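/- A plane graph is a finite simple graph with a fixed (combinatorial) planar embedding, i.e. with a clockwise cyclic order of the incident edges at each vertex that satisfies Euler's formula; a plane graph $T$ is a spanning subgraph of a plane graph $G$, written $T\subseteq G$, if it has the same vertex set, $E(T)\subseteq E(G)$, and the embedding of $T$ is the restriction of the embedding of $G$. A graph is $3$-connected if it has at least $4$ vertices and stays connected whenever at most two vertices are removed. Let $n_i(T)$ denote the number of vertices of degree $i$ of $T$. Theorem. Let $T$ be an $n$-vertex plane tree with $n\ge 4$. Then there is a $3$-connected plane graph $G$ with $T\subseteq G$ and $$|E(G)|-|E(T)|=\left\lceil \frac{2n_1(T)+n_2(T)}{2}\right\rceil .$$ This number is the least possible: every $3$-connected graph $H$, planar or not, that contains $T$ as a spanning subgraph satisfies $|E(H)|-|E(T)|\ge\lceil (2n_1(T)+n_2(T))/2\rceil$. Moreover, such a $G$ can be computed in $O(n)$ time: there are a single program of a unit-cost random access machine (constants, addition, truncated subtraction, indirect reads and writes, comparisons, branches and loops) and constants $c,w$ such that, for every $n\ge 4$ and every $n$-vertex plane tree $T$ with vertices $0,\dots,n-1$, given as a list of half-edges in an arbitrary order, each with its tail, its reversal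 and its clockwise successor around its tail, the program halts after at most $cn$ steps with such a $G$ in memory in the same format, and never writes a number larger than $wn$ (so that words of $\log_2 n+O(1)$ bits suffice). -/

import Mathlib

/-! ### Plane graphs, given by their rotation systems -/

/-- The reversal of half-edges (darts), as a permutation. -/
def dartReversal {V : Type*} (G : SimpleGraph V) : Equiv.Perm G.Dart :=
  SimpleGraph.Dart.symm_involutive.toPerm SimpleGraph.Dart.symm

/-- The face permutation of a rotation `rot`: traverse a half-edge, then leave its head along the
next half-edge in the rotation. Its cycles are the boundary walks of the faces. -/
def facePerm {V : Type*} {G : SimpleGraph V} (rot : Equiv.Perm G.Dart) : Equiv.Perm G.Dart :=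
  (dartReversal G).trans rot

/-- The number of boundary walks of a rotation system: the cycles of the face permutation, and
one trivial walk for each isolated vertex. -/
noncomputable def boundaryWalkCount {V : Type*} {G : SimpleGraph V}
    (rot : Equiv.Perm G.Dart) : ℕ :=
  Nat.card (Quotient (Equiv.Perm.SameCycle.setoid (facePerm rot))) +
    {v : V | ∀ u, ¬ G.Adj v u}.ncard

/-- A (finite, simple) plane graph: a simple graph with a combinatorial planar embedding, that is,
at every vertex a cyclic order (say, clockwise) of the half-edges that leave it, such that Euler's
formula holds. Every component contributes `2 - 2 * genus` to
`vertices - edges + boundary walks`, so that `euler` says that all components have genus zero. -/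
structure PlaneGraph (V : Type*) [Finite V] where
  /-- the underlying abstract graph -/
  graph : SimpleGraph V
  /-- the next half-edge around the same tail -/
  rot : Equiv.Perm graph.Dart
  rot_fst : ∀ d, (rot d).fst = d.fst
  rot_cyclic : ∀ d e, d.fst = e.fst → rot.SameCycle d e
  euler : Nat.card V + boundaryWalkCount rot =
    graph.edgeSet.ncard + 2 * Nat.card graph.ConnectedComponent

/-- A half-edge of a spanning subgraph, seen in the larger graph. -/
def dartOfLE {V : Type*} {T G : SimpleGraph V} (h : T ≤ G) (d : T.Dart) : G.Dart :=
  ⟨d.toProd, h d.adj⟩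

/-- `T` is a spanning subgraph of `G`, embedded in the same way: around each vertex, the successor
of a half-edge of `T` in the rotation of `T` is the first half-edge of `T` that follows it
in the rotation of `G`. -/
def PlaneGraph.IsSpanningSubgraph {V : Type*} [Finite V] (T G : PlaneGraph V) : Prop :=
  ∃ h : T.graph ≤ G.graph, ∀ d : T.graph.Dart, ∃ k : ℕ, 0 < k ∧
    (G.rot ^ k) (dartOfLE h d) = dartOfLE h (T.rot d) ∧
    ∀ j : ℕ, 0 < j → j < k → (G.rot ^ j) (dartOfLE h d) ∉ Set.range (dartOfLE h)

/-- `G` is `k`-connected: it has more than `k` vertices, and no removal of fewer than `k` vertices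
disconnects it. -/
def SimpleGraph.IsKConnected {V : Type*} (G : SimpleGraph V) (k : ℕ) : Prop :=
  k < Nat.card V ∧ ∀ S : Finset V, S.card < k → (G.induce (S : Set V)ᶜ).Connected

/-- `G.degreeCount i` is the number of vertices of degree `i`. -/
noncomputable def SimpleGraph.degreeCount {V : Type*} (G : SimpleGraph V) (i : ℕ) : ℕ :=
  {v : V | (G.neighborSet v).ncard = i}.ncard

/-- `⌈(2 n₁ + n₂) / 2⌉`, where `nᵢ` is the number of vertices of degree `i`. -/
noncomputable def SimpleGraph.augmentationBound {V : Type*} (T : SimpleGraph V) : ℤ :=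
  ⌈(2 * (T.degreeCount 1 : ℚ) + (T.degreeCount 2 : ℚ)) / 2⌉

/-- `G` is a 3-connected plane graph that contains the plane graph `T` as a spanning subgraph
and has exactly `⌈(2 n₁(T) + n₂(T)) / 2⌉` edges more than `T`. -/
def PlaneGraph.IsAugmentation {V : Type*} [Finite V] (T G : PlaneGraph V) : Prop :=
  T.IsSpanningSubgraph G ∧ G.graph.IsKConnected 3 ∧
    (G.graph.edgeSet.ncard : ℤ) - T.graph.edgeSet.ncard = T.graph.augmentationBound

/-! ### A unit-cost random access machine -/

/-- The memory of the machine: registers, and arrays `arr 0`, `arr 1`, … of cells. A program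
names only finitely many registers and arrays. -/
structure RamState where
  reg : ℕ → ℕ
  arr : ℕ → ℕ → ℕ

/-- Programs of the machine. The numbers `r`, `a`, `b`, `i` name registers, `A` an array. -/
inductive RamProgram : Type
  /-- do nothing -/
  | skip : RamProgram
  /-- `r := k` -/
  | const (r k : ℕ) : RamProgram
  /-- `r := a + b` -/
  | add (r a b : ℕ) : RamProgram
  /-- `r := a - b`, truncated at zero -/
  | sub (r a b : ℕ) : RamProgram
  /-- `r := A[i]`, at the address held by register `i` -/
  | load (r A i : ℕ) : RamProgram
  /-- `A[i] := r`, at the address held by register `i` -/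
  | store (A i r : ℕ) : RamProgram
  /-- first `P`, then `Q` -/
  | seq (P Q : RamProgram) : RamProgram
  /-- if `a < b` then `P` else `Q` -/
  | ite (a b : ℕ) (P Q : RamProgram) : RamProgram
  /-- while `a < b` do `P` -/
  | loop (a b : ℕ) (P : RamProgram) : RamProgram

/-- Overwrite the register `r` by `x`. -/
def RamState.setReg (s : RamState) (r x : ℕ) : RamState :=
  { s with reg := Function.update s.reg r x }

/-- Overwrite the cell `i` of the array `A` by `x`. -/
def RamState.setArr (s : RamState) (A i x : ℕ) : RamState :=
  { s with arr := Function.update s.arr A (Function.update (s.arr A) i x) }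

/-- `RamExec w P s t s'`: on a machine whose words hold the numbers `0, …, w`, the program `P`,
started in `s`, halts after exactly `t` steps in `s'`. Every elementary instruction and every test
of a branch or a loop is one step. An instruction that would write a number above `w` has no
execution. -/
inductive RamExec (w : ℕ) : RamProgram → RamState → ℕ → RamState → Prop
  | skip (s : RamState) : RamExec w .skip s 1 s
  | const (s : RamState) (r k : ℕ) (h : k ≤ w) :
      RamExec w (.const r k) s 1 (s.setReg r k)
  | add (s : RamState) (r a b : ℕ) (h : s.reg a + s.reg b ≤ w) :
      RamExec w (.add r a b) s 1 (s.setReg r (s.reg a + s.reg b))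
  | sub (s : RamState) (r a b : ℕ) (h : s.reg a - s.reg b ≤ w) :
      RamExec w (.sub r a b) s 1 (s.setReg r (s.reg a - s.reg b))
  | load (s : RamState) (r A i : ℕ) (h : s.arr A (s.reg i) ≤ w) :
      RamExec w (.load r A i) s 1 (s.setReg r (s.arr A (s.reg i)))
  | store (s : RamState) (A i r : ℕ) (h : s.reg r ≤ w) :
      RamExec w (.store A i r) s 1 (s.setArr A (s.reg i) (s.reg r))
  | seq {P Q : RamProgram} {s s' s'' : RamState} {t t' : ℕ}
      (hP : RamExec w P s t s') (hQ : RamExec w Q s' t' s'') :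
      RamExec w (.seq P Q) s (t + t') s''
  | iteTrue {a b : ℕ} {P Q : RamProgram} {s s' : RamState} {t : ℕ}
      (h : s.reg a < s.reg b) (hP : RamExec w P s t s') :
      RamExec w (.ite a b P Q) s (t + 1) s'
  | iteFalse {a b : ℕ} {P Q : RamProgram} {s s' : RamState} {t : ℕ}
      (h : ¬ s.reg a < s.reg b) (hQ : RamExec w Q s t s') :
      RamExec w (.ite a b P Q) s (t + 1) s'
  | loopStop {a b : ℕ} {P : RamProgram} {s : RamState}
      (h : ¬ s.reg a < s.reg b) : RamExec w (.loop a b P) s 1 s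
  | loopStep {a b : ℕ} {P : RamProgram} {s s' s'' : RamState} {t t' : ℕ}
      (h : s.reg a < s.reg b) (hP : RamExec w P s t s')
      (hL : RamExec w (.loop a b P) s' t' s'') :
      RamExec w (.loop a b P) s (t + 1 + t') s''

/-- The memory holds a half-edge list of the plane graph `G` on `0, …, n - 1`: register 0 holds
`n`, register 1 the number `D` of half-edges, and, for some numbering of the half-edges by
`0, …, D - 1`, cell `h` of the arrays 0, 1 and 2 holds the tail of the half-edge `h`, the number
of its reversal, and the number of its successor in the rotation around its tail. -/
def RamState.Holds (s : RamState) {n : ℕ} (G : PlaneGraph (Fin n)) : Prop :=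
  s.reg 0 = n ∧ ∃ num : Fin (s.reg 1) ≃ G.graph.Dart, ∀ h : Fin (s.reg 1),
    s.arr 0 h = (num h).fst ∧
    s.arr 1 h = num.symm (num h).symm ∧
    s.arr 2 h = num.symm (G.rot (num h))

/-- An initial memory with input `G`: a half-edge list of `G`, and zeros everywhere else. -/
def RamState.IsInput (s : RamState) {n : ℕ} (G : PlaneGraph (Fin n)) : Prop :=
  s.Holds G ∧ (∀ r, 2 ≤ r → s.reg r = 0) ∧ ∀ A i, 3 ≤ A ∨ s.reg 1 ≤ i → s.arr A i = 0

/-! Lower bound. A vertex with at most two neighbours would be cut off by removing them, so all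
degrees of a 3-connected graph are at least 3. Hence a leaf of `T` misses two edges and a vertex of
degree 2 misses one, and a new edge meets at most two of these demands
(`IsKConnected.augmentationBound_le`).

Construction. Root the tree at a leaf `r` and walk around its only face. A branch is a vertex `w`
with all its descendants. When the walk leaves a branch, chords inside it have met all its demands
exactly, except for two or three that are pending at corners `a`, `b`, `c`, in this order on the
outer boundary. A leaf has two pending demands. A vertex with one child adds its own demand: 2
pending demands become 3 without a chord, and 3 become 2 by a chord from the last corner to the
vertex. Several children are folded from left to right: a chord joins the last corner on the left to
the first corner on the right, and a second chord is nested around it if both sides have three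
pending demands. So 2+2 and 3+3 give 2, while 2+3 and 3+2 give 3. No chord crosses another, since
each one only cuts a piece off the outer face (`HasFaces.chord`). At the end, two or three chords
close the last branch at `r`. If three demands are pending, the total demand is odd and one chord
end is in surplus; this is the rounding in the bound.

Connectivity. The invariant is `FullBranch`. After the removal of two vertices, every remaining part
of the branch contains a surviving exit `w`, `a`, `b` or `c` (`two`). One vertex does not disconnect
the branch, except that in kinds 3 and 4 there may be several parts, each of which contains `w` and
`a`, or `b` and `c` (`split`). The kind of a branch with three pending demands records its origin: 3
for a vertex with one child, where `a` is `w` itself; 4 for 2+3; 5 for 3+2. In kinds 3 and 4 the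
closing also uses a chord from `w` to `c`, which links the two sorts of parts. The lemmas that carry
this are `FullBranch.unary_two`, `FullBranch.unary_three`, the four `PartialBranch.merge_*` and
`FullBranch.closed_of_root`.

Algorithm. Each arrival of the walk takes constant work (`Config.step`). Its correctness is an
induction along the boundary walk (`Shape.visits`, `Visited.finish`), and a loop-free program
simulates it (`RamProgram.run_arrive`). That program adds nothing but ones, so its linear running
time also bounds every number it writes. The existence of the augmentation is obtained by running
the program. -/

/-! ### Connectivity after removal of vertices -/

/-- `C` is closed under the adjacencies of `E` between members of `A`. -/
def ClosedIn (E : ℕ → ℕ → Prop) (A C : Set ℕ) : Prop :=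
  ∀ u v, E u v → u ∈ A → v ∈ A → u ∈ C → v ∈ C

theorem ClosedIn.mono {E : ℕ → ℕ → Prop} {A B C : Set ℕ} (h : ClosedIn E A C) (hB : B ⊆ A) :
    ClosedIn E B C :=
  fun u v e hu hv => h u v e (hB hu) (hB hv)

theorem ClosedIn.anti {E F : ℕ → ℕ → Prop} {A C : Set ℕ} (h : ClosedIn F A C)
    (hE : ∀ u v, E u v → F u v) : ClosedIn E A C :=
  fun u v e hu hv => h u v (hE u v e) hu hv

/-- An edge out of the complement, reversed, is an edge into it. This is the recurring device for
connectedness: if every closed set with a surviving point contains one fixed vertex, then no closed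
set and its complement can both have surviving points. -/
theorem ClosedIn.compl {E : ℕ → ℕ → Prop} {A C : Set ℕ} (h : ClosedIn E A C)
    (hs : ∀ u v, E u v → E v u) : ClosedIn E A Cᶜ :=
  fun u v e hu hv hc hv' => hc (h v u (hs u v e) hv hu hv')

/-- The part `S` of a graph hangs together, and it reaches its exits `w`, `a`, `b`, `c` after the
removal of vertices. -/
structure Hangs (E : ℕ → ℕ → Prop) (S : Set ℕ) (w a b c : ℕ) : Prop where
  hw : w ∈ S
  ha : a ∈ S
  hb : b ∈ S
  hc : c ∈ S
  conn : ∀ C, ClosedIn E S C → ∀ z ∈ S, z ∈ C → ∀ t ∈ S, t ∈ C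
  conn_root : ∀ C, ClosedIn E (S \ {w}) C → ∀ z ∈ S, z ≠ w → z ∈ C → ∀ t ∈ S, t ≠ w → t ∈ C
  one : ∀ x ∈ S, x ≠ w → ∀ C, ClosedIn E (S \ {x}) C → ∀ z ∈ S, z ≠ x → z ∈ C →
    w ∈ C ∨ (b ∈ C ∧ c ∈ C ∧ b ≠ x ∧ c ≠ x)
  two : ∀ x ∈ S, ∀ y ∈ S, ∀ C, ClosedIn E (S \ {x, y}) C → ∀ z ∈ S, z ≠ x → z ≠ y → z ∈ C →
    (w ∈ C ∧ w ≠ x ∧ w ≠ y) ∨ (a ∈ C ∧ a ≠ x ∧ a ≠ y) ∨ (b ∈ C ∧ b ≠ x ∧ b ≠ y) ∨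
      (c ∈ C ∧ c ≠ x ∧ c ≠ y)

/-- The connectivity of a branch that still misses children of its root `w`. -/
structure PartialBranch (E : ℕ → ℕ → Prop) (S : Set ℕ) (w k a b c : ℕ) : Prop
    extends Hangs E S w a b c where
  aw : a ≠ w
  bw : b ≠ w
  cw : c ≠ w
  ab_two : k = 2 → b = a
  ab : k ≠ 2 → a ≠ b
  ac : k ≠ 2 → a ≠ c

/-- The connectivity of a complete branch with the root `w`. Its kind `k` is `2` if it has the two
pending vertices `a`, `c`, and `3`, `4` or `5` if it has the three pending vertices
`a`, `b`, `c`. -/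
structure FullBranch (E : ℕ → ℕ → Prop) (S : Set ℕ) (w k a b c : ℕ) : Prop
    extends Hangs E S w a b c where
  split : ∀ x ∈ S, ∀ C, ClosedIn E (S \ {x}) C → ∀ z ∈ S, z ≠ x → z ∈ C →
    (∀ t ∈ S, t ≠ x → t ∈ C) ∨ (k ≠ 2 ∧ k ≠ 5 ∧ x ≠ w ∧ x ≠ a ∧ x ≠ b ∧ x ≠ c ∧
      ((w ∈ C ∧ a ∈ C) ∨ (b ∈ C ∧ c ∈ C)))
  kind : k = 2 ∨ k = 3 ∨ k = 4 ∨ k = 5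
  two_four : k = 4 → ∀ y ∈ S, ∀ C, ClosedIn E (S \ {w, y}) C → ∀ z ∈ S, z ≠ w → z ≠ y → z ∈ C →
    (a ∈ C ∧ a ≠ y) ∨ (b ∈ C ∧ b ≠ y)
  ab_two : k = 2 → b = a
  distinct_two : k = 2 → (∀ v ∈ S, v = w) ∨ (a ≠ w ∧ c ≠ w ∧ a ≠ c)
  distinct : k ≠ 2 → a ≠ b ∧ a ≠ c ∧ b ≠ w ∧ c ≠ w
  aw_three : k = 3 → a = w ∧ ((∀ v ∈ S, v = w ∨ v = c) ∨ b ≠ c)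
  aw : k = 4 ∨ k = 5 → a ≠ w
  bc : k = 5 → b ≠ c

/-! ### Complete branches: a single vertex, and a new root with one child -/

section Branches

variable {E : ℕ → ℕ → Prop} {S S' : Set ℕ} {w w' k k' a b c a' b' c' : ℕ}

/-- Both missing edges of a leaf are pending at the leaf itself, so all exits coincide. -/
theorem FullBranch.leaf (E : ℕ → ℕ → Prop) (w : ℕ) : FullBranch E {w} w 2 w w w := by
  constructor
  · constructor <;> simp_all
  all_goals simp_all

theorem FullBranch.conn_of_two (h : FullBranch E S w k a b c) (hk : k = 2 ∨ k = 5) :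
    ∀ x ∈ S, ∀ C, ClosedIn E (S \ {x}) C → ∀ z ∈ S, z ≠ x → z ∈ C → ∀ t ∈ S, t ≠ x → t ∈ C := by
  intro x hx C hC z hz hzx hzC
  have := h.split x hx C hC z hz hzx hzC
  grind

/-- The new root hangs on `w` alone. If `w` is removed, `split` leaves the rest of `S` in one piece,
which contains `b` and `c` unless it is empty. If another vertex of `S` is removed, a part contains
`w`, and so reaches `w'`, or it contains `b` and `c`. This explains the second alternative of `one`.
-/
theorem Hangs.insert_root (h : FullBranch E S w k a b c) (hr : w' ∉ S) (e : E w' w)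
    (hs : ∀ u v, E u v → E v u) : Hangs E (insert w' S) w' a b c := by
  have hw := h.hw; have ha := h.ha; have hb := h.hb; have hc := h.hc
  have e' := hs _ _ e
  have hd2 := h.distinct_two
  have hd := h.distinct
  have hab := h.ab_two
  refine ⟨by simp, by simp [ha], by simp [hb], by simp [hc], ?_, ?_, ?_, ?_⟩
  · intro C hC z hz hzC
    have h1 := h.conn C (hC.mono (by grind))
    have h2 := hC _ _ e (by grind) (by grind)
    have h3 := hC _ _ e' (by grind) (by grind)
    grind
  · intro C hC z hz hzx hzC
    have h1 := h.conn C (hC.mono (by grind))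
    grind
  · intro x hx hxw C hC z hz hzx hzC
    have h1 := h.split x (by grind) C (hC.mono (by grind))
    by_cases hxw' : x = w
    · grind
    · have h3 := hC _ _ e' (by grind) (by grind)
      grind
  · intro x hx y hy C hC z hz hzx hzy hzC
    by_cases hxr : x = w'
    · by_cases hyr : y = w'
      · have h1 := h.conn C (hC.mono (by grind))
        grind
      · have h1 := h.split y (by grind) C (hC.mono (by grind))
        grind
    · by_cases hyr : y = w'
      · have h1 := h.split x (by grind) C (hC.mono (by grind))
        grind
      · have h1 := h.two x (by grind) y (by grind) C (hC.mono (by grind))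
        by_cases hw : x ≠ w ∧ y ≠ w
        · have h3 := hC _ _ e' (by grind) (by grind)
          grind
        · grind

/-- The demand of the new root joins the two pending ones, so `w'` becomes the first exit. The only
vertex that can disconnect the result is `w`: it separates `w'`, which is root and first exit at
once, from the piece with the two old exits. -/
theorem FullBranch.unary_two (h : FullBranch E S w 2 a b c) (hr : w' ∉ S) (e : E w' w)
    (hs : ∀ u v, E u v → E v u) : FullBranch E (insert w' S) w' 3 w' a c := by
  have hw := h.hw; have ha := h.ha; have hb := h.hb; have hc := h.hc
  have e' := hs _ _ e
  have hd2 := h.distinct_two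
  have hab := h.ab_two
  have H := Hangs.insert_root h hr e hs
  refine ⟨⟨by simp, by simp, by simp [ha], by simp [hc], H.conn, H.conn_root, ?_, ?_⟩, ?_,
    by simp, by simp, by simp, by simp, by grind, by grind, by simp, by simp⟩
  · have := H.one
    grind
  · intro x hx y hy C hC z hz hzx hzy hzC
    have := H.two x hx y hy C hC z hz hzx hzy hzC
    grind
  · intro x hx C hC z hz hzx hzC
    by_cases hxr : x = w'
    · have := H.conn_root C (by grind) z hz
      grind
    · have h1 := h.split x (by grind) C (hC.mono (by grind))
      by_cases hxw' : x = w
      · grind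
      · have h3 := hC _ _ e' (by grind) (by grind)
        have h3 := hC _ _ e (by grind) (by grind)
        grind

/-- The new root is linked to `w` and to `c`, hence to both sorts of parts that `split` allows, so
no cut vertex remains. Its own demand and the one at `c` are met by the chord. -/
theorem FullBranch.unary_three (h : FullBranch E S w k a b c) (hk : k ≠ 2) (hr : w' ∉ S)
    (e : E w' w) (f : E w' c) (hs : ∀ u v, E u v → E v u) :
    FullBranch E (insert w' S) w' 2 a a b := by
  have hw := h.hw; have ha := h.ha; have hb := h.hb; have hc := h.hc
  have e' := hs _ _ e
  have f' := hs _ _ f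
  have hd := h.distinct hk
  have H := Hangs.insert_root h hr e hs
  have hsplit : ∀ x ∈ insert w' S, ∀ C, ClosedIn E (insert w' S \ {x}) C →
      ∀ z ∈ insert w' S, z ≠ x → z ∈ C → ∀ t ∈ insert w' S, t ≠ x → t ∈ C := by
    have key : ∀ x ∈ S, ∀ C, ClosedIn E (insert w' S \ {x}) C →
      ∀ z ∈ insert w' S, z ≠ x → z ∈ C → w' ∈ C := by
      intro x hx C hC z hz hzx hzC
      have h1 := h.split x (by grind) C (hC.mono (by grind))
      by_cases hxw' : x = w
      · have h3 := hC _ _ f' (by grind) (by grind)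
        grind
      · have h3 := hC _ _ e' (by grind) (by grind)
        by_cases hxc : x = c
        · grind
        · have h4 := hC _ _ f' (by grind) (by grind)
          grind
    intro x hx C hC z hz hzx hzC t ht htx
    by_cases hxr : x = w'
    · have := H.conn_root C (by grind) z hz
      grind
    · have h1 := key x (by grind) C hC z hz hzx hzC
      -- If `t` were outside `C`, the complement would also be closed and would also contain `w'`.
      have h2 := key x (by grind) Cᶜ (hC.compl hs) t ht htx
      grind
  refine ⟨⟨by simp, by simp [ha], by simp [ha], by simp [hb], H.conn, H.conn_root, ?_, ?_⟩, ?_,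
    by simp, by simp, by simp, by grind, by simp, by simp, by simp, by simp⟩
  · intro x hx hxw C hC z hz hzx hzC
    exact Or.inl (hsplit x hx C hC z hz hzx hzC _ (by simp) hxw.symm)
  · intro x hx y hy C hC z hz hzx hzy hzC
    by_cases hc' : x = c ∨ y = c
    · have := H.two x hx y hy C hC z hz hzx hzy hzC
      grind
    by_cases hw' : x = w' ∨ y = w'
    · by_cases hx' : x = w'
      · by_cases hy' : y = w'
        · have h1 := h.conn C (hC.mono (by grind))
          grind
        · have h1 := h.split y (by grind) C (hC.mono (by grind))
          grind
      · have h1 := h.split x (by grind) C (hC.mono (by grind))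
        grind
    · have h4 := hC _ _ f' (by grind) (by grind)
      have := H.two x hx y hy C hC z hz hzx hzy hzC
      grind
  · intro x hx C hC z hz hzx hzC
    exact Or.inl (hsplit x hx C hC z hz hzx hzC)

end Branches

/-! ### Joining a further child to an incomplete branch -/

section Merge

variable {E : ℕ → ℕ → Prop} {S S' : Set ℕ} {w w' k k' a b c a' b' c' : ℕ}

theorem FullBranch.toPartialBranch (h : FullBranch E S w k a b c) (hr : w' ∉ S) (e : E w' w)
    (hs : ∀ u v, E u v → E v u) : PartialBranch E (insert w' S) w' k a b c := by
  have hw := h.hw; have ha := h.ha; have hb := h.hb; have hc := h.hc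
  exact ⟨Hangs.insert_root h hr e hs, by grind, by grind, by grind, h.ab_two,
    fun hk => (h.distinct hk).1, fun hk => (h.distinct hk).2.1⟩

/-- The result of a merge is an incomplete branch again if more children follow. Incomplete branches
keep their exits off the root, so kind 3 does not occur here. -/
theorem FullBranch.partialBranch (h : FullBranch E S w k a b c) (ha : a ≠ w) :
    PartialBranch E S w k a b c := by
  have h1 := h.distinct_two
  have h2 := h.distinct
  have h3 := h.ab_two
  have h4 := h.hw
  have h5 := h.ha
  exact ⟨h.toHangs, ha, by grind, by grind, h.ab_two,
    fun hk => (h.distinct hk).1, fun hk => (h.distinct hk).2.1⟩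

-- The two halves are linked by the edge `w w'` and by the chord from `c` to `a'`. Since `c ≠ w`,
-- and `a' ≠ w'` unless the right half is a single vertex, one removed vertex cannot destroy both
-- links and leave something to be cut off.
set_option maxHeartbeats 1000000 in
theorem PartialBranch.merge_two_two (h : PartialBranch E S w 2 a b c)
    (h' : FullBranch E S' w' 2 a' b' c') (hd : ∀ v ∈ S, v ∉ S') (e : E w w') (f : E c a')
    (hs : ∀ u v, E u v → E v u) : FullBranch E (S ∪ S') w 2 a b c' := by
  have hw := h.hw; have ha := h.ha; have hb := h.hb; have hc := h.hc
  have hw' := h'.hw; have ha' := h'.ha; have hb' := h'.hb; have hc' := h'.hc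
  have e' := hs _ _ e
  have f' := hs _ _ f
  have hab := h.ab_two
  have haw := h.aw
  have hcw := h.cw
  have hab' := h'.ab_two
  have hd2 := h'.distinct_two
  have hsplit : ∀ x ∈ S ∪ S', ∀ C, ClosedIn E ((S ∪ S') \ {x}) C → ∀ z ∈ S ∪ S', z ≠ x →
      z ∈ C → ∀ t ∈ S ∪ S', t ≠ x → t ∈ C := by
    intro x hx C hC z hz hzx hzC
    rcases hx with hx | hx
    · have h2 := h'.conn C (hC.mono (by grind))
      have f1 : x ≠ c → c ∈ C → a' ∈ C := fun h => hC _ _ f (by grind) (by grind)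
      have f2 : x ≠ c → a' ∈ C → c ∈ C := fun h => hC _ _ f' (by grind) (by grind)
      by_cases hxw : x = w
      · have h1 := h.conn_root C (hC.mono (by grind))
        grind
      · have h1 := h.one x hx hxw C (hC.mono (by grind))
        -- A part of the left half without `w` contains `c`, so the chord leads it to the right half
        -- and back to `w` along the tree edge. This applies to `C` and to its complement.
        have h1' := h.one x hx hxw Cᶜ ((hC.compl hs).mono (by grind))
        have e1 := hC _ _ e (by grind) (by grind)
        have e2 := hC _ _ e' (by grind) (by grind)
        grind
    · have h1 := h.conn C (hC.mono (by grind))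
      have h2 := h'.conn_of_two (by simp) x hx C (hC.mono (by grind))
      have f1 : x ≠ a' → c ∈ C → a' ∈ C := fun h => hC _ _ f (by grind) (by grind)
      have f2 : x ≠ a' → a' ∈ C → c ∈ C := fun h => hC _ _ f' (by grind) (by grind)
      have e1 : x ≠ w' → w ∈ C → w' ∈ C := fun h => hC _ _ e (by grind) (by grind)
      have e2 : x ≠ w' → w' ∈ C → w ∈ C := fun h => hC _ _ e' (by grind) (by grind)
      grind
  refine ⟨⟨by simp [hw], by simp [ha], by simp [hb], by simp [hc'], ?_, ?_, ?_, ?_⟩, ?_,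
    by simp, by simp, by grind, by grind, by simp, by simp, by simp, by simp⟩
  · intro C hC z hz hzC
    have h1 := h.conn C (hC.mono (by grind))
    have h2 := h'.conn C (hC.mono (by grind))
    have e1 := hC _ _ e (by grind) (by grind)
    have e2 := hC _ _ e' (by grind) (by grind)
    grind
  · intro C hC z hz hzw
    exact hsplit w (by grind) C hC z hz hzw
  · intro x hx hxw C hC z hz hzx hzC
    exact Or.inl (hsplit x hx C hC z hz hzx hzC _ (by simp [hw]) hxw.symm)
  -- One removed vertex in each half; by symmetry in `x` and `y` this serves both mixed cases below.
  · have key : ∀ x ∈ S, ∀ y ∈ S', ∀ C, ClosedIn E ((S ∪ S') \ {x, y}) C → ∀ z ∈ S ∪ S',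
        z ≠ x → z ≠ y → z ∈ C → (w ∈ C ∧ w ≠ x ∧ w ≠ y) ∨ (a ∈ C ∧ a ≠ x ∧ a ≠ y) ∨
        (c' ∈ C ∧ c' ≠ x ∧ c' ≠ y) := by
      clear hsplit
      intro x hx y hy C hC z hz hzx hzy hzC
      have h2 := h'.conn_of_two (by simp) y hy C (hC.mono (by grind))
      have e2 : x ≠ w → y ≠ w' → w' ∈ C → w ∈ C := fun h1 h2 => hC _ _ e' (by grind) (by grind)
      have f2 : x ≠ c → y ≠ a' → a' ∈ C → c ∈ C := fun h1 h2 => hC _ _ f' (by grind) (by grind)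
      by_cases hxw : x = w
      · have h1 := h.conn_root C (hC.mono (by grind))
        grind
      · have h1 := h.one x hx hxw C (hC.mono (by grind))
        grind
    clear hsplit
    intro x hx y hy C hC z hz hzx hzy hzC
    rcases hx with hx | hx <;> rcases hy with hy | hy
    · have h1 := h.two x hx y hy C (hC.mono (by grind))
      have h2 := h'.conn C (hC.mono (by grind))
      have f1 : x ≠ c → y ≠ c → c ∈ C → a' ∈ C := fun h1 h2 => hC _ _ f (by grind) (by grind)
      grind
    · have := key x hx y hy C hC z hz hzx hzy hzC
      grind
    · have := key y hy x hx C (hC.mono (by grind)) z hz hzy hzx hzC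
      grind
    · have h1 := h.conn C (hC.mono (by grind))
      have h2 := h'.two x hx y hy C (hC.mono (by grind))
      have e2 : x ≠ w' → y ≠ w' → w' ∈ C → w ∈ C := fun h1 h2 => hC _ _ e' (by grind) (by grind)
      have f2 : x ≠ a' → y ≠ a' → a' ∈ C → c ∈ C := fun h1 h2 => hC _ _ f' (by grind) (by grind)
      grind
  · intro x hx C hC z hz hzx hzC
    exact Or.inl (hsplit x hx C hC z hz hzx hzC)

-- A cut vertex of the right half may survive the merge. Its parts with `w'` and `a'` are linked to
-- the left half, where `w` and `a` lie, and its other parts contain `b'` and `c'`: exactly the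
-- alternative that `split` allows in kind 4.
set_option maxHeartbeats 1000000 in
theorem PartialBranch.merge_two_three (h : PartialBranch E S w 2 a b c)
    (h' : FullBranch E S' w' k' a' b' c') (hk' : k' ≠ 2) (hd : ∀ v ∈ S, v ∉ S') (e : E w w')
    (f : E c a') (hs : ∀ u v, E u v → E v u) : FullBranch E (S ∪ S') w 4 a b' c' := by
  have hw := h.hw; have ha := h.ha; have hb := h.hb; have hc := h.hc
  have hw' := h'.hw; have ha' := h'.ha; have hb' := h'.hb; have hc' := h'.hc
  have e' := hs _ _ e
  have f' := hs _ _ f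
  have hab := h.ab_two
  have haw := h.aw
  have hcw := h.cw
  have hd2 := h'.distinct hk'
  have hconn : ∀ x ∈ S, ∀ C, ClosedIn E ((S ∪ S') \ {x}) C → ∀ z ∈ S ∪ S', z ≠ x →
      z ∈ C → ∀ t ∈ S ∪ S', t ≠ x → t ∈ C := by
    intro x hx C hC z hz hzx hzC
    have h2 := h'.conn C (hC.mono (by grind))
    have f1 : x ≠ c → c ∈ C → a' ∈ C := fun h => hC _ _ f (by grind) (by grind)
    have f2 : x ≠ c → a' ∈ C → c ∈ C := fun h => hC _ _ f' (by grind) (by grind)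
    by_cases hxw : x = w
    · have h1 := h.conn_root C (hC.mono (by grind))
      grind
    · have h1 := h.one x hx hxw C (hC.mono (by grind))
      have h1' := h.one x hx hxw Cᶜ ((hC.compl hs).mono (by grind))
      have e1 := hC _ _ e (by grind) (by grind)
      have e2 := hC _ _ e' (by grind) (by grind)
      grind
  have hsplit : ∀ x ∈ S', ∀ C, ClosedIn E ((S ∪ S') \ {x}) C → ∀ z ∈ S ∪ S', z ≠ x →
      z ∈ C → (∀ t ∈ S ∪ S', t ≠ x → t ∈ C) ∨ (x ≠ w ∧ x ≠ a ∧ x ≠ b' ∧ x ≠ c' ∧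
      ((w ∈ C ∧ a ∈ C) ∨ (b' ∈ C ∧ c' ∈ C))) := by
    intro x hx C hC z hz hzx hzC
    have h1 := h.conn C (hC.mono (by grind))
    have h2 := h'.split x hx C (hC.mono (by grind))
    have f1 : x ≠ a' → c ∈ C → a' ∈ C := fun h => hC _ _ f (by grind) (by grind)
    have f2 : x ≠ a' → a' ∈ C → c ∈ C := fun h => hC _ _ f' (by grind) (by grind)
    have e1 : x ≠ w' → w ∈ C → w' ∈ C := fun h => hC _ _ e (by grind) (by grind)
    have e2 : x ≠ w' → w' ∈ C → w ∈ C := fun h => hC _ _ e' (by grind) (by grind)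
    by_cases hxw : x = w'
    · grind
    · grind
  -- In kind 4 the closing links the last exit to `w` only, so once `w` is removed the first two
  -- exits must suffice. They do: a part of the right half contains `b'`, or it leads through `a'`
  -- and `c` to `a`.
  have hfour : ∀ y ∈ S ∪ S', ∀ C, ClosedIn E ((S ∪ S') \ {w, y}) C → ∀ z ∈ S ∪ S', z ≠ w →
      z ≠ y → z ∈ C → (a ∈ C ∧ a ≠ y) ∨ (b' ∈ C ∧ b' ≠ y) := by
    clear hconn hsplit
    intro y hy C hC z hz hzw hzy hzC
    rcases hy with hy | hy
    · have h2 := h'.conn C (hC.mono (by grind))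
      have f1 : y ≠ c → c ∈ C → a' ∈ C := fun h => hC _ _ f (by grind) (by grind)
      have h1 := h.two w hw y hy C (hC.mono (by grind))
      grind
    · have h1 := h.conn_root C (hC.mono (by grind))
      have h2 := h'.split y hy C (hC.mono (by grind))
      have f2 : y ≠ a' → a' ∈ C → c ∈ C := fun h => hC _ _ f' (by grind) (by grind)
      by_cases hyb : y = b'
      · grind
      · grind
  refine ⟨⟨by simp [hw], by simp [ha], by simp [hb'], by simp [hc'], ?_, ?_, ?_, ?_⟩, ?_,
    by simp, fun _ => hfour, by simp, by simp, by grind, by simp, by grind, by simp⟩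
  · intro C hC z hz hzC
    have h1 := h.conn C (hC.mono (by grind))
    have h2 := h'.conn C (hC.mono (by grind))
    have e1 := hC _ _ e (by grind) (by grind)
    have e2 := hC _ _ e' (by grind) (by grind)
    grind
  · intro C hC z hz hzw
    exact hconn w (by grind) C hC z hz hzw
  · intro x hx hxw C hC z hz hzx hzC
    rcases hx with hx | hx
    · exact Or.inl (hconn x hx C hC z hz hzx hzC _ (by simp [hw]) hxw.symm)
    · have := hsplit x hx C hC z hz hzx hzC
      grind
  · have key : ∀ x ∈ S, ∀ y ∈ S', ∀ C, ClosedIn E ((S ∪ S') \ {x, y}) C → ∀ z ∈ S ∪ S',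
        z ≠ x → z ≠ y → z ∈ C → (w ∈ C ∧ w ≠ x ∧ w ≠ y) ∨ (a ∈ C ∧ a ≠ x ∧ a ≠ y) ∨
        (b' ∈ C ∧ b' ≠ x ∧ b' ≠ y) ∨ (c' ∈ C ∧ c' ≠ x ∧ c' ≠ y) := by
      clear hsplit hconn
      intro x hx y hy C hC z hz hzx hzy hzC
      by_cases hxw : x = w
      · subst hxw
        have := hfour y (Or.inr hy) C hC z hz hzx hzy hzC
        clear hfour
        grind
      · clear hfour
        have h1 := h.one x hx hxw C (hC.mono (by grind))
        have h2 := h'.split y hy C (hC.mono (by grind))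
        have e2 : y ≠ w' → w' ∈ C → w ∈ C := fun h2 => hC _ _ e' (by grind) (by grind)
        have f2 : x ≠ c → y ≠ a' → a' ∈ C → c ∈ C := fun h1 h2 => hC _ _ f' (by grind) (by grind)
        grind
    clear hsplit hconn hfour
    intro x hx y hy C hC z hz hzx hzy hzC
    rcases hx with hx | hx <;> rcases hy with hy | hy
    · have h1 := h.two x hx y hy C (hC.mono (by grind))
      have h2 := h'.conn C (hC.mono (by grind))
      have f1 : x ≠ c → y ≠ c → c ∈ C → a' ∈ C := fun h1 h2 => hC _ _ f (by grind) (by grind)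
      grind
    · have := key x hx y hy C hC z hz hzx hzy hzC
      grind
    · have := key y hy x hx C (hC.mono (by grind)) z hz hzy hzx hzC
      grind
    · have h1 := h.conn C (hC.mono (by grind))
      have h2 := h'.two x hx y hy C (hC.mono (by grind))
      have e2 : x ≠ w' → y ≠ w' → w' ∈ C → w ∈ C := fun h1 h2 => hC _ _ e' (by grind) (by grind)
      have f2 : x ≠ a' → y ≠ a' → a' ∈ C → c ∈ C := fun h1 h2 => hC _ _ f' (by grind) (by grind)
      grind
  · intro x hx C hC z hz hzx hzC
    rcases hx with hx | hx
    · exact Or.inl (hconn x hx C hC z hz hzx hzC)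
    · have := hsplit x hx C hC z hz hzx hzC
      grind

-- The right half has kind 2 and no cut vertex, so the argument for 2+2 shows that the result has
-- none either. The exit `b` of the left half simply stays pending.
set_option maxHeartbeats 1000000 in
theorem PartialBranch.merge_three_two (h : PartialBranch E S w k a b c) (hk : k ≠ 2)
    (h' : FullBranch E S' w' 2 a' b' c') (hd : ∀ v ∈ S, v ∉ S') (e : E w w')
    (f : E c a') (hs : ∀ u v, E u v → E v u) : FullBranch E (S ∪ S') w 5 a b c' := by
  have hw := h.hw; have ha := h.ha; have hb := h.hb; have hc := h.hc
  have hw' := h'.hw; have ha' := h'.ha; have hb' := h'.hb; have hc' := h'.hc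
  have e' := hs _ _ e
  have f' := hs _ _ f
  have hab := h.ab hk
  have hac := h.ac hk
  have haw := h.aw
  have hbw := h.bw
  have hcw := h.cw
  have hab' := h'.ab_two
  have hd2 := h'.distinct_two
  have hsplit : ∀ x ∈ S ∪ S', ∀ C, ClosedIn E ((S ∪ S') \ {x}) C → ∀ z ∈ S ∪ S', z ≠ x →
      z ∈ C → ∀ t ∈ S ∪ S', t ≠ x → t ∈ C := by
    intro x hx C hC z hz hzx hzC
    rcases hx with hx | hx
    · have h2 := h'.conn C (hC.mono (by grind))
      have f1 : x ≠ c → c ∈ C → a' ∈ C := fun h => hC _ _ f (by grind) (by grind)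
      have f2 : x ≠ c → a' ∈ C → c ∈ C := fun h => hC _ _ f' (by grind) (by grind)
      by_cases hxw : x = w
      · have h1 := h.conn_root C (hC.mono (by grind))
        grind
      · have h1 := h.one x hx hxw C (hC.mono (by grind))
        have h1' := h.one x hx hxw Cᶜ ((hC.compl hs).mono (by grind))
        have e1 := hC _ _ e (by grind) (by grind)
        have e2 := hC _ _ e' (by grind) (by grind)
        grind
    · have h1 := h.conn C (hC.mono (by grind))
      have h2 := h'.conn_of_two (by simp) x hx C (hC.mono (by grind))
      have f1 : x ≠ a' → c ∈ C → a' ∈ C := fun h => hC _ _ f (by grind) (by grind)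
      have f2 : x ≠ a' → a' ∈ C → c ∈ C := fun h => hC _ _ f' (by grind) (by grind)
      have e1 : x ≠ w' → w ∈ C → w' ∈ C := fun h => hC _ _ e (by grind) (by grind)
      have e2 : x ≠ w' → w' ∈ C → w ∈ C := fun h => hC _ _ e' (by grind) (by grind)
      grind
  refine ⟨⟨by simp [hw], by simp [ha], by simp [hb], by simp [hc'], ?_, ?_, ?_, ?_⟩, ?_,
    by simp, by simp, by simp, by simp, by grind, by simp, by grind, by grind⟩
  · intro C hC z hz hzC
    have h1 := h.conn C (hC.mono (by grind))
    have h2 := h'.conn C (hC.mono (by grind))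
    have e1 := hC _ _ e (by grind) (by grind)
    have e2 := hC _ _ e' (by grind) (by grind)
    grind
  · intro C hC z hz hzw
    exact hsplit w (by grind) C hC z hz hzw
  · intro x hx hxw C hC z hz hzx hzC
    exact Or.inl (hsplit x hx C hC z hz hzx hzC _ (by simp [hw]) hxw.symm)
  · have key : ∀ x ∈ S, ∀ y ∈ S', ∀ C, ClosedIn E ((S ∪ S') \ {x, y}) C → ∀ z ∈ S ∪ S',
        z ≠ x → z ≠ y → z ∈ C → (w ∈ C ∧ w ≠ x ∧ w ≠ y) ∨ (a ∈ C ∧ a ≠ x ∧ a ≠ y) ∨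
        (b ∈ C ∧ b ≠ x ∧ b ≠ y) ∨ (c' ∈ C ∧ c' ≠ x ∧ c' ≠ y) := by
      clear hsplit
      intro x hx y hy C hC z hz hzx hzy hzC
      have h2 := h'.conn_of_two (by simp) y hy C (hC.mono (by grind))
      have e2 : x ≠ w → y ≠ w' → w' ∈ C → w ∈ C := fun h1 h2 => hC _ _ e' (by grind) (by grind)
      have f2 : x ≠ c → y ≠ a' → a' ∈ C → c ∈ C := fun h1 h2 => hC _ _ f' (by grind) (by grind)
      by_cases hxw : x = w
      · have h1 := h.conn_root C (hC.mono (by grind))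
        grind
      · have h1 := h.one x hx hxw C (hC.mono (by grind))
        grind
    clear hsplit
    intro x hx y hy C hC z hz hzx hzy hzC
    rcases hx with hx | hx <;> rcases hy with hy | hy
    · have h1 := h.two x hx y hy C (hC.mono (by grind))
      have h2 := h'.conn C (hC.mono (by grind))
      have f1 : x ≠ c → y ≠ c → c ∈ C → a' ∈ C := fun h1 h2 => hC _ _ f (by grind) (by grind)
      grind
    · have := key x hx y hy C hC z hz hzx hzy hzC
      grind
    · have := key y hy x hx C (hC.mono (by grind)) z hz hzy hzx hzC
      grind
    · have h1 := h.conn C (hC.mono (by grind))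
      have h2 := h'.two x hx y hy C (hC.mono (by grind))
      have e2 : x ≠ w' → y ≠ w' → w' ∈ C → w ∈ C := fun h1 h2 => hC _ _ e' (by grind) (by grind)
      have f2 : x ≠ a' → y ≠ a' → a' ∈ C → c ∈ C := fun h1 h2 => hC _ _ f' (by grind) (by grind)
      grind
  · intro x hx C hC z hz hzx hzC
    exact Or.inl (hsplit x hx C hC z hz hzx hzC)

-- The second chord, from `b` to `b'`, reaches those parts of the right half that a cut vertex
-- separates from `w'` and `a'`. Thus no cut vertex is left, and the branch returns to kind 2.
set_option maxHeartbeats 1000000 in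
theorem PartialBranch.merge_three_three (h : PartialBranch E S w k a b c) (hk : k ≠ 2)
    (h' : FullBranch E S' w' k' a' b' c') (hk' : k' ≠ 2) (hd : ∀ v ∈ S, v ∉ S') (e : E w w')
    (f : E c a') (g : E b b') (hs : ∀ u v, E u v → E v u) :
    FullBranch E (S ∪ S') w 2 a a c' := by
  have hw := h.hw; have ha := h.ha; have hb := h.hb; have hc := h.hc
  have hw' := h'.hw; have ha' := h'.ha; have hb' := h'.hb; have hc' := h'.hc
  have e' := hs _ _ e
  have f' := hs _ _ f
  have g' := hs _ _ g
  have hab := h.ab hk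
  have hac := h.ac hk
  have haw := h.aw
  have hbw := h.bw
  have hcw := h.cw
  have hd2 := h'.distinct hk'
  have hsplit : ∀ x ∈ S ∪ S', ∀ C, ClosedIn E ((S ∪ S') \ {x}) C → ∀ z ∈ S ∪ S', z ≠ x →
      z ∈ C → ∀ t ∈ S ∪ S', t ≠ x → t ∈ C := by
    intro x hx C hC z hz hzx hzC
    rcases hx with hx | hx
    · have h2 := h'.conn C (hC.mono (by grind))
      have f1 : x ≠ c → c ∈ C → a' ∈ C := fun h => hC _ _ f (by grind) (by grind)
      have f2 : x ≠ c → a' ∈ C → c ∈ C := fun h => hC _ _ f' (by grind) (by grind)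
      by_cases hxw : x = w
      · have h1 := h.conn_root C (hC.mono (by grind))
        grind
      · have h1 := h.one x hx hxw C (hC.mono (by grind))
        have h1' := h.one x hx hxw Cᶜ ((hC.compl hs).mono (by grind))
        have e1 := hC _ _ e (by grind) (by grind)
        have e2 := hC _ _ e' (by grind) (by grind)
        grind
    · have h1 := h.conn C (hC.mono (by grind))
      -- Each part of the right half has a surviving link to the intact left half: at `w'`, at `a'`
      -- or at `b'`.
      have key : ∀ C, ClosedIn E ((S ∪ S') \ {x}) C → ∀ z ∈ S ∪ S', z ≠ x → z ∈ C → w ∈ C := by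
        intro C hC z hz hzx hzC
        have h1 := h.conn C (hC.mono (by grind))
        have h2 := h'.split x hx C (hC.mono (by grind))
        have f2 : x ≠ a' → a' ∈ C → c ∈ C := fun h => hC _ _ f' (by grind) (by grind)
        have g2 : x ≠ b' → b' ∈ C → b ∈ C := fun h => hC _ _ g' (by grind) (by grind)
        have e2 : x ≠ w' → w' ∈ C → w ∈ C := fun h => hC _ _ e' (by grind) (by grind)
        by_cases hxa : x = a'
        · grind
        · grind
      intro t ht htx
      have h1 := key C hC z hz hzx hzC
      have h2 := key Cᶜ (hC.compl hs) t ht htx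
      grind
  refine ⟨⟨by simp [hw], by simp [ha], by simp [ha], by simp [hc'], ?_, ?_, ?_, ?_⟩, ?_,
    by simp, by simp, by simp, by grind, by simp, by simp, by simp, by simp⟩
  · intro C hC z hz hzC
    have h1 := h.conn C (hC.mono (by grind))
    have h2 := h'.conn C (hC.mono (by grind))
    have e1 := hC _ _ e (by grind) (by grind)
    have e2 := hC _ _ e' (by grind) (by grind)
    grind
  · intro C hC z hz hzw
    exact hsplit w (by grind) C hC z hz hzw
  · intro x hx hxw C hC z hz hzx hzC
    exact Or.inl (hsplit x hx C hC z hz hzx hzC _ (by simp [hw]) hxw.symm)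
  · have key : ∀ x ∈ S, ∀ y ∈ S', ∀ C, ClosedIn E ((S ∪ S') \ {x, y}) C → ∀ z ∈ S ∪ S',
        z ≠ x → z ≠ y → z ∈ C → (w ∈ C ∧ w ≠ x ∧ w ≠ y) ∨ (a ∈ C ∧ a ≠ x ∧ a ≠ y) ∨
        (c' ∈ C ∧ c' ≠ x ∧ c' ≠ y) := by
      clear hsplit
      intro x hx y hy C hC z hz hzx hzy hzC
      have h2 := h'.split y hy C (hC.mono (by grind))
      have e2 : x ≠ w → y ≠ w' → w' ∈ C → w ∈ C := fun h1 h2 => hC _ _ e' (by grind) (by grind)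
      have f1 : x ≠ c → y ≠ a' → c ∈ C → a' ∈ C := fun h1 h2 => hC _ _ f (by grind) (by grind)
      have f2 : x ≠ c → y ≠ a' → a' ∈ C → c ∈ C := fun h1 h2 => hC _ _ f' (by grind) (by grind)
      have g1 : x ≠ b → y ≠ b' → b ∈ C → b' ∈ C := fun h1 h2 => hC _ _ g (by grind) (by grind)
      by_cases hxw : x = w
      · have h1 := h.conn_root C (hC.mono (by grind))
        by_cases hyc : y = c'
        · grind
        · grind
      · have h1 := h.one x hx hxw C (hC.mono (by grind))
        by_cases hya : y = a'
        · grind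
        · by_cases hyc : y = c'
          · grind
          · grind
    clear hsplit
    intro x hx y hy C hC z hz hzx hzy hzC
    rcases hx with hx | hx <;> rcases hy with hy | hy
    · have h1 := h.two x hx y hy C (hC.mono (by grind))
      have h2 := h'.conn C (hC.mono (by grind))
      have f1 : x ≠ c → y ≠ c → c ∈ C → a' ∈ C := fun h1 h2 => hC _ _ f (by grind) (by grind)
      have g1 : x ≠ b → y ≠ b → b ∈ C → b' ∈ C := fun h1 h2 => hC _ _ g (by grind) (by grind)
      grind
    · have := key x hx y hy C hC z hz hzx hzy hzC
      grind
    · have := key y hy x hx C (hC.mono (by grind)) z hz hzy hzx hzC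
      grind
    · have h1 := h.conn C (hC.mono (by grind))
      have h2 := h'.two x hx y hy C (hC.mono (by grind))
      have e2 : x ≠ w' → y ≠ w' → w' ∈ C → w ∈ C := fun h1 h2 => hC _ _ e' (by grind) (by grind)
      have f2 : x ≠ a' → y ≠ a' → a' ∈ C → c ∈ C := fun h1 h2 => hC _ _ f' (by grind) (by grind)
      have g2 : x ≠ b' → y ≠ b' → b' ∈ C → b ∈ C := fun h1 h2 => hC _ _ g' (by grind) (by grind)
      grind
  · intro x hx C hC z hz hzx hzC
    exact Or.inl (hsplit x hx C hC z hz hzx hzC)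

end Merge

/-! ### Closing the last branch at the root leaf -/

section Root

variable {E : ℕ → ℕ → Prop} {S : Set ℕ} {r u k a b c : ℕ}

/-- Closing a complete branch at a leaf `r`: no two vertices separate the result. -/
theorem FullBranch.closed_of_root (h : FullBranch E S u k a b c) (hr : r ∉ S) (e : E r u)
    (hs : ∀ u v, E u v → E v u) (huc : k = 3 ∨ k = 4 → E u c) (hra : k ≠ 3 → E r a)
    (hrb : k ≠ 2 → E r b) (hrc : k ≠ 4 → E r c) (x y : ℕ) (hx : x ∈ insert r S)
    (hy : y ∈ insert r S) (C : Set ℕ) (hC : ClosedIn E (insert r S \ {x, y}) C) :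
    ∀ z ∈ insert r S, z ≠ x → z ≠ y → z ∈ C → ∀ t ∈ insert r S, t ≠ x → t ≠ y → t ∈ C := by
  have hw := h.hw; have ha := h.ha; have hb := h.hb; have hc := h.hc
  have e' := hs _ _ e
  have huc' : k = 3 ∨ k = 4 → E c u := fun hk => hs _ _ (huc hk)
  have hra' : k ≠ 3 → E a r := fun hk => hs _ _ (hra hk)
  have hrb' : k ≠ 2 → E b r := fun hk => hs _ _ (hrb hk)
  have hrc' : k ≠ 4 → E c r := fun hk => hs _ _ (hrc hk)
  have hk := h.kind
  -- If `r` is among the removed vertices, at most one vertex of `S` is missing and `split` applies.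
  -- Otherwise every part reaches an exit that is joined to `r`.
  by_cases hxr : x = r
  · by_cases hyr : y = r
    · have h1 := h.conn C (hC.mono (by grind))
      grind
    · have hyS : y ∈ S := by grind
      have key : ∀ C, ClosedIn E (insert r S \ {x, y}) C → ∀ z ∈ insert r S, z ≠ x → z ≠ y →
          z ∈ C → (∀ t ∈ S, t ≠ y → t ∈ C) ∨ ((k = 3 ∨ k = 4) ∧ y ≠ u ∧ y ≠ a ∧ y ≠ b ∧ y ≠ c ∧
            ((u ∈ C ∧ a ∈ C) ∨ (b ∈ C ∧ c ∈ C))) := by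
        intro C hC z hz hzx hzy hzC
        have h1 := h.split y hyS C (hC.mono (by grind)) z (by grind) hzy hzC
        grind
      intro z hz hzx hzy hzC t ht htx hty
      by_contra htC
      have h1 := key C hC z hz hzx hzy hzC
      have h2 := key Cᶜ (hC.compl hs) t ht htx hty htC
      clear key
      -- The chord from `u` to `c` links a part with `u` and `a` to a part with `b` and `c`; the
      -- exceptional case of `split` guarantees that both its ends survive.
      by_cases hkk : (k = 3 ∨ k = 4) ∧ y ≠ u ∧ y ≠ c
      · have h3 := hC _ _ (huc hkk.1) (by grind) (by grind)
        have h4 := hC _ _ (huc' hkk.1) (by grind) (by grind)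
        grind
      · grind
  · by_cases hyr : y = r
    · have hxS : x ∈ S := by grind
      have key : ∀ C, ClosedIn E (insert r S \ {x, y}) C → ∀ z ∈ insert r S, z ≠ x → z ≠ y →
          z ∈ C → (∀ t ∈ S, t ≠ x → t ∈ C) ∨ ((k = 3 ∨ k = 4) ∧ x ≠ u ∧ x ≠ a ∧ x ≠ b ∧ x ≠ c ∧
            ((u ∈ C ∧ a ∈ C) ∨ (b ∈ C ∧ c ∈ C))) := by
        intro C hC z hz hzx hzy hzC
        have h1 := h.split x hxS C (hC.mono (by grind)) z (by grind) hzx hzC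
        grind
      intro z hz hzx hzy hzC t ht htx hty
      by_contra htC
      have h1 := key C hC z hz hzx hzy hzC
      have h2 := key Cᶜ (hC.compl hs) t ht htx hty htC
      clear key
      by_cases hkk : (k = 3 ∨ k = 4) ∧ x ≠ u ∧ x ≠ c
      · have h3 := hC _ _ (huc hkk.1) (by grind) (by grind)
        have h4 := hC _ _ (huc' hkk.1) (by grind) (by grind)
        grind
      · grind
    · have hxS : x ∈ S := by grind
      have hyS : y ∈ S := by grind
      -- In kind 3 the exit `a` is `u`, so the tree edge at `r` serves it and no chord to `a` is
      -- needed.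
      have key : ∀ C, ClosedIn E (insert r S \ {x, y}) C → ∀ z ∈ insert r S, z ≠ x → z ≠ y →
          z ∈ C → r ∈ C := by
        intro C hC z hz hzx hzy hzC
        by_cases hzr : z = r
        · grind
        have hzS : z ∈ S := by grind
        have g1 : u ≠ x → u ≠ y → u ∈ C → r ∈ C := fun h1 h2 =>
          hC _ _ e' (by grind) (by grind)
        have g2 : k ≠ 3 → a ≠ x → a ≠ y → a ∈ C → r ∈ C := fun h0 h1 h2 =>
          hC _ _ (hra' h0) (by grind) (by grind)
        have g3 : k ≠ 2 → b ≠ x → b ≠ y → b ∈ C → r ∈ C := fun h0 h1 h2 =>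
          hC _ _ (hrb' h0) (by grind) (by grind)
        have g4 : k ≠ 4 → c ≠ x → c ≠ y → c ∈ C → r ∈ C := fun h0 h1 h2 =>
          hC _ _ (hrc' h0) (by grind) (by grind)
        have g5 := h.aw_three
        have g6 := h.ab_two
        have g8 := h.aw
        have g9 := h.distinct
        -- In kind 4 the exit `c` reaches `r` only through `u`; if `u` is removed, `two_four`
        -- provides `a` or `b` instead.
        by_cases hk4 : k = 4
        · by_cases hux : u = x
          · have := h.two_four hk4 y hyS C (hC.mono (by grind)) z hzS (by grind) hzy hzC
            grind
          · by_cases huy : u = y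
            · have := h.two_four hk4 x hxS C (hC.mono (by grind)) z hzS (by grind) hzx hzC
              grind
            · have g7 : c ≠ x → c ≠ y → c ∈ C → u ∈ C := fun h1 h2 =>
                hC _ _ (huc' (Or.inr hk4)) (by grind) (by grind)
              have := h.two x hxS y hyS C (hC.mono (by grind)) z hzS hzx hzy hzC
              grind
        · have := h.two x hxS y hyS C (hC.mono (by grind)) z hzS hzx hzy hzC
          grind
      intro z hz hzx hzy hzC t ht htx hty
      by_contra htC
      have h1 := key C hC z hz hzx hzy hzC
      have h2 := key Cᶜ (hC.compl hs) t ht htx hty htC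
      exact h2 h1

/-- More edges leave fewer closed sets, and the conditions on the exits do not involve the edges. -/
theorem FullBranch.mono {F : ℕ → ℕ → Prop} (h : FullBranch E S u k a b c)
    (hE : ∀ u v, E u v → F u v) : FullBranch F S u k a b c :=
  ⟨⟨h.hw, h.ha, h.hb, h.hc, fun C hC => h.conn C (hC.anti hE),
    fun C hC => h.conn_root C (hC.anti hE), fun x hx hxw C hC => h.one x hx hxw C (hC.anti hE),
    fun x hx y hy C hC => h.two x hx y hy C (hC.anti hE)⟩,
    fun x hx C hC => h.split x hx C (hC.anti hE), h.kind,
    fun hk y hy C hC => h.two_four hk y hy C (hC.anti hE), h.ab_two, h.distinct_two, h.distinct,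
    h.aw_three, h.aw, h.bc⟩

theorem PartialBranch.mono {F : ℕ → ℕ → Prop} (h : PartialBranch E S u k a b c)
    (hE : ∀ u v, E u v → F u v) : PartialBranch F S u k a b c :=
  ⟨⟨h.hw, h.ha, h.hb, h.hc, fun C hC => h.conn C (hC.anti hE),
    fun C hC => h.conn_root C (hC.anti hE), fun x hx hxw C hC => h.one x hx hxw C (hC.anti hE),
    fun x hx y hy C hC => h.two x hx y hy C (hC.anti hE)⟩,
    h.aw, h.bw, h.cw, h.ab_two, h.ab, h.ac⟩

end Root

/-! ### Half-edge maps -/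

/-- A half-edge map: `D` half-edges `0, …, D - 1` with tails, reversals and rotation. -/
structure HalfEdgeMap where
  D : ℕ
  tail : ℕ → ℕ
  rev : ℕ → ℕ
  nxt : ℕ → ℕ

/-- A closed walk along `f`, as the list of its points. -/
def IsClosedWalk (f : ℕ → ℕ) (l : List ℕ) : Prop :=
  (l ++ l.take 1).IsChain (fun a b => f a = b)

/-- `t` is the first point below `B` that follows `h` under `f`. -/
inductive FirstBelow (f : ℕ → ℕ) (B : ℕ) : ℕ → ℕ → Prop
  | here {h t : ℕ} (e : f h = t) (ht : t < B) : FirstBelow f B h t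
  | skip {h t : ℕ} (hB : B ≤ f h) (ht : FirstBelow f B (f h) t) : FirstBelow f B h t

namespace HalfEdgeMap

/-- The head of a half-edge. -/
def head (M : HalfEdgeMap) (h : ℕ) : ℕ := M.tail (M.rev h)

/-- The half-edge that follows on the boundary of the same face. -/
def face (M : HalfEdgeMap) (h : ℕ) : ℕ := M.nxt (M.rev h)

/-- Adjacency of vertices. -/
def Edge (M : HalfEdgeMap) (u v : ℕ) : Prop := ∃ h < M.D, M.tail h = u ∧ M.head h = v

/-- Join the head of `x` to the head of `y` by a new edge, inserted behind the arrivals `x` and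
`y`. -/
def chord (M : HalfEdgeMap) (x y : ℕ) : HalfEdgeMap where
  D := M.D + 2
  tail := Function.update (Function.update M.tail M.D (M.tail (M.rev x))) (M.D + 1)
    (M.tail (M.rev y))
  rev := Function.update (Function.update M.rev M.D (M.D + 1)) (M.D + 1) M.D
  nxt := Function.update (Function.update (Function.update (Function.update M.nxt M.D
    (M.nxt (M.rev x))) (M.D + 1) (M.nxt (M.rev y))) (M.rev x) M.D) (M.rev y) (M.D + 1)

/-- `M` has all half-edges of `T`. -/
structure Extends (T M : HalfEdgeMap) : Prop where
  le : T.D ≤ M.D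
  tail : ∀ h < T.D, M.tail h = T.tail h
  rev : ∀ h < T.D, M.rev h = T.rev h

/-- The rotation and reversal of `M` are consistent, and the underlying graph on `0, …, n - 1` is
simple. -/
structure IsSimpleMap (n : ℕ) (M : HalfEdgeMap) : Prop where
  tail_lt : ∀ h < M.D, M.tail h < n
  rev_lt : ∀ h < M.D, M.rev h < M.D
  nxt_lt : ∀ h < M.D, M.nxt h < M.D
  rev_rev : ∀ h < M.D, M.rev (M.rev h) = h
  tail_nxt : ∀ h < M.D, M.tail (M.nxt h) = M.tail h
  loopless : ∀ h < M.D, M.head h ≠ M.tail h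
  simple : ∀ h < M.D, ∀ h' < M.D, M.tail h = M.tail h' → M.head h = M.head h' → h = h'
  cyc : ∀ h < M.D, ∀ h' < M.D, M.tail h = M.tail h' →
    Relation.ReflTransGen (fun a b => M.nxt a = b) h h'

/-- The faces of `M` are `W` and the members of `F`, and Euler's formula for a connected plane graph
with `n` vertices holds. -/
structure HasFaces (n : ℕ) (M : HalfEdgeMap) (W : List ℕ) (F : List (List ℕ)) : Prop where
  nodup : (W ++ F.flatten).Nodup
  mem : ∀ h, h ∈ W ++ F.flatten ↔ h < M.D
  outer_ne : W ≠ []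
  outer : IsClosedWalk M.face W
  inner : ∀ l ∈ F, l ≠ [] ∧ IsClosedWalk M.face l
  euler : 2 * (n + F.length) = M.D + 2

/-- A plane map that contains `T`, with the outer face `W` and the other faces `F`. -/
structure IsPlane (T : HalfEdgeMap) (n : ℕ) (M : HalfEdgeMap) (W : List ℕ) (F : List (List ℕ)) :
    Prop extends IsSimpleMap n M, HasFaces n M W F, Extends T M where
  first : ∀ h < T.D, FirstBelow M.nxt T.D h (T.nxt h)

theorem Extends.refl (M : HalfEdgeMap) : M.Extends M := ⟨le_rfl, fun _ _ => rfl, fun _ _ => rfl⟩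

theorem Extends.trans {T M N : HalfEdgeMap} (h : T.Extends M) (h' : M.Extends N) : T.Extends N :=
  ⟨h.le.trans h'.le, fun x hx => (h'.tail x (hx.trans_le h.le)).trans (h.tail x hx),
    fun x hx => (h'.rev x (hx.trans_le h.le)).trans (h.rev x hx)⟩

theorem Extends.head {T M : HalfEdgeMap} (h : T.Extends M) {x : ℕ} (hx : x < T.D)
    (hr : T.rev x < T.D) : M.head x = T.head x := by
  simp only [HalfEdgeMap.head, h.rev x hx, h.tail _ hr]

theorem Extends.edge {T M : HalfEdgeMap} (h : T.Extends M) (hr : ∀ x < T.D, T.rev x < T.D)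
    {u v : ℕ} (e : T.Edge u v) : M.Edge u v := by
  obtain ⟨x, hx, rfl, rfl⟩ := e
  exact ⟨x, hx.trans_le h.le, h.tail x hx, h.head hx (hr x hx)⟩

theorem IsSimpleMap.edge_symm {n : ℕ} {M : HalfEdgeMap} (h : M.IsSimpleMap n) (u v : ℕ)
    (e : M.Edge u v) : M.Edge v u := by
  obtain ⟨x, hx, rfl, rfl⟩ := e
  exact ⟨M.rev x, h.rev_lt x hx, rfl, by rw [head, h.rev_rev x hx]⟩

theorem IsSimpleMap.head_rev {n : ℕ} {M : HalfEdgeMap} (h : M.IsSimpleMap n) {x : ℕ}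
    (hx : x < M.D) : M.head (M.rev x) = M.tail x := by
  rw [head, h.rev_rev x hx]

theorem IsSimpleMap.tail_face {n : ℕ} {M : HalfEdgeMap} (h : M.IsSimpleMap n) {x : ℕ}
    (hx : x < M.D) : M.tail (M.face x) = M.head x := by
  rw [face, h.tail_nxt _ (h.rev_lt x hx), head]

/-! ### The rotation after the insertion of one chord -/

section Chord

variable {n : ℕ} {M : HalfEdgeMap} {x y : ℕ}

theorem extends_chord (M : HalfEdgeMap) (x y : ℕ) : M.Extends (M.chord x y) := by
  refine ⟨by simp [chord], fun h hh => ?_, fun h hh => ?_⟩ <;>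
    simp [chord, Function.update_of_ne (show h ≠ M.D + 1 by omega),
      Function.update_of_ne (show h ≠ M.D by omega)]

theorem chord_D : (M.chord x y).D = M.D + 2 := rfl

theorem chord_rev_left : (M.chord x y).rev M.D = M.D + 1 := by simp [chord]

theorem chord_rev_right : (M.chord x y).rev (M.D + 1) = M.D := by simp [chord]

theorem chord_rev {h : ℕ} (hh : h < M.D) : (M.chord x y).rev h = M.rev h :=
  (extends_chord M x y).rev h hh

theorem chord_tail {h : ℕ} (hh : h < M.D) : (M.chord x y).tail h = M.tail h :=
  (extends_chord M x y).tail h hh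

theorem chord_tail_left : (M.chord x y).tail M.D = M.head x := by simp [chord, head]

theorem chord_tail_right : (M.chord x y).tail (M.D + 1) = M.head y := by simp [chord, head]

theorem chord_head_left : (M.chord x y).head M.D = M.head y := by
  rw [head, chord_rev_left, chord_tail_right]

theorem chord_head_right : (M.chord x y).head (M.D + 1) = M.head x := by
  rw [head, chord_rev_right, chord_tail_left]

theorem chord_head (hM : M.IsSimpleMap n) {h : ℕ} (hh : h < M.D) :
    (M.chord x y).head h = M.head h :=
  (extends_chord M x y).head hh (hM.rev_lt h hh)

theorem chord_nxt {h : ℕ} (hh : h < M.D) (h1 : h ≠ M.rev x) (h2 : h ≠ M.rev y) :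
    (M.chord x y).nxt h = M.nxt h := by
  simp only [chord]
  grind

theorem chord_nxt_rev_right : (M.chord x y).nxt (M.rev y) = M.D + 1 := by
  simp [chord]

variable (hM : M.IsSimpleMap n) (hx : x < M.D) (hy : y < M.D)
include hM hx hy

theorem chord_nxt_left : (M.chord x y).nxt M.D = M.face x := by
  have h1 := hM.rev_lt x hx
  have h2 := hM.rev_lt y hy
  simp only [chord, face]
  grind

theorem chord_nxt_right : (M.chord x y).nxt (M.D + 1) = M.face y := by
  have h1 := hM.rev_lt x hx
  have h2 := hM.rev_lt y hy
  simp only [chord, face]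
  grind

/-- For `x = y` the later update at `M.rev y` would overwrite this one. -/
theorem chord_nxt_rev_left (hxy : x ≠ y) : (M.chord x y).nxt (M.rev x) = M.D := by
  have h1 := hM.rev_rev x hx
  have h2 := hM.rev_rev y hy
  simp only [chord]
  grind

theorem chord_face_left (hxy : x ≠ y) : (M.chord x y).face x = M.D := by
  rw [face, chord_rev hx, chord_nxt_rev_left hM hx hy hxy]

omit hM hx in
theorem chord_face_right : (M.chord x y).face y = M.D + 1 := by
  rw [face, chord_rev hy, chord_nxt_rev_right]

theorem chord_face_new_left : (M.chord x y).face M.D = M.face y := by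
  rw [face, chord_rev_left, chord_nxt_right hM hx hy]

theorem chord_face_new_right : (M.chord x y).face (M.D + 1) = M.face x := by
  rw [face, chord_rev_right, chord_nxt_left hM hx hy]

theorem chord_face {h : ℕ} (hh : h < M.D) (h1 : h ≠ x) (h2 : h ≠ y) :
    (M.chord x y).face h = M.face h := by
  have hrx := hM.rev_rev x hx
  have hry := hM.rev_rev y hy
  have hrh := hM.rev_rev h hh
  rw [face, chord_rev hh, chord_nxt (hM.rev_lt h hh) (by grind) (by grind), face]

omit hx hy in
theorem chord_edge {u v : ℕ} : (M.chord x y).Edge u v ↔ M.Edge u v ∨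
    (u = M.head x ∧ v = M.head y) ∨ (u = M.head y ∧ v = M.head x) := by
  constructor
  · rintro ⟨h, hh, rfl, rfl⟩
    rw [chord_D] at hh
    rcases lt_or_ge h M.D with h1 | h1
    · exact Or.inl ⟨h, h1, (chord_tail h1).symm, (chord_head hM h1).symm⟩
    · rcases (show h = M.D ∨ h = M.D + 1 by omega) with rfl | rfl
      · exact Or.inr (Or.inl ⟨chord_tail_left, chord_head_left⟩)
      · exact Or.inr (Or.inr ⟨chord_tail_right, chord_head_right⟩)
  · rintro (⟨h, hh, rfl, rfl⟩ | ⟨rfl, rfl⟩ | ⟨rfl, rfl⟩)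
    · exact ⟨h, by rw [chord_D]; omega, chord_tail hh, chord_head hM hh⟩
    · exact ⟨M.D, by rw [chord_D]; omega, chord_tail_left, chord_head_left⟩
    · exact ⟨M.D + 1, by rw [chord_D]; omega, chord_tail_right, chord_head_right⟩

/-- One step of the old rotation takes one or two steps of the new one. -/
theorem chord_nxt_cases (hxy : x ≠ y) {h : ℕ} (hh : h < M.D) :
    (M.chord x y).nxt h = M.nxt h ∨
      (M.D ≤ (M.chord x y).nxt h ∧ (M.chord x y).nxt ((M.chord x y).nxt h) = M.nxt h) := by
  by_cases h1 : h = M.rev x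
  · subst h1
    right
    rw [chord_nxt_rev_left hM hx hy hxy, chord_nxt_left hM hx hy]
    exact ⟨le_rfl, rfl⟩
  · by_cases h2 : h = M.rev y
    · subst h2
      right
      rw [chord_nxt_rev_right, chord_nxt_right hM hx hy]
      exact ⟨by omega, rfl⟩
    · exact Or.inl (chord_nxt hh h1 h2)

theorem chord_reach (hxy : x ≠ y) {h h' : ℕ} (hh : h < M.D)
    (hr : Relation.ReflTransGen (fun a b => M.nxt a = b) h h') :
    h' < M.D ∧ Relation.ReflTransGen (fun a b => (M.chord x y).nxt a = b) h h' := by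
  induction hr with
  | refl => exact ⟨hh, .refl⟩
  | @tail b c _ hbc ih =>
    obtain ⟨hb, ih⟩ := ih
    subst hbc
    refine ⟨hM.nxt_lt b hb, ?_⟩
    rcases chord_nxt_cases hM hx hy hxy hb with h1 | ⟨-, h1⟩
    · exact ih.tail h1
    · exact (ih.tail rfl).tail h1

/-- The new half-edges have numbers from `M.D` on, so a search for a number below `B` passes over
them. Taken with `B` as the number of half-edges of `T`, this keeps the embedding of `T`. -/
theorem chord_firstBelow (hxy : x ≠ y) {B h t : ℕ} (hB : B ≤ M.D) (hh : h < M.D)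
    (hr : FirstBelow M.nxt B h t) : FirstBelow (M.chord x y).nxt B h t := by
  induction hr with
  | @here h t e ht =>
    rcases chord_nxt_cases hM hx hy hxy hh with h1 | ⟨h0, h1⟩
    · exact .here (h1.trans e) ht
    · exact .skip (hB.trans h0) (.here (h1.trans e) ht)
  | @skip h t hb _ ih =>
    have ih := ih (hM.nxt_lt h hh)
    rcases chord_nxt_cases hM hx hy hxy hh with h1 | ⟨h0, h1⟩
    · exact .skip (h1 ▸ hb) (h1 ▸ ih)
    · exact .skip (hB.trans h0) (.skip (h1 ▸ hb) (h1 ▸ ih))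

theorem IsSimpleMap.chord (hne : M.head x ≠ M.head y) (he : ¬ M.Edge (M.head x) (M.head y)) :
    (M.chord x y).IsSimpleMap n := by
  have hxy : x ≠ y := fun h => hne (by rw [h])
  have he' : ¬ M.Edge (M.head y) (M.head x) := fun h => he (hM.edge_symm _ _ h)
  have hnew : ∀ h < M.D + 2, h < M.D ∨ h = M.D ∨ h = M.D + 1 := fun h hh => by omega
  have hrx := hM.rev_lt x hx
  have hry := hM.rev_lt y hy
  have hfx := hM.nxt_lt _ hrx
  have hfy := hM.nxt_lt _ hry
  refine ⟨?_, ?_, ?_, ?_, ?_, ?_, ?_, ?_⟩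
  · intro h hh
    rcases hnew h hh with h1 | rfl | rfl
    · rw [chord_tail h1]; exact hM.tail_lt h h1
    · rw [chord_tail_left]; exact hM.tail_lt _ hrx
    · rw [chord_tail_right]; exact hM.tail_lt _ hry
  · intro h hh
    rw [chord_D]
    rcases hnew h hh with h1 | rfl | rfl
    · rw [chord_rev h1]; have := hM.rev_lt h h1; omega
    · rw [chord_rev_left]; omega
    · rw [chord_rev_right]; omega
  · intro h hh
    rw [chord_D]
    rcases hnew h hh with h1 | rfl | rfl
    · by_cases h2 : h = M.rev x
      · rw [h2, chord_nxt_rev_left hM hx hy hxy]; omega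
      · by_cases h3 : h = M.rev y
        · rw [h3, chord_nxt_rev_right]; omega
        · rw [chord_nxt h1 h2 h3]; have := hM.nxt_lt h h1; omega
    · rw [chord_nxt_left hM hx hy, face]; omega
    · rw [chord_nxt_right hM hx hy, face]; omega
  · intro h hh
    rcases hnew h hh with h1 | rfl | rfl
    · rw [chord_rev h1, chord_rev (hM.rev_lt h h1), hM.rev_rev h h1]
    · rw [chord_rev_left, chord_rev_right]
    · rw [chord_rev_right, chord_rev_left]
  · intro h hh
    rcases hnew h hh with h1 | rfl | rfl
    · rw [chord_tail h1]
      by_cases h2 : h = M.rev x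
      · rw [h2, chord_nxt_rev_left hM hx hy hxy, chord_tail_left, head]
      · by_cases h3 : h = M.rev y
        · rw [h3, chord_nxt_rev_right, chord_tail_right, head]
        · rw [chord_nxt h1 h2 h3, chord_tail (hM.nxt_lt h h1), hM.tail_nxt h h1]
    · rw [chord_nxt_left hM hx hy, chord_tail_left, face, chord_tail hfx, hM.tail_nxt _ hrx, head]
    · rw [chord_nxt_right hM hx hy, chord_tail_right, face, chord_tail hfy, hM.tail_nxt _ hry, head]
  · intro h hh
    rcases hnew h hh with h1 | rfl | rfl
    · rw [chord_tail h1, chord_head hM h1]; exact hM.loopless h h1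
    · rw [chord_tail_left, chord_head_left]; exact hne.symm
    · rw [chord_tail_right, chord_head_right]; exact hne
  · have key : ∀ h < M.D, ∀ h', h' = M.D ∨ h' = M.D + 1 →
        (M.chord x y).tail h = (M.chord x y).tail h' →
        (M.chord x y).head h = (M.chord x y).head h' → False := by
      rintro h hh h' (rfl | rfl) e1 e2
      · rw [chord_tail hh, chord_tail_left] at e1
        rw [chord_head hM hh, chord_head_left] at e2
        exact he ⟨h, hh, e1, e2⟩
      · rw [chord_tail hh, chord_tail_right] at e1
        rw [chord_head hM hh, chord_head_right] at e2
        exact he' ⟨h, hh, e1, e2⟩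
    intro h hh h' hh' e1 e2
    rcases hnew h hh with h1 | h1
    · rcases hnew h' hh' with h2 | h2
      · rw [chord_tail h1, chord_tail h2] at e1
        rw [chord_head hM h1, chord_head hM h2] at e2
        exact hM.simple h h1 h' h2 e1 e2
      · exact (key h h1 h' h2 e1 e2).elim
    · rcases hnew h' hh' with h2 | h2
      · exact (key h' h2 h h1 e1.symm e2.symm).elim
      · rcases h1 with rfl | rfl <;> rcases h2 with rfl | rfl
        · rfl
        · rw [chord_tail_left, chord_tail_right] at e1
          exact (hne e1).elim
        · rw [chord_tail_left, chord_tail_right] at e1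
          exact (hne e1.symm).elim
        · rfl
  -- Each new half-edge has an old neighbour on either side in the rotation, so its cyclicity
  -- reduces to that of the old rotation.
  · have hfrom : ∀ h < M.D + 2, ∃ p < M.D, M.tail p = (M.chord x y).tail h ∧
        Relation.ReflTransGen (fun a b => (M.chord x y).nxt a = b) p h := by
      intro h hh
      rcases hnew h hh with h1 | rfl | rfl
      · exact ⟨h, h1, (chord_tail h1).symm, .refl⟩
      · exact ⟨M.rev x, hrx, chord_tail_left.symm,
          .single (chord_nxt_rev_left hM hx hy hxy)⟩
      · exact ⟨M.rev y, hry, chord_tail_right.symm, .single chord_nxt_rev_right⟩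
    have hto : ∀ h < M.D + 2, ∃ p < M.D, M.tail p = (M.chord x y).tail h ∧
        Relation.ReflTransGen (fun a b => (M.chord x y).nxt a = b) h p := by
      intro h hh
      rcases hnew h hh with h1 | rfl | rfl
      · exact ⟨h, h1, (chord_tail h1).symm, .refl⟩
      · exact ⟨M.face x, hfx, by rw [hM.tail_face hx, chord_tail_left],
          .single (chord_nxt_left hM hx hy)⟩
      · exact ⟨M.face y, hfy, by rw [hM.tail_face hy, chord_tail_right],
          .single (chord_nxt_right hM hx hy)⟩
    intro h hh h' hh' e
    obtain ⟨p, hp, e1, r1⟩ := hto h hh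
    obtain ⟨q, hq, e2, r2⟩ := hfrom h' hh'
    exact (r1.trans (chord_reach hM hx hy hxy hp (hM.cyc p hp q hq (by rw [e1, e2, e]))).2).trans r2

end Chord

/-! ### How a chord divides the outer face -/

theorem isChain_congr {f g : ℕ → ℕ} {l : List ℕ} {z : ℕ}
    (h : (l ++ [z]).IsChain (fun a b => f a = b)) (hfg : ∀ a ∈ l, g a = f a) :
    (l ++ [z]).IsChain (fun a b => g a = b) := by
  induction l with
  | nil => simp
  | cons a l ih =>
    cases l with
    | nil =>
      simp only [List.cons_append, List.nil_append, List.isChain_cons_cons] at h ⊢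
      exact ⟨(hfg a (by simp)).trans h.1, by simp⟩
    | cons b l =>
      simp only [List.cons_append, List.isChain_cons_cons] at h ⊢
      exact ⟨(hfg a (by simp)).trans h.1, ih h.2 fun c hc => hfg c (by simp [hc])⟩

theorem isClosedWalk_congr {f g : ℕ → ℕ} {l : List ℕ} (h : IsClosedWalk f l)
    (hfg : ∀ a ∈ l, g a = f a) : IsClosedWalk g l := by
  cases l with
  | nil => simp [IsClosedWalk]
  | cons a l =>
    simp only [IsClosedWalk, List.take_succ_cons, List.take_zero] at h ⊢
    exact isChain_congr h hfg

/-- The face permutation changes at `x` and `y` only. The half-edge `M.D` bridges from `x` to what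
followed `y`, and `M.D + 1` leads from `y` back to what followed `x`. So the arrivals after `x`, up
to `y`, close up to a new face: two half-edges and one face more, as Euler's formula requires. -/
theorem HasFaces.chord {n : ℕ} {M : HalfEdgeMap} {x y : ℕ} {W₁ W₂ W₃ : List ℕ}
    {F : List (List ℕ)} (hM : M.IsSimpleMap n)
    (h : M.HasFaces n (W₁ ++ x :: (W₂ ++ y :: W₃)) F) :
    (M.chord x y).HasFaces n (W₁ ++ x :: M.D :: W₃) ((W₂ ++ [y, M.D + 1]) :: F) := by
  have hlt : ∀ z, z ∈ (W₁ ++ x :: (W₂ ++ y :: W₃)) ++ F.flatten → z < M.D :=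
    fun z hz => (h.mem z).1 hz
  have hx : x < M.D := hlt x (by simp)
  have hy : y < M.D := hlt y (by simp)
  have hnd := h.nodup
  have hxy : x ≠ y := by
    simp only [List.nodup_append, List.nodup_cons] at hnd
    grind
  have hD : M.D ∉ (W₁ ++ x :: (W₂ ++ y :: W₃)) ++ F.flatten := fun hz => lt_irrefl _ (hlt _ hz)
  have hD' : M.D + 1 ∉ (W₁ ++ x :: (W₂ ++ y :: W₃)) ++ F.flatten := fun hz => by
    have := hlt _ hz
    omega
  have hcongr : ∀ z ∈ (W₁ ++ x :: (W₂ ++ y :: W₃)) ++ F.flatten, z ≠ x → z ≠ y →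
      (M.chord x y).face z = M.face z := fun z hz h1 h2 => chord_face hM hx hy (hlt z hz) h1 h2
  have hnd' : x ∉ W₁ ∧ y ∉ W₁ ∧ x ∉ W₂ ∧ y ∉ W₂ ∧ x ∉ W₃ ∧ y ∉ W₃ ∧ x ∉ F.flatten ∧
      y ∉ F.flatten := by
    simp only [List.nodup_append, List.nodup_cons] at hnd
    grind
  obtain ⟨x₁, y₁, x₂, y₂, x₃, y₃, xF, yF⟩ := hnd'
  -- The old and the new outer walk start at the same arrival, so both close up at `z`.
  obtain ⟨z, hz⟩ : ∃ z, ∀ l, (W₁ ++ x :: l).take 1 = [z] := by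
    cases W₁ with
    | nil => exact ⟨x, fun l => by simp⟩
    | cons a l' => exact ⟨a, fun l => by simp⟩
  have hout := h.outer
  rw [IsClosedWalk, hz, show W₁ ++ x :: (W₂ ++ y :: W₃) ++ [z] =
    W₁ ++ x :: (W₂ ++ y :: (W₃ ++ [z])) by simp, List.isChain_split] at hout
  obtain ⟨c₁, hout⟩ := hout
  obtain ⟨c₂, c₃⟩ := (List.isChain_split (l₁ := x :: W₂)).1 hout
  refine ⟨?_, ?_, by simp, ?_, ?_, ?_⟩
  · simp only [List.nodup_append, List.nodup_cons, List.flatten_cons] at hnd ⊢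
    grind
  · intro z
    have := h.mem z
    rw [chord_D]
    simp only [List.mem_append, List.mem_cons, List.flatten_cons] at this ⊢
    grind
  · rw [IsClosedWalk, hz, show W₁ ++ x :: M.D :: W₃ ++ [z] = W₁ ++ x :: (M.D :: (W₃ ++ [z])) by
      simp, List.isChain_split, List.isChain_cons_cons, chord_face_left hM hx hy hxy]
    refine ⟨isChain_congr c₁ fun a ha => hcongr a (by simp [ha]) (by grind) (by grind), rfl, ?_⟩
    obtain ⟨q, l, hq⟩ : ∃ q l, W₃ ++ [z] = q :: l := by cases W₃ <;> simp
    have c₄ : (W₃ ++ [z]).IsChain (fun a b => (M.chord x y).face a = b) :=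
      isChain_congr c₃.tail fun a ha => hcongr a (by simp [ha]) (by grind) (by grind)
    rw [hq] at c₃ c₄ ⊢
    rw [List.isChain_cons_cons] at c₃ ⊢
    exact ⟨(chord_face_new_left hM hx hy).trans c₃.1, c₄⟩
  · intro l hl
    rcases List.mem_cons.1 hl with rfl | hl
    · refine ⟨by simp, ?_⟩
      obtain ⟨q, l, hq⟩ : ∃ q l, W₂ ++ [y] = q :: l := by cases W₂ <;> simp
      have hq' : (W₂ ++ [y, M.D + 1]).take 1 = [q] := by
        rw [show W₂ ++ [y, M.D + 1] = (W₂ ++ [y]) ++ [M.D + 1] by simp, hq]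
        simp
      have c₄ : (W₂ ++ [y]).IsChain (fun a b => (M.chord x y).face a = b) :=
        isChain_congr c₂.tail fun a ha => hcongr a (by simp [ha]) (by grind) (by grind)
      rw [List.cons_append, hq, List.isChain_cons_cons] at c₂
      rw [IsClosedWalk, hq', show W₂ ++ [y, M.D + 1] ++ [q] = W₂ ++ y :: [M.D + 1, q] by simp,
        List.isChain_split]
      refine ⟨c₄, ?_⟩
      rw [List.isChain_cons_cons, List.isChain_cons_cons]
      exact ⟨chord_face_right hy, (chord_face_new_right hM hx hy).trans c₂.1, by simp⟩
    · refine ⟨(h.inner l hl).1, isClosedWalk_congr (h.inner l hl).2 fun a ha => ?_⟩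
      have haF : a ∈ F.flatten := List.mem_flatten.2 ⟨l, hl, ha⟩
      exact hcongr a (by simp [haF]) (fun e => xF (e ▸ haF)) (fun e => yF (e ▸ haF))
  · have := h.euler
    simp only [List.length_cons, chord_D]
    omega

theorem IsPlane.chord {T : HalfEdgeMap} {n : ℕ} {M : HalfEdgeMap} {x y : ℕ} {W₁ W₂ W₃ : List ℕ}
    {F : List (List ℕ)} (h : IsPlane T n M (W₁ ++ x :: (W₂ ++ y :: W₃)) F)
    (hne : M.head x ≠ M.head y) (he : ¬ M.Edge (M.head x) (M.head y)) :
    IsPlane T n (M.chord x y) (W₁ ++ x :: M.D :: W₃) ((W₂ ++ [y, M.D + 1]) :: F) := by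
  have hx : x < M.D := (h.mem x).1 (by simp)
  have hy : y < M.D := (h.mem y).1 (by simp)
  exact ⟨h.toIsSimpleMap.chord hx hy hne he, h.toHasFaces.chord h.toIsSimpleMap,
    h.toExtends.trans (extends_chord M x y), fun z hz => chord_firstBelow h.toIsSimpleMap hx hy
      (fun e => hne (by rw [e])) h.le (hz.trans_le h.le) (h.first z hz)⟩

end HalfEdgeMap

/-! ### The order of the points of a list -/

/-- `x` and `y` are points of `l`, and `y` does not come before `x`. -/
def InOrder (l : List ℕ) (x y : ℕ) : Prop := x ∈ l ∧ y ∈ l ∧ l.idxOf x ≤ l.idxOf y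

theorem InOrder.refl {l : List ℕ} {x : ℕ} (h : x ∈ l) : InOrder l x x := ⟨h, h, le_rfl⟩

theorem InOrder.trans {l : List ℕ} {x y z : ℕ} (h : InOrder l x y) (h' : InOrder l y z) :
    InOrder l x z := ⟨h.1, h'.2.1, h.2.2.trans h'.2.2⟩

theorem InOrder.append_left {l₁ l₂ : List ℕ} {x y : ℕ} (h : InOrder l₁ x y) :
    InOrder (l₁ ++ l₂) x y :=
  ⟨List.mem_append_left _ h.1, List.mem_append_left _ h.2.1, by
    rw [List.idxOf_append_of_mem h.1, List.idxOf_append_of_mem h.2.1]; exact h.2.2⟩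

theorem InOrder.append_right {l₁ l₂ : List ℕ} {x y : ℕ} (h : InOrder l₂ x y) (hx : x ∉ l₁)
    (hy : y ∉ l₁) : InOrder (l₁ ++ l₂) x y :=
  ⟨List.mem_append_right _ h.1, List.mem_append_right _ h.2.1, by
    rw [List.idxOf_append_of_notMem hx, List.idxOf_append_of_notMem hy]
    exact Nat.add_le_add_left h.2.2 _⟩

theorem InOrder.of_append_left {l₁ l₂ : List ℕ} {x y : ℕ} (h : InOrder (l₁ ++ l₂) x y)
    (hx : x ∈ l₁) (hy : y ∈ l₁) : InOrder l₁ x y := by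
  have := h.2.2
  rw [List.idxOf_append_of_mem hx, List.idxOf_append_of_mem hy] at this
  exact ⟨hx, hy, this⟩

theorem InOrder.of_append_right {l₁ l₂ : List ℕ} {x y : ℕ} (h : InOrder (l₁ ++ l₂) x y)
    (hx : x ∉ l₁) (hy : y ∉ l₁) : InOrder l₂ x y := by
  have := h.2.2
  rw [List.idxOf_append_of_notMem hx, List.idxOf_append_of_notMem hy] at this
  have h1 := h.1
  have h2 := h.2.1
  simp only [List.mem_append] at h1 h2
  exact ⟨h1.resolve_left hx, h2.resolve_left hy, by omega⟩

theorem InOrder.append_append {l₁ l₂ : List ℕ} {x y : ℕ} (hx : x ∈ l₁) (hy : y ∈ l₂)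
    (hy' : y ∉ l₁) : InOrder (l₁ ++ l₂) x y :=
  ⟨List.mem_append_left _ hx, List.mem_append_right _ hy, by
    rw [List.idxOf_append_of_mem hx, List.idxOf_append_of_notMem hy']
    have := List.idxOf_lt_length_of_mem hx
    omega⟩

theorem InOrder.mem_left {l₁ l₂ : List ℕ} {x y : ℕ} (h : InOrder (l₁ ++ l₂) x y) (hy : y ∈ l₁) :
    x ∈ l₁ := by
  by_contra hx
  have := h.2.2
  rw [List.idxOf_append_of_notMem hx, List.idxOf_append_of_mem hy] at this
  have := List.idxOf_lt_length_of_mem hy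
  omega

theorem InOrder.cons {l : List ℕ} {x y : ℕ} (hy : y ∈ l) : InOrder (x :: l) x y :=
  ⟨by simp, by simp [hy], by simp⟩

/-- How the order changes if the points of `l` between `x` and `y`, and `y` itself, are replaced
by `A`. -/
structure ShortCut (l l' : List ℕ) (x y A : ℕ) : Prop where
  before : ∀ p q, InOrder l p q → InOrder l q x → InOrder l' p q
  across : ∀ p q, InOrder l p x → InOrder l y q → q ≠ y → InOrder l' p q
  after : ∀ p q, InOrder l p q → InOrder l y p → p ≠ y → InOrder l' p q
  new : ∀ p, InOrder l p x → InOrder l' p A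
  last : ∀ s e, l = s ++ [e] → y ≠ e → ∃ s', l' = s' ++ [e]
  mem : A ∈ l'

/-- Split `l` at its unique occurrences of `x` and `y`. The arrival `x` remains available for
further chords, while `y` is swallowed and `A` takes its place. -/
theorem InOrder.exists_shortCut {l : List ℕ} {x y A : ℕ} (h : InOrder l x y) (hxy : x ≠ y)
    (hl : l.Nodup) (hA : A ∉ l) :
    ∃ P Q R, l = P ++ x :: (Q ++ y :: R) ∧ ShortCut l (P ++ x :: A :: R) x y A := by
  obtain ⟨P, Q', rfl⟩ := List.append_of_mem h.1
  have hy : y ∈ Q' := by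
    have h1 : y ∉ P ++ [x] := by
      intro hy
      rw [show P ++ x :: Q' = (P ++ [x]) ++ Q' by simp] at h hl
      have h2 : InOrder (P ++ [x]) x y := h.of_append_left (by simp) hy
      rcases List.mem_append.1 hy with hy | hy
      · have := h2.mem_left hy
        simp only [List.nodup_append] at hl
        grind
      · simp only [List.mem_singleton] at hy
        exact hxy hy.symm
    have := h.2.1
    simp only [List.mem_append, List.mem_cons] at this h1
    grind
  obtain ⟨Q, R, rfl⟩ := List.append_of_mem hy
  have hx' : ∀ p, InOrder (P ++ x :: (Q ++ y :: R)) p x → p ∈ P ++ [x] := fun p hp => by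
    rw [show P ++ x :: (Q ++ y :: R) = (P ++ [x]) ++ (Q ++ y :: R) by simp] at hp
    exact hp.mem_left (by simp)
  have hdis : ∀ p ∈ P ++ [x], p ∉ Q ++ y :: R := by
    simp only [List.nodup_append, List.nodup_cons] at hl
    grind
  have hy' : ∀ q, InOrder (P ++ x :: (Q ++ y :: R)) y q → q ≠ y → q ∈ R := fun q hq hqy => by
    rw [show P ++ x :: (Q ++ y :: R) = (P ++ x :: Q) ++ (y :: R) by simp] at hq hl
    have h1 : q ∉ P ++ x :: Q := fun h => by
      have := hq.mem_left h
      simp only [List.nodup_append] at hl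
      grind
    have := hq.2.1
    simp only [List.mem_append, List.mem_cons] at this h1
    grind
  have hR : ∀ p ∈ R, p ∉ P ++ x :: (Q ++ [y]) := by
    simp only [List.nodup_append, List.nodup_cons] at hl
    grind
  refine ⟨P, Q, R, rfl, ?_, ?_, ?_, ?_, ?_, by simp⟩
  · intro p q hpq hq
    have h1 := hx' q hq
    rw [show P ++ x :: (Q ++ y :: R) = (P ++ [x]) ++ (Q ++ y :: R) by simp] at hpq
    rw [show P ++ x :: A :: R = (P ++ [x]) ++ (A :: R) by simp]
    exact (hpq.of_append_left (hpq.mem_left h1) h1).append_left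
  · intro p q hp hq hqy
    have h1 := hy' q hq hqy
    rw [show P ++ x :: A :: R = (P ++ [x]) ++ (A :: R) by simp]
    exact .append_append (hx' p hp) (by simp [h1]) (by grind)
  · intro p q hpq hp hpy
    have h1 := hy' p hp hpy
    have h2 : q ∈ R := hy' q (hp.trans hpq) (by
      rintro rfl
      have h3 := hp.2.2.antisymm hpq.2.2
      exact hpy ((List.idxOf_inj hp.1).1 h3).symm)
    rw [show P ++ x :: (Q ++ y :: R) = (P ++ x :: (Q ++ [y])) ++ R by simp] at hpq
    rw [show P ++ x :: A :: R = (P ++ [x, A]) ++ R by simp]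
    refine (hpq.of_append_right (hR p h1) (hR q h2)).append_right ?_ ?_
    · have := hR p h1
      grind
    · have := hR q h2
      grind
  · intro p hp
    rw [show P ++ x :: A :: R = (P ++ [x]) ++ (A :: R) by simp]
    exact .append_append (hx' p hp) (by simp) (by grind)
  · intro s e hs hye
    rcases List.eq_nil_or_concat R with rfl | ⟨R', e', rfl⟩
    · have h1 : (P ++ x :: Q) ++ [y] = s ++ [e] := by simpa using hs
      have h2 := (List.append_inj' h1 rfl).2
      simp only [List.cons.injEq, and_true] at h2
      exact (hye h2).elim
    · have h1 : (P ++ x :: (Q ++ y :: R')) ++ [e'] = s ++ [e] := by simpa using hs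
      have h2 := (List.append_inj' h1 rfl).2
      simp only [List.cons.injEq, and_true] at h2
      exact ⟨P ++ x :: A :: R', by simp [h2]⟩

namespace HalfEdgeMap

/-- A chord between two corners of the stretch `l` leaves the rest of the outer walk untouched. This
makes the induction over branches local. -/
theorem IsPlane.exists_chord {T M : HalfEdgeMap} {n x y : ℕ} {W₁ W₃ l : List ℕ} {F : List (List ℕ)}
    (h : IsPlane T n M (W₁ ++ (l ++ W₃)) F) (hxy : InOrder l x y)
    (hne : M.head x ≠ M.head y) (he : ¬ M.Edge (M.head x) (M.head y)) :
    ∃ l' F', IsPlane T n (M.chord x y) (W₁ ++ (l' ++ W₃)) F' ∧ ShortCut l l' x y M.D := by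
  have hnd := h.nodup
  have hl : l.Nodup := by
    simp only [List.nodup_append] at hnd
    grind
  have hA : M.D ∉ l := fun hA => lt_irrefl M.D ((h.mem M.D).1 (by simp [hA]))
  obtain ⟨P, Q, R, rfl, hs⟩ := hxy.exists_shortCut (fun e => hne (by rw [e])) hl hA
  have h1 : IsPlane T n M ((W₁ ++ P) ++ x :: (Q ++ y :: (R ++ W₃))) F := by
    simpa using h
  exact ⟨_, _, by simpa using h1.chord hne he, hs⟩

theorem IsPlane.lt_of_mem {T M : HalfEdgeMap} {n x : ℕ} {W₁ W₃ l : List ℕ} {F : List (List ℕ)}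
    (h : IsPlane T n M (W₁ ++ (l ++ W₃)) F) (hx : x ∈ l) : x < M.D :=
  (h.mem x).1 (by simp [hx])

end HalfEdgeMap

/-! ### Pending corners on the outer boundary walk -/

namespace HalfEdgeMap

/-- The arrivals `a`, `b`, `c` are the pending corners of the complete branch `S` with the root `w`,
in the order in which they follow on the boundary walk `l`. -/
structure FullAt (M : HalfEdgeMap) (S : Set ℕ) (w : ℕ) (l : List ℕ) (k a b c : ℕ) : Prop where
  ab : InOrder l a b
  bc : InOrder l b c
  two : k = 2 → b = a
  conn : FullBranch M.Edge S w k (M.head a) (M.head b) (M.head c)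

/-- The arrivals `a`, `b`, `c` are the pending corners of the incomplete branch `S` with the root
`w`, in the order in which they follow on the boundary walk `l`. -/
structure PartialAt (M : HalfEdgeMap) (S : Set ℕ) (w : ℕ) (l : List ℕ) (k a b c : ℕ) : Prop where
  ab : InOrder l a b
  bc : InOrder l b c
  two : k = 2 → b = a
  conn : PartialBranch M.Edge S w k (M.head a) (M.head b) (M.head c)

variable {T M N : HalfEdgeMap} {n : ℕ} {S S' : Set ℕ} {w w' k k' a b c a' b' c' d e : ℕ}
  {l l' W₁ W₃ : List ℕ} {F : List (List ℕ)}

theorem FullAt.partialAt (h : FullAt M S w l k a b c) (ha : M.head a ≠ w) :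
    PartialAt M S w l k a b c :=
  ⟨h.ab, h.bc, h.two, h.conn.partialBranch ha⟩

theorem PartialAt.extends (h : PartialAt M S w l k a b c) (hM : M.IsSimpleMap n)
    (hl : ∀ z ∈ l, z < M.D) (hN : M.Extends N) : PartialAt N S w l k a b c := by
  have hh : ∀ z ∈ l, N.head z = M.head z := fun z hz => hN.head (hl z hz) (hM.rev_lt z (hl z hz))
  refine ⟨h.ab, h.bc, h.two, ?_⟩
  rw [hh a h.ab.1, hh b h.ab.2.1, hh c h.bc.2.1]
  exact h.conn.mono fun u v => hN.edge hM.rev_lt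

theorem IsPlane.head_chord (h : IsPlane T n M (W₁ ++ (l ++ W₃)) F) {x y z : ℕ} (hz : z ∈ l) :
    (M.chord x y).head z = M.head z :=
  HalfEdgeMap.chord_head h.toIsSimpleMap (h.lt_of_mem hz)

theorem fullAt_leaf (hd : M.head d = w) : FullAt M {w} w [d] 2 d d d :=
  ⟨.refl (by simp), .refl (by simp), fun _ => rfl, by rw [hd]; exact .leaf _ _⟩

theorem IsPlane.nodup_part (h : IsPlane T n M (W₁ ++ (l ++ W₃)) F) : l.Nodup := by
  have hnd := h.nodup
  simp only [List.nodup_append] at hnd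
  grind

theorem InOrder.enclose {l : List ℕ} {d e x y : ℕ} (h : InOrder l x y)
    (hnd : (d :: (l ++ [e])).Nodup) : InOrder (d :: (l ++ [e])) x y := by
  have h1 := h.1
  have h2 := h.2.1
  rw [List.nodup_cons] at hnd
  exact (h.append_left (l₂ := [e])).append_right (l₁ := [d]) (by grind) (by grind)

theorem FullAt.first (h : FullAt M S w l k a b c)
    (hP : IsPlane T n M (W₁ ++ ((d :: (l ++ [e])) ++ W₃)) F) (hw : w' ∉ S) (he : M.Edge w' w) :
    PartialAt M (insert w' S) w' (d :: (l ++ [e])) k a b c :=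
  ⟨InOrder.enclose h.ab hP.nodup_part, InOrder.enclose h.bc hP.nodup_part, h.two,
    h.conn.toPartialBranch hw he hP.edge_symm⟩

theorem FullAt.unary_two (h : FullAt M S w l 2 a b c)
    (hP : IsPlane T n M (W₁ ++ ((d :: (l ++ [e])) ++ W₃)) F) (hw : w' ∉ S) (he : M.Edge w' w)
    (hd : M.head d = w') : FullAt M (insert w' S) w' (d :: (l ++ [e])) 3 d a c := by
  refine ⟨.cons (by simp [h.ab.1]), InOrder.enclose (h.ab.trans h.bc) hP.nodup_part,
    by simp, ?_⟩
  rw [hd]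
  exact h.conn.unary_two hw he hP.edge_symm

/-- The chord runs from the last pending corner to the last arrival `e` at the new root, so the
corners `a` and `b` lie before it and stay on the outer face. -/
theorem FullAt.unary_three (h : FullAt M S w l k a b c) (hk : k ≠ 2)
    (hP : IsPlane T n M (W₁ ++ ((d :: (l ++ [e])) ++ W₃)) F) (hw : w' ∉ S) (he : M.Edge w' w)
    (hhe : M.head e = w') (hno : ∀ u ∈ S, u ≠ w → ¬ M.Edge u w') :
    ∃ l' F', IsPlane T n (M.chord c e) (W₁ ++ (l' ++ W₃)) F' ∧
      FullAt (M.chord c e) (insert w' S) w' l' 2 a a b := by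
  have hdis := h.conn.distinct hk
  have hab := InOrder.enclose h.ab hP.nodup_part
  have hbc := InOrder.enclose h.bc hP.nodup_part
  have hce : InOrder (d :: (l ++ [e])) c e := by
    have hnd := hP.nodup_part
    have hc := h.bc.2.1
    rw [List.nodup_cons, List.nodup_append] at hnd
    rw [← List.cons_append]
    exact .append_append (by simp [hc]) (by simp) (by grind)
  have hne : M.head c ≠ M.head e := fun heq => hw (by rw [← hhe, ← heq]; exact h.conn.hc)
  have hno' : ¬ M.Edge (M.head c) (M.head e) := by
    rw [hhe]
    exact hno _ h.conn.hc hdis.2.2.2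
  obtain ⟨l', F', hP', hs⟩ := hP.exists_chord hce hne hno'
  refine ⟨l', F', hP', hs.before _ _ (.refl hab.1) (hab.trans hbc), hs.before _ _ hab hbc,
    fun _ => rfl, ?_⟩
  rw [hP.head_chord hab.1, hP.head_chord hbc.1]
  refine (h.conn.mono fun u v => (extends_chord M c e).edge hP.rev_lt).unary_three hk hw
    ((extends_chord M c e).edge hP.rev_lt he) ?_ hP'.edge_symm
  rw [chord_edge hP.toIsSimpleMap, hhe]
  exact Or.inr (Or.inr ⟨rfl, rfl⟩)

section Merge

variable (hA : PartialAt M S w l k a b c) (hB : FullAt M S' w' l' k' a' b' c')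
  (hP : IsPlane T n M (W₁ ++ ((l ++ l' ++ [e]) ++ W₃)) F) (hd : ∀ v ∈ S, v ∉ S')
  (hww : M.Edge w w') (hno : ∀ u ∈ S, u ≠ w → ∀ v ∈ S', ¬ M.Edge u v)
include hA hB hP hd hww hno

omit hww in
/-- The first chord of a merge. -/
theorem merge_chord : ∃ m F', IsPlane T n (M.chord c a') (W₁ ++ ((m ++ [e]) ++ W₃)) F' ∧
    ShortCut (l ++ l' ++ [e]) (m ++ [e]) c a' M.D ∧
    (M.chord c a').Edge (M.head c) (M.head a') ∧
    InOrder (m ++ [e]) a b ∧ InOrder (m ++ [e]) b (if c' = a' then M.D else c') ∧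
    (a' ≠ b' → InOrder (m ++ [e]) b b' ∧ InOrder (m ++ [e]) b' c') ∧
    (M.chord c a').head (if c' = a' then M.D else c') = M.head c' := by
  have hnd := hP.nodup_part
  rw [List.nodup_append, List.nodup_append] at hnd
  have hll : ∀ x ∈ l, x ∉ l' := fun x hx hx' => hnd.1.2.2 x hx x hx' rfl
  have hcross : ∀ x ∈ l, ∀ y ∈ l', InOrder (l ++ l' ++ [e]) x y := fun x hx y hy =>
    (InOrder.append_append hx hy fun h => hll y h hy).append_left
  have hin : ∀ x y, InOrder l x y → InOrder (l ++ l' ++ [e]) x y := fun x y h =>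
    h.append_left.append_left
  have hin' : ∀ x y, InOrder l' x y → InOrder (l ++ l' ++ [e]) x y := fun x y h =>
    (h.append_right (fun hx => hll x hx h.1) (fun hy => hll y hy h.2.1)).append_left
  have hne : M.head c ≠ M.head a' := fun h => hd _ hA.conn.hc (h ▸ hB.conn.ha)
  have hno' : ¬ M.Edge (M.head c) (M.head a') := hno _ hA.conn.hc hA.conn.cw _ hB.conn.ha
  have hae : a' ≠ e := fun h => hnd.2.2 a' (by simp [hB.ab.1]) e (by simp) h
  obtain ⟨m', F', hP', hs⟩ := hP.exists_chord (hcross c hA.bc.2.1 a' hB.ab.1) hne hno'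
  obtain ⟨m, rfl⟩ := hs.last _ _ rfl hae
  refine ⟨m, F', hP', hs, ?_, hs.before _ _ (hin _ _ hA.ab) (hin _ _ hA.bc), ?_, ?_, ?_⟩
  · rw [chord_edge hP.toIsSimpleMap]
    exact Or.inr (Or.inl ⟨rfl, rfl⟩)
  -- Both outer pending edges of the right branch may sit at one corner, as at a leaf. The chord
  -- swallows that arrival, and its own half-edge `M.D`, which arrives at the same vertex, takes
  -- over as the pending corner.
  · split_ifs with hca
    · exact hs.new _ (hin _ _ hA.bc)
    · exact hs.across _ _ (hin _ _ hA.bc) (hin' _ _ (hB.ab.trans hB.bc)) hca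
  · intro hab
    exact ⟨hs.across _ _ (hin _ _ hA.bc) (hin' _ _ hB.ab) hab.symm,
      hs.after _ _ (hin' _ _ hB.bc) (hin' _ _ hB.ab) hab.symm⟩
  · split_ifs with hca
    · rw [chord_head_left, hca]
    · exact hP.head_chord (by simp [hB.bc.2.1])

theorem merge_two_two (hk : k = 2) (hk' : k' = 2) :
    ∃ m F', IsPlane T n (M.chord c a') (W₁ ++ ((m ++ [e]) ++ W₃)) F' ∧
      FullAt (M.chord c a') (S ∪ S') w (m ++ [e]) 2 a b (if c' = a' then M.D else c') := by
  obtain ⟨m, F', hP', -, hE, h1, h2, -, h4⟩ := merge_chord hA hB hP hd hno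
  have hmono := fun u v => (extends_chord M c a').edge (u := u) (v := v) hP.rev_lt
  subst hk hk'
  refine ⟨m, F', hP', h1, h2, hA.two, ?_⟩
  rw [h4, hP.head_chord (by simp [hA.ab.1]), hP.head_chord (by simp [hA.ab.2.1])]
  exact (hA.conn.mono hmono).merge_two_two (hB.conn.mono hmono) hd (hmono _ _ hww) hE hP'.edge_symm

theorem merge_two_three (hk : k = 2) (hk' : k' ≠ 2) :
    ∃ m F', IsPlane T n (M.chord c a') (W₁ ++ ((m ++ [e]) ++ W₃)) F' ∧
      FullAt (M.chord c a') (S ∪ S') w (m ++ [e]) 4 a b' (if c' = a' then M.D else c') := by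
  obtain ⟨m, F', hP', -, hE, h1, h2, h3, h4⟩ := merge_chord hA hB hP hd hno
  have hmono := fun u v => (extends_chord M c a').edge (u := u) (v := v) hP.rev_lt
  subst hk
  have hdis := hB.conn.distinct hk'
  obtain ⟨h5, h6⟩ := h3 (fun h => hdis.1 (by rw [h]))
  have hca : c' ≠ a' := fun h => hdis.2.1 (by rw [h])
  rw [if_neg hca] at h4 ⊢
  refine ⟨m, F', hP', h1.trans h5, h6, by simp, ?_⟩
  rw [h4, hP.head_chord (by simp [hA.ab.1]), hP.head_chord (by simp [hB.ab.2.1])]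
  exact (hA.conn.mono hmono).merge_two_three (hB.conn.mono hmono) hk' hd (hmono _ _ hww) hE
    hP'.edge_symm

theorem merge_three_two (hk : k ≠ 2) (hk' : k' = 2) :
    ∃ m F', IsPlane T n (M.chord c a') (W₁ ++ ((m ++ [e]) ++ W₃)) F' ∧
      FullAt (M.chord c a') (S ∪ S') w (m ++ [e]) 5 a b (if c' = a' then M.D else c') := by
  obtain ⟨m, F', hP', -, hE, h1, h2, -, h4⟩ := merge_chord hA hB hP hd hno
  have hmono := fun u v => (extends_chord M c a').edge (u := u) (v := v) hP.rev_lt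
  subst hk'
  refine ⟨m, F', hP', h1, h2, by simp, ?_⟩
  rw [h4, hP.head_chord (by simp [hA.ab.1]), hP.head_chord (by simp [hA.ab.2.1])]
  exact (hA.conn.mono hmono).merge_three_two hk (hB.conn.mono hmono) hd (hmono _ _ hww) hE
    hP'.edge_symm

/-- Since `b` does not come after `c` and `b'` comes after `a'`, the second chord is nested around
the first. -/
theorem merge_three_three (hk : k ≠ 2) (hk' : k' ≠ 2) :
    ∃ m F', IsPlane T n ((M.chord c a').chord b b') (W₁ ++ ((m ++ [e]) ++ W₃)) F' ∧
      FullAt ((M.chord c a').chord b b') (S ∪ S') w (m ++ [e]) 2 a a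
        (if c' = b' then M.D + 2 else c') := by
  obtain ⟨m, F', hP', hs, hE, h1, h2, h3, h4⟩ := merge_chord hA hB hP hd hno
  have hdis := hB.conn.distinct hk'
  obtain ⟨h5, h6⟩ := h3 (fun h => hdis.1 (by rw [h]))
  have hb : (M.chord c a').head b = M.head b := hP.head_chord (by simp [hA.ab.2.1])
  have hb' : (M.chord c a').head b' = M.head b' := hP.head_chord (by simp [hB.ab.2.1])
  have ha : (M.chord c a').head a = M.head a := hP.head_chord (by simp [hA.ab.1])
  have hc' : (M.chord c a').head c' = M.head c' := hP.head_chord (by simp [hB.bc.2.1])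
  have hne : (M.chord c a').head b ≠ (M.chord c a').head b' := by
    rw [hb, hb']
    exact fun h => hd _ hA.conn.hb (h ▸ hB.conn.hb)
  -- The second chord cannot be parallel to the first: `a'` and `b'` lie at different vertices and
  -- the two branches are disjoint.
  have hno' : ¬ (M.chord c a').Edge ((M.chord c a').head b) ((M.chord c a').head b') := by
    rw [chord_edge hP.toIsSimpleMap, hb, hb']
    rintro (h | ⟨-, h⟩ | ⟨h, -⟩)
    · exact hno _ hA.conn.hb hA.conn.bw _ hB.conn.hb h
    · exact hdis.1 h.symm
    · exact hd _ hA.conn.hb (h ▸ hB.conn.ha)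
  have hb'e : b' ≠ e := by
    have hnd := hP.nodup_part
    rw [List.nodup_append] at hnd
    exact fun h => hnd.2.2 b' (by simp [hB.ab.2.1]) e (by simp) h
  obtain ⟨m₂', F₂, hP₂, hs₂⟩ := hP'.exists_chord h5 hne hno'
  obtain ⟨m₂, rfl⟩ := hs₂.last _ _ rfl hb'e
  have hmono := fun u v => ((extends_chord M c a').trans
    (extends_chord (M.chord c a') b b')).edge (u := u) (v := v) hP.rev_lt
  refine ⟨m₂, F₂, hP₂, hs₂.before _ _ (.refl h1.1) h1, ?_, fun _ => rfl, ?_⟩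
  · split_ifs with hcb
    · exact hs₂.new _ h1
    · exact hs₂.across _ _ h1 h6 hcb
  · have hh : ((M.chord c a').chord b b').head (if c' = b' then M.D + 2 else c') = M.head c' := by
      split_ifs with hcb
      · rw [← chord_D (M := M) (x := c) (y := a'), chord_head_left, hb', hcb]
      · rw [hP'.head_chord h6.2.1, hc']
    rw [hh, hP'.head_chord h1.1, ha]
    refine (hA.conn.mono hmono).merge_three_three hk (hB.conn.mono hmono) hk' hd (hmono _ _ hww)
      ?_ ?_ hP₂.edge_symm
    · exact (extends_chord (M.chord c a') b b').edge hP'.rev_lt hE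
    · rw [chord_edge hP'.toIsSimpleMap, hb, hb']
      exact Or.inr (Or.inl ⟨rfl, rfl⟩)

end Merge

end HalfEdgeMap

namespace HalfEdgeMap

/-! ### The shape of a plane tree -/

/-- How the boundary walk of the tree `T` traverses the branch that is entered by the half-edge `d`.
`S` is the set of visited vertices, and `l` the list of arrivals at them. With `none`, the walk
has visited the whole branch; with `some c`, it has visited the children of the head of `d` up to
the head of `c`, which is not the last one. The function `dem` prescribes the number of edges that
are missing at a vertex. -/
inductive Shape (T : HalfEdgeMap) (dem : ℕ → ℕ) : ℕ → Option ℕ → Finset ℕ → List ℕ → Prop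
  | leaf {d : ℕ} (hn : T.nxt (T.rev d) = T.rev d) (hdem : dem (T.head d) = 2) :
      Shape T dem d none {T.head d} [d]
  | unary {d c : ℕ} {S : Finset ℕ} {l : List ℕ} (hc : T.nxt (T.rev d) = c) (hcd : c ≠ T.rev d)
      (hn : T.nxt c = T.rev d) (hdem : dem (T.head d) = 1) (hS : Shape T dem c none S l)
      (hD : c < T.D) (ht : T.tail c = T.head d) (hw : T.head d ∉ S)
      (hno : ∀ u ∈ S, u ≠ T.head c → ¬ T.Edge u (T.head d)) :
      Shape T dem d none (insert (T.head d) S) (d :: (l ++ [T.rev c]))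
  | first {d c : ℕ} {S : Finset ℕ} {l : List ℕ} (hc : T.nxt (T.rev d) = c) (hcd : c ≠ T.rev d)
      (hn : T.nxt c ≠ T.rev d) (hdem : dem (T.head d) = 0) (hS : Shape T dem c none S l)
      (hD : c < T.D) (ht : T.tail c = T.head d) (hw : T.head d ∉ S) :
      Shape T dem d (some c) (insert (T.head d) S) (d :: (l ++ [T.rev c]))
  | next {d c c' : ℕ} {S S' : Finset ℕ} {l l' : List ℕ} (hS : Shape T dem d (some c) S l)
      (hc : T.nxt c = c') (hn : T.nxt c' ≠ T.rev d) (hS' : Shape T dem c' none S' l')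
      (hD : c' < T.D) (ht : T.tail c' = T.head d) (hd : ∀ v ∈ S, v ∉ S')
      (hno : ∀ u ∈ S, ∀ v ∈ S', T.Edge u v → u = T.head d ∧ v = T.head c') :
      Shape T dem d (some c') (S ∪ S') (l ++ l' ++ [T.rev c'])
  | last {d c c' : ℕ} {S S' : Finset ℕ} {l l' : List ℕ} (hS : Shape T dem d (some c) S l)
      (hc : T.nxt c = c') (hn : T.nxt c' = T.rev d) (hS' : Shape T dem c' none S' l')
      (hD : c' < T.D) (ht : T.tail c' = T.head d) (hd : ∀ v ∈ S, v ∉ S')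
      (hno : ∀ u ∈ S, ∀ v ∈ S', T.Edge u v → u = T.head d ∧ v = T.head c') :
      Shape T dem d none (S ∪ S') (l ++ l' ++ [T.rev c'])

/-- A map with a depth function that makes it a rooted tree. -/
structure IsRooted (n : ℕ) (T : HalfEdgeMap) (dep : ℕ → ℕ) : Prop extends IsSimpleMap n T where
  adj : ∀ h < T.D, dep (T.head h) = dep (T.tail h) + 1 ∨ dep (T.tail h) = dep (T.head h) + 1
  parent : ∀ h < T.D, ∀ h' < T.D, dep (T.head h) = dep (T.tail h) + 1 →
    dep (T.head h') = dep (T.tail h') + 1 → T.head h = T.head h' → T.tail h = T.tail h'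

/-- `c` is a child of `p`. -/
def IsChild (T : HalfEdgeMap) (dep : ℕ → ℕ) (p c : ℕ) : Prop :=
  T.Edge p c ∧ dep c = dep p + 1

/-- `v` is a descendant of `w`. -/
def IsDescendant (T : HalfEdgeMap) (dep : ℕ → ℕ) : ℕ → ℕ → Prop :=
  Relation.ReflTransGen (T.IsChild dep)

section Rooted

variable {T : HalfEdgeMap} {n : ℕ} {dep dem : ℕ → ℕ}

/-- By `cyc`, the orbit of `M.nxt i` returns to `i`, so `M.nxt` is surjective on a finite set. -/
theorem IsSimpleMap.nxt_inj {M : HalfEdgeMap} (hM : M.IsSimpleMap n) {a b : ℕ} (ha : a < M.D)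
    (hb : b < M.D) (h : M.nxt a = M.nxt b) : a = b := by
  let f : Fin M.D → Fin M.D := fun i => ⟨M.nxt i, hM.nxt_lt i i.2⟩
  have hlt : ∀ p q, p < M.D → Relation.ReflTransGen (fun a b => M.nxt a = b) p q → q < M.D := by
    intro p q hp hr
    induction hr with
    | refl => exact hp
    | tail _ e ih => exact e ▸ hM.nxt_lt _ ih
  have hf : Function.Surjective f := by
    intro ⟨i, hi⟩
    have h1 := hM.cyc (M.nxt i) (hM.nxt_lt i hi) i hi (hM.tail_nxt i hi)
    rcases Relation.ReflTransGen.cases_tail h1 with h2 | ⟨p, hp, h2⟩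
    · exact ⟨⟨i, hi⟩, Fin.ext h2.symm⟩
    · exact ⟨⟨p, hlt _ _ (hM.nxt_lt i hi) hp⟩, Fin.ext h2⟩
  have := (Finite.injective_iff_surjective.2 hf) (a₁ := ⟨a, ha⟩) (a₂ := ⟨b, hb⟩) (Fin.ext h)
  exact congrArg Fin.val this

theorem IsSimpleMap.iterate_nxt_lt {M : HalfEdgeMap} (hM : M.IsSimpleMap n) {a : ℕ} (ha : a < M.D)
    (k : ℕ) : M.nxt^[k] a < M.D ∧ M.tail (M.nxt^[k] a) = M.tail a := by
  induction k with
  | zero => exact ⟨ha, rfl⟩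
  | succ k ih =>
    rw [Function.iterate_succ_apply']
    exact ⟨hM.nxt_lt _ ih.1, (hM.tail_nxt _ ih.1).trans ih.2⟩

theorem IsSimpleMap.iterate_nxt_inj {M : HalfEdgeMap} (hM : M.IsSimpleMap n) {a b : ℕ}
    (ha : a < M.D) (hb : b < M.D) (k : ℕ) (h : M.nxt^[k] a = M.nxt^[k] b) : a = b := by
  induction k with
  | zero => exact h
  | succ k ih =>
    rw [Function.iterate_succ_apply', Function.iterate_succ_apply'] at h
    exact ih (hM.nxt_inj (hM.iterate_nxt_lt ha k).1 (hM.iterate_nxt_lt hb k).1 h)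

theorem IsDescendant.dep_le {a b : ℕ} (h : T.IsDescendant dep a b) : dep a ≤ dep b := by
  induction h with
  | refl => exact le_rfl
  | tail _ h ih => exact ih.trans (by have := h.2; omega)

theorem IsDescendant.eq_of_dep {a b : ℕ} (h : T.IsDescendant dep a b) (hd : dep a = dep b) :
    a = b := by
  rcases Relation.ReflTransGen.cases_head h with h | ⟨c, h1, h2⟩
  · exact h
  · have := IsDescendant.dep_le h2
    have := h1.2
    omega

variable (hT : T.IsRooted n dep)
include hT

theorem IsRooted.parent_unique {p q c : ℕ} (h : T.IsChild dep p c) (h' : T.IsChild dep q c) :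
    p = q := by
  obtain ⟨⟨x, hx, rfl, rfl⟩, h1⟩ := h
  obtain ⟨⟨y, hy, rfl, h2⟩, h3⟩ := h'
  rw [← h2] at h3
  exact hT.parent x hx y hy h1 h3 h2.symm

/-- Parents are unique, so the ancestors of a vertex form a chain. Branches of siblings are
therefore disjoint. -/
theorem IsRooted.eq_of_common {a b v : ℕ} (ha : T.IsDescendant dep a v)
    (hb : T.IsDescendant dep b v) (hd : dep a = dep b) : a = b := by
  have hu : Relator.RightUnique (Function.swap (T.IsChild dep)) := fun c p q h h' =>
    hT.parent_unique h h'
  rcases Relation.ReflTransGen.total_of_right_unique hu ha.swap hb.swap with h | h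
  · exact (IsDescendant.eq_of_dep (Relation.reflTransGen_swap.1 h) hd.symm).symm
  · exact IsDescendant.eq_of_dep (Relation.reflTransGen_swap.1 h) hd

/-- An edge joins a parent to a child, so it can lead into a branch only at its root and from that
root's parent. -/
theorem IsRooted.enter {w u v : ℕ} (e : T.Edge u v) (hv : T.IsDescendant dep w v)
    (hu : ¬ T.IsDescendant dep w u) : v = w ∧ T.IsChild dep u w := by
  obtain ⟨h, hh, rfl, rfl⟩ := e
  have e : T.Edge (T.tail h) (T.head h) := ⟨h, hh, rfl, rfl⟩
  rcases hT.adj h hh with h1 | h1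
  · rcases Relation.ReflTransGen.cases_tail hv with h2 | ⟨p, h2, h3⟩
    · exact ⟨h2, h2 ▸ ⟨e, h1⟩⟩
    · exact (hu (hT.parent_unique h3 ⟨e, h1⟩ ▸ h2)).elim
  · exact (hu (hv.tail ⟨hT.edge_symm _ _ e, h1⟩)).elim

/-- Induction on the height that may remain above the bound `B`. Inside, the rotation at the head of
`d` is followed from `T.rev d` through all children until it returns. -/
theorem IsRooted.exists_shape (B : ℕ) (hB : ∀ v < n, dep v ≤ B)
    (hdem : ∀ h < T.D, dem (T.tail h) =
      if T.nxt h = h then 2 else if T.nxt (T.nxt h) = h then 1 else 0) :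
    ∀ (k d : ℕ), d < T.D → dep (T.head d) = dep (T.tail d) + 1 → B < dep (T.head d) + k →
      ∃ S l, Shape T dem d none S l ∧ ∀ v ∈ S, T.IsDescendant dep (T.head d) v := by
  intro k
  induction k with
  | zero =>
    intro d hd _ hk
    have := hB _ (hT.tail_lt _ (hT.rev_lt d hd))
    rw [← head] at this
    omega
  | succ k ih =>
    intro d hd hdown hk
    have hrd := hT.rev_lt d hd
    -- Only one half-edge at the head of `d` leads upwards, namely `T.rev d`, because parents are
    -- unique and the graph is simple.
    have hsib : ∀ c < T.D, T.tail c = T.head d → c ≠ T.rev d →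
        dep (T.head c) = dep (T.head d) + 1 := by
      intro c hc ht hcd
      rcases hT.adj c hc with h | h
      · rw [h, ht]
      · exfalso
        have h1 := hT.parent (T.rev c) (hT.rev_lt c hc) d hd
          (by rw [hT.head_rev hc]; exact h) hdown (by rw [hT.head_rev hc, ht])
        refine hcd (hT.simple c hc (T.rev d) hrd ht ?_)
        rw [hT.head_rev hd, ← h1, head]
    have hchild : ∀ c < T.D, T.tail c = T.head d → c ≠ T.rev d →
        ∃ S l, Shape T dem c none S l ∧ ∀ v ∈ S, T.IsDescendant dep (T.head c) v := by
      intro c hc ht hcd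
      have h1 := hsib c hc ht hcd
      exact ih c hc (by rw [ht, h1]) (by omega)
    have hisch : ∀ c < T.D, T.tail c = T.head d → c ≠ T.rev d →
        T.IsChild dep (T.head d) (T.head c) := fun c hc ht hcd =>
      ⟨⟨c, hc, ht, rfl⟩, hsib c hc ht hcd⟩
    have hnotanc : ∀ c < T.D, T.tail c = T.head d → c ≠ T.rev d →
        ¬ T.IsDescendant dep (T.head c) (T.head d) := by
      intro c hc ht hcd h
      have h1 := IsDescendant.dep_le h
      have h2 := hsib c hc ht hcd
      omega
    have hdemd := hdem (T.rev d) hrd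
    rw [show T.tail (T.rev d) = T.head d from rfl] at hdemd
    by_cases h1 : T.nxt (T.rev d) = T.rev d
    · rw [if_pos h1] at hdemd
      exact ⟨_, _, .leaf h1 hdemd, by simpa using .refl⟩
    rw [if_neg h1] at hdemd
    have hc₁ := hT.nxt_lt _ hrd
    have ht₁ : T.tail (T.nxt (T.rev d)) = T.head d := hT.tail_nxt _ hrd
    obtain ⟨S₁, l₁, hS₁, hdesc₁⟩ := hchild _ hc₁ ht₁ h1
    have hw₁ : T.head d ∉ S₁ := fun h => hnotanc _ hc₁ ht₁ h1 (hdesc₁ _ h)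
    have hsub₁ : ∀ v ∈ insert (T.head d) S₁, T.IsDescendant dep (T.head d) v := by
      intro v hv
      rcases Finset.mem_insert.1 hv with rfl | hv
      · exact .refl
      · exact Relation.ReflTransGen.head (hisch _ hc₁ ht₁ h1) (hdesc₁ v hv)
    by_cases h2 : T.nxt (T.nxt (T.rev d)) = T.rev d
    · rw [if_pos h2] at hdemd
      refine ⟨_, _, .unary rfl h1 h2 hdemd hS₁ hc₁ ht₁ hw₁ ?_, hsub₁⟩
      intro u hu huc he
      exact huc (hT.enter (hT.edge_symm _ _ he) (hdesc₁ u hu) (hnotanc _ hc₁ ht₁ h1)).1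
    rw [if_neg h2] at hdemd
    -- Induction along the rotation from the next child `g` to `T.rev d`. The number `j` counts the
    -- children handled so far, and the rotation has not returned within `j + 1` steps.
    have hloop : ∀ g, Relation.ReflTransGen (fun a b => T.nxt a = b) g (T.rev d) →
        ∀ (j : ℕ) (c : ℕ) (S : Finset ℕ) (l : List ℕ), g = T.nxt c → c = T.nxt^[j] (T.rev d) →
        (∀ i, 0 < i → i ≤ j + 1 → T.nxt^[i] (T.rev d) ≠ T.rev d) → Shape T dem d (some c) S l →
        (∀ v ∈ S, v = T.head d ∨ ∃ i, 0 < i ∧ i ≤ j ∧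
          T.IsDescendant dep (T.head (T.nxt^[i] (T.rev d))) v) →
        ∃ S' l', Shape T dem d none S' l' ∧ ∀ v ∈ S', T.IsDescendant dep (T.head d) v := by
      intro g hg
      induction hg using Relation.ReflTransGen.head_induction_on with
      | refl =>
        intro j c S l hgc hcj hne _ _
        refine absurd ?_ (hne (j + 1) (by omega) le_rfl)
        rw [Function.iterate_succ_apply', ← hcj, ← hgc]
      | @head g g' hgg' _ ihl =>
        intro j c S l hgc hcj hne hS hSd
        have hgj : g = T.nxt^[j + 1] (T.rev d) := by
          rw [Function.iterate_succ_apply', ← hcj, ← hgc]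
        have hgD : g < T.D := hgj ▸ (hT.iterate_nxt_lt hrd (j + 1)).1
        have htg : T.tail g = T.head d := hgj ▸ (hT.iterate_nxt_lt hrd (j + 1)).2
        have hgd : g ≠ T.rev d := hgj ▸ hne (j + 1) (by omega) le_rfl
        obtain ⟨S', l', hS', hdesc'⟩ := hchild g hgD htg hgd
        -- A common descendant would make `g` equal to an earlier child half-edge, and then the
        -- rotation would have returned to `T.rev d` too early.
        have hsep : ∀ u ∈ S, ¬ T.IsDescendant dep (T.head g) u := by
          intro u hu hug
          rcases hSd u hu with rfl | ⟨i, hi0, hij, hiu⟩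
          · exact hnotanc g hgD htg hgd hug
          · have hiD := hT.iterate_nxt_lt hrd i
            have hid := hne i hi0 (by omega)
            have h3 := hT.eq_of_common hiu hug
              (by rw [hsib _ hiD.1 hiD.2 hid, hsib g hgD htg hgd])
            have h4 := hT.simple _ hiD.1 g hgD (by rw [hiD.2, htg, head]) h3
            refine hne (j + 1 - i) (by omega) (by omega) ?_
            refine (hT.iterate_nxt_inj hrd (hT.iterate_nxt_lt hrd _).1 i ?_).symm
            rw [← Function.iterate_add_apply, h4, Nat.add_sub_cancel' (by omega), hgj]
        have hdis : ∀ v ∈ S, v ∉ S' := fun v hv hv' => hsep v hv (hdesc' v hv')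
        have hno : ∀ u ∈ S, ∀ v ∈ S', T.Edge u v → u = T.head d ∧ v = T.head g := by
          intro u hu v hv he
          have h := hT.enter he (hdesc' v hv) (hsep u hu)
          exact ⟨hT.parent_unique h.2 (hisch g hgD htg hgd), h.1⟩
        by_cases hlast : T.nxt g = T.rev d
        · refine ⟨_, _, .last hS hgc.symm hlast hS' hgD htg hdis hno, ?_⟩
          intro v hv
          rcases Finset.mem_union.1 hv with hv | hv
          · rcases hSd v hv with rfl | ⟨i, hi0, hij, hiu⟩
            · exact .refl
            · have hiD := hT.iterate_nxt_lt hrd i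
              exact Relation.ReflTransGen.head
                (hisch _ hiD.1 hiD.2 (hne i hi0 (by omega))) hiu
          · exact Relation.ReflTransGen.head (hisch g hgD htg hgd) (hdesc' v hv)
        · refine ihl (j + 1) g _ _ hgg'.symm hgj ?_
            (.next hS hgc.symm hlast hS' hgD htg hdis hno) ?_
          · intro i hi0 hij
            rcases Nat.lt_or_ge i (j + 2) with h | h
            · exact hne i hi0 (by omega)
            · have : i = j + 2 := by omega
              rw [this, Function.iterate_succ_apply', ← hgj]
              exact hlast
          · intro v hv
            rcases Finset.mem_union.1 hv with hv | hv
            · rcases hSd v hv with rfl | ⟨i, hi0, hij, hiu⟩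
              · exact Or.inl rfl
              · exact Or.inr ⟨i, hi0, by omega, hiu⟩
            · exact Or.inr ⟨j + 1, by omega, le_rfl, hgj ▸ hdesc' v hv⟩
    have hc₂ := hT.nxt_lt _ hc₁
    refine hloop _ (hT.cyc _ hc₂ _ hrd (by rw [hT.tail_nxt _ hc₁, ht₁, head])) 1 _ _ _ rfl
      rfl ?_ (.first rfl h1 h2 hdemd hS₁ hc₁ ht₁ hw₁) ?_
    · intro i hi0 hi
      rcases (show i = 1 ∨ i = 2 by omega) with rfl | rfl
      · exact h1
      · exact h2
    · intro v hv
      rcases Finset.mem_insert.1 hv with rfl | hv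
      · exact Or.inl rfl
      · exact Or.inr ⟨1, by omega, le_rfl, hdesc₁ v hv⟩

end Rooted

/-! ### The boundary walk of a shape -/

section Walk

variable {T : HalfEdgeMap} {n : ℕ} {dem : ℕ → ℕ} {d : ℕ} {o : Option ℕ} {S : Finset ℕ} {l : List ℕ}

/-- Each edge inside is traversed in both directions and `d` once, and a tree has one edge fewer
than vertices. -/
theorem Shape.card (h : Shape T dem d o S l) : 2 * S.card = l.length + 1 := by
  induction h with
  | leaf => simp
  | unary _ _ _ _ _ _ _ hw _ ih | first _ _ _ _ _ _ _ hw ih =>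
    rw [Finset.card_insert_of_notMem hw]
    simp only [List.length_cons, List.length_append, List.length_nil]
    omega
  | next _ _ _ _ _ _ hd _ ih ih' | last _ _ _ _ _ _ hd _ ih ih' =>
    rw [Finset.card_union_of_disjoint (Finset.disjoint_left.2 hd)]
    simp only [List.length_cons, List.length_append, List.length_nil]
    omega

theorem Shape.exists_cons (h : Shape T dem d o S l) : ∃ l', l = d :: l' := by
  induction h with
  | leaf | unary | first => exact ⟨_, rfl⟩
  | next _ _ _ _ _ _ _ _ ih _ | last _ _ _ _ _ _ _ _ ih _ =>
    obtain ⟨l', rfl⟩ := ih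
    exact ⟨_, rfl⟩

theorem Shape.mem_lt (hT : T.IsSimpleMap n) (h : Shape T dem d o S l) (hd : d < T.D) :
    ∀ z ∈ l, z < T.D := by
  induction h with
  | leaf => simpa using hd
  | unary _ _ _ _ _ hD _ _ _ ih | first _ _ _ _ _ hD _ _ ih =>
    have := hT.rev_lt _ hD
    have := ih hD
    simp only [List.mem_cons, List.mem_append]
    grind
  | next _ _ _ _ hD _ _ _ ih ih' | last _ _ _ _ hD _ _ _ ih ih' =>
    have := hT.rev_lt _ hD
    have := ih hd
    have := ih' hD
    simp only [List.mem_cons, List.mem_append]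
    grind

/-- The added last entry is where the walk goes next: back along `T.rev d` after a whole branch, or
to the child after `c`. -/
theorem Shape.isChain (hT : T.IsSimpleMap n) (h : Shape T dem d o S l) :
    (l ++ [o.elim (T.rev d) T.nxt]).IsChain (fun a b => T.face a = b) := by
  induction h with
  | leaf hn => simp [face, hn]
  | @unary d c S l hc _ hn _ hS hD _ _ _ ih =>
    obtain ⟨l', rfl⟩ := hS.exists_cons
    have h1 : T.face (T.rev c) = T.nxt c := by rw [face, hT.rev_rev c hD]
    simp only [Option.elim_none] at ih ⊢
    simp only [List.append_assoc, List.cons_append, List.nil_append, List.isChain_cons_cons]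
    refine ⟨hc, ?_⟩
    rw [← List.cons_append, List.isChain_split]
    exact ⟨ih, by simp [h1, hn]⟩
  | @first d c S l hc _ hn _ hS hD _ _ ih =>
    obtain ⟨l', rfl⟩ := hS.exists_cons
    have h1 : T.face (T.rev c) = T.nxt c := by rw [face, hT.rev_rev c hD]
    simp only [Option.elim_none, Option.elim_some] at ih ⊢
    simp only [List.append_assoc, List.cons_append, List.nil_append, List.isChain_cons_cons]
    refine ⟨hc, ?_⟩
    rw [← List.cons_append, List.isChain_split]
    exact ⟨ih, by simp [h1]⟩
  | @next d c c' S S' l l' hS hc hn hS' hD _ _ _ ih ih' =>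
    obtain ⟨l'', rfl⟩ := hS'.exists_cons
    have h1 : T.face (T.rev c') = T.nxt c' := by rw [face, hT.rev_rev c' hD]
    simp only [Option.elim_none, Option.elim_some, hc] at ih ih' ⊢
    simp only [List.append_assoc, List.cons_append, List.nil_append]
    rw [List.isChain_split]
    refine ⟨ih, ?_⟩
    rw [← List.cons_append, List.isChain_split]
    exact ⟨ih', by simp [h1]⟩
  | @last d c c' S S' l l' hS hc hn hS' hD _ _ _ ih ih' =>
    obtain ⟨l'', rfl⟩ := hS'.exists_cons
    have h1 : T.face (T.rev c') = T.nxt c' := by rw [face, hT.rev_rev c' hD]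
    simp only [Option.elim_none, Option.elim_some, hc] at ih ih' ⊢
    simp only [List.append_assoc, List.cons_append, List.nil_append]
    rw [List.isChain_split]
    refine ⟨ih, ?_⟩
    rw [← List.cons_append, List.isChain_split]
    exact ⟨ih', by simp [h1, hn]⟩

end Walk

end HalfEdgeMap

namespace HalfEdgeMap

/-! ### The algorithm as a state machine -/

/-- The memory of the algorithm: the map that is built; for every vertex the kind and the three
pending corners of its branch, and one more than the half-edge to its parent, if it is visited; and
the current and the previous arrival. -/
structure Config where
  map : HalfEdgeMap
  kind : ℕ → ℕ
  a : ℕ → ℕ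
  b : ℕ → ℕ
  c : ℕ → ℕ
  up : ℕ → ℕ
  cur : ℕ
  prev : ℕ

namespace Config

/-- Store the map `M`, and the corners of the vertex that is arrived at, and go on along the face. -/
def put (s : Config) (M : HalfEdgeMap) (k a b c : ℕ) : Config where
  map := M
  kind := Function.update s.kind (s.map.head s.cur) k
  a := Function.update s.a (s.map.head s.cur) a
  b := Function.update s.b (s.map.head s.cur) b
  c := Function.update s.c (s.map.head s.cur) c
  up := s.up
  -- The old map is followed here, not `M`: the walk stays on the tree even if a new chord starts at
  -- this corner.
  cur := s.map.face s.cur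
  prev := s.cur

/-- Mark the vertex that is arrived at as visited. -/
def mark (s : Config) : Config :=
  { s with up := Function.update s.up (s.map.head s.cur) (s.map.rev s.cur + 1) }

/-- One arrival of the boundary walk. -/
def step (s : Config) : Config :=
  let v := s.map.head s.cur
  let w := s.map.tail s.cur
  if s.up v < 1 then
    if s.map.face s.cur = s.map.rev s.cur then
      s.mark.put s.map 2 s.cur s.cur s.cur
    else { s.mark with cur := s.map.face s.cur, prev := s.cur }
  else if s.kind v < 1 then
    -- The next half-edge leads to the parent, so `w` is the only child of `v`.
    if s.map.face s.cur + 1 = s.up v then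
      if s.kind w < 3 then s.put s.map 3 (s.map.rev (s.up v - 1)) (s.a w) (s.c w)
      else s.put (s.map.chord (s.c w) s.cur) 2 (s.a w) (s.a w) (s.b w)
    else s.put s.map (s.kind w) (s.a w) (s.b w) (s.c w)
  else if s.kind v < 3 then
    if s.kind w < 3 then
      s.put (s.map.chord (s.c v) (s.a w)) 2 (s.a v) (s.b v)
        (if s.c w = s.a w then s.map.D else s.c w)
    else
      s.put (s.map.chord (s.c v) (s.a w)) 4 (s.a v) (s.b w)
        (if s.c w = s.a w then s.map.D else s.c w)
  else if s.kind w < 3 then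
    s.put (s.map.chord (s.c v) (s.a w)) 5 (s.a v) (s.b v)
      (if s.c w = s.a w then s.map.D else s.c w)
  else
    s.put ((s.map.chord (s.c v) (s.a w)).chord (s.b v) (s.b w)) 2 (s.a v) (s.a v)
      (if s.c w = s.b w then s.map.D + 2 else s.c w)

end Config

/-- The number of edges that are pending at a branch of kind `k`. -/
def pending (k : ℕ) : ℕ := if k = 2 then 2 else 3

variable {T : HalfEdgeMap} {n : ℕ} {dem : ℕ → ℕ} {W₁ W₃ : List ℕ} {F : List (List ℕ)}

theorem IsPlane.face_eq {M : HalfEdgeMap} {x y : ℕ} (h : IsPlane T n M (W₁ ++ x :: y :: W₃) F) :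
    M.face x = y := by
  have h1 := h.outer
  rw [IsClosedWalk, List.append_assoc, List.isChain_append] at h1
  simpa using (List.isChain_cons_cons.1 h1.2.1).1

/-- The corners `a`, `b`, `c` of a complete or an incomplete branch. -/
def CornersAt (o : Option ℕ) (M : HalfEdgeMap) (S : Set ℕ) (w : ℕ) (l : List ℕ)
    (k a b c : ℕ) : Prop :=
  o.elim (FullAt M S w l k a b c) fun _ => PartialAt M S w l k a b c

/-- The effect of a walk around the branch `S` with the root `w`, or a part of it. -/
structure Visited (T : HalfEdgeMap) (n : ℕ) (dem : ℕ → ℕ) (d : ℕ) (o : Option ℕ) (S : Finset ℕ)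
    (W₁ W₃ : List ℕ) (s s' : Config) : Prop where
  ext : s.map.Extends s'.map
  edge : ∀ u v, s'.map.Edge u v →
    s.map.Edge u v ∨ (u ∈ S ∧ v ∈ S ∧ (o ≠ none → u ≠ T.head d ∧ v ≠ T.head d))
  off : ∀ v ∉ S, s'.kind v = s.kind v ∧ s'.a v = s.a v ∧ s'.b v = s.b v ∧ s'.c v = s.c v ∧
    s'.up v = s.up v
  up : s'.up (T.head d) = T.rev d + 1
  cur : s'.cur = o.elim (T.rev d) T.nxt
  kind : 2 ≤ s'.kind (T.head d)
  count : s'.map.D + pending (s'.kind (T.head d)) = s.map.D + ∑ v ∈ S, dem v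
  sep : o = none → s'.kind (T.head d) = 4 ∨ s'.kind (T.head d) = 3 ∧ 2 < S.card →
    ¬ s'.map.Edge (s'.map.head (s'.c (T.head d))) (T.head d)
  plane : ∃ m F, IsPlane T n s'.map (W₁ ++ (m ++ W₃)) F ∧
    CornersAt o s'.map S (T.head d) m (s'.kind (T.head d)) (s'.a (T.head d)) (s'.b (T.head d))
      (s'.c (T.head d)) ∧
    (s'.kind (T.head d) ≠ 2 → InOrder m (s'.c (T.head d)) s'.prev ∧
      s'.map.head s'.prev = T.head d)

/-! ### Correctness of one arrival, case by case -/

section Cases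

variable {d c : ℕ} {S S' : Finset ℕ} {l : List ℕ} {s s₁ s₂ : Config}

theorem visited_leaf (hT : T.IsSimpleMap n) (hd : d < T.D) (hdem : dem (T.head d) = 2)
    (hP : IsPlane T n s.map (W₁ ++ ([d] ++ T.rev d :: W₃)) F)
    (hcur : s.cur = d) (hup : s.up (T.head d) = 0) :
    Visited T n dem d none {T.head d} W₁ (T.rev d :: W₃) s s.step := by
  have hh : s.map.head d = T.head d := hP.head hd (hT.rev_lt d hd)
  have hf : s.map.face d = T.rev d := IsPlane.face_eq hP
  have hr : s.map.rev d = T.rev d := hP.rev d hd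
  have hs : s.step = s.mark.put s.map 2 d d d := by
    simp [Config.step, hcur, hh, hup, hf, hr]
  have hh' : s.mark.map.head s.mark.cur = T.head d := by simp [Config.mark, hcur, hh]
  rw [hs]
  refine ⟨.refl _, fun u v h => Or.inl h, ?_, ?_, ?_, ?_, ?_, ?_, [d], F, ?_, ?_, ?_⟩
  · intro v hv
    have hv : v ≠ T.head d := by simpa using hv
    simp [Config.put, hh', hv]
    simp [Config.mark, hcur, hh, hv]
  · simp [Config.put, Config.mark, hcur, hh, hr]
  · simp [Config.put, Config.mark, hcur, hf]
  · simp [Config.put, hh']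
  · simp [Config.put, hh', pending, hdem]
  · simp [Config.put, hh']
  · exact hP
  · simpa [Config.put, hh', CornersAt] using fullAt_leaf hh
  · simp [Config.put, hh']

/-- The bookkeeping that the returns from children share. The last arrival of the stretch becomes
the previous one; as it comes after every pending corner, it is ready for the closing chord from `c`
to the root of the branch. -/
theorem visited_put {o : Option ℕ} {N : HalfEdgeMap} {k x y z : ℕ} {m : List ℕ}
    (hh : s₂.map.head s₂.cur = T.head d) (hf : s₂.map.face s₂.cur = o.elim (T.rev d) T.nxt)
    (hS : T.head d ∈ S) (ext : s.map.Extends N)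
    (edge : ∀ u v, N.Edge u v →
      s.map.Edge u v ∨ (u ∈ S ∧ v ∈ S ∧ (o ≠ none → u ≠ T.head d ∧ v ≠ T.head d)))
    (off : ∀ v ∉ S, s₂.kind v = s.kind v ∧ s₂.a v = s.a v ∧ s₂.b v = s.b v ∧ s₂.c v = s.c v ∧
      s₂.up v = s.up v)
    (up : s₂.up (T.head d) = T.rev d + 1) (kind : 2 ≤ k)
    (count : N.D + pending k = s.map.D + ∑ v ∈ S, dem v)
    (sep : o = none → k = 4 ∨ k = 3 ∧ 2 < S.card → ¬ N.Edge (N.head z) (T.head d))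
    (hP : IsPlane T n N (W₁ ++ (m ++ W₃)) F) (hC : CornersAt o N S (T.head d) m k x y z)
    (hI : k ≠ 2 → ∃ m', m = m' ++ [s₂.cur] ∧ N.head s₂.cur = T.head d) :
    Visited T n dem d o S W₁ W₃ s (s₂.put N k x y z) := by
  refine ⟨ext, edge, ?_, up, hf, ?_, ?_, ?_, m, F, hP, ?_, ?_⟩
  · intro v hv
    have hvd : v ≠ T.head d := fun h => hv (h ▸ hS)
    simpa [Config.put, hh, hvd] using off v hv
  · simpa [Config.put, hh] using kind
  · simpa [Config.put, hh] using count
  · simpa [Config.put, hh] using sep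
  · simpa [Config.put, hh] using hC
  · simp only [Config.put, hh, Function.update_self]
    intro hk
    obtain ⟨m', rfl, hz⟩ := hI hk
    refine ⟨?_, hz⟩
    have hzm : z ∈ m' ++ [s₂.cur] := by
      cases o with
      | none => exact FullAt.bc hC |>.2.1
      | some _ => exact PartialAt.bc hC |>.2.1
    have hnd := hP.nodup_part
    rw [List.nodup_append] at hnd
    rcases List.mem_append.1 hzm with h | h
    · exact .append_append h (by simp) fun h' => hnd.2.2 _ h' _ (by simp) rfl
    · rw [List.mem_singleton.1 h]
      exact .refl (by simp)

/-- The part of the outer walk still ahead has not been changed, so the walk leaves a child's branch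
as it would in `T`. -/
theorem Visited.arrive {nx : ℕ} (hT : T.IsSimpleMap n) (hD : c < T.D) (ht : T.tail c = T.head d)
    (hV : Visited T n dem c none S W₁ (T.rev c :: nx :: W₃) s₁ s₂) :
    s₂.cur = T.rev c ∧ s₂.map.head (T.rev c) = T.head d ∧
      s₂.map.tail (T.rev c) = T.head c ∧ s₂.map.face (T.rev c) = nx := by
  obtain ⟨m, F', hP, -⟩ := hV.plane
  have hr := hT.rev_lt c hD
  refine ⟨hV.cur, ?_, hP.tail _ hr, ?_⟩
  · rw [hP.head hr (hT.rev_lt _ hr), hT.head_rev hD, ht]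
  · rw [← List.append_assoc] at hP
    exact hP.face_eq

section Enter

variable {nx : ℕ} (hT : T.IsSimpleMap n) (hd : d < T.D) (hD : c < T.D) (ht : T.tail c = T.head d)
  (hw : T.head d ∉ S) (hV : Visited T n dem c none S (W₁ ++ [d]) (T.rev c :: nx :: W₃) s₁ s₂)
include hT hd hD ht hw hV

variable (hP₀ : T.Extends s.map) (hcur : s.cur = d)
  (hs₁ : s₁ = { s.mark with cur := c, prev := d })
  (hfresh : ∀ v ∈ insert (T.head d) S, s.up v = 0 ∧ s.kind v = 0)
  (hedge : ∀ u ∈ insert (T.head d) S, ∀ v, s.map.Edge u v → T.Edge u v)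
include hP₀ hcur hs₁ hfresh hedge

-- The walk around the child's branch leaves the memory of outer vertices alone; here the mark set
-- on entering is recovered.
omit hD ht hedge in
theorem Visited.enter_facts : s₁.map = s.map ∧
    (∀ v ∉ insert (T.head d) S, s₂.kind v = s.kind v ∧ s₂.a v = s.a v ∧ s₂.b v = s.b v ∧
      s₂.c v = s.c v ∧ s₂.up v = s.up v) ∧
    s₂.up (T.head d) = T.rev d + 1 ∧ s₂.kind (T.head d) = 0 := by
  have hh : s.map.head d = T.head d := hP₀.head hd (hT.rev_lt d hd)
  have h1 := hV.off _ hw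
  subst hs₁
  refine ⟨rfl, ?_, ?_, ?_⟩
  · intro v hv
    have hvd : v ≠ T.head d := fun h => hv (by simp [h])
    have h2 := hV.off v fun h => hv (by simp [h])
    simpa [Config.mark, hcur, hh, hvd] using h2
  · rw [h1.2.2.2.2]
    simp [Config.mark, hcur, hh, hP₀.rev d hd]
  · rw [h1.1]
    exact (hfresh _ (by simp)).2

/-- The demand 1 of the vertex explains the count: pending 2 + 1 = 3 without a chord, or 3 + 1 = 2 +
2 with one chord of two half-edges. -/
theorem visited_unary (hnx : nx = T.rev d) (hdem : dem (T.head d) = 1)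
    (hno : ∀ u ∈ S, u ≠ T.head c → ¬ T.Edge u (T.head d)) :
    Visited T n dem d none (insert (T.head d) S) W₁ (nx :: W₃) s s₂.step := by
  obtain ⟨hc₂, hh₂, ht₂, hf₂⟩ := Visited.arrive hT hD ht hV
  obtain ⟨hm, hoff, hup, hk⟩ := Visited.enter_facts hT hd hw hV hP₀ hcur hs₁ hfresh
  obtain ⟨m, F', hP, hC, hI⟩ := hV.plane
  have hP' : IsPlane T n s₂.map (W₁ ++ ((d :: (m ++ [T.rev c])) ++ nx :: W₃)) F' := by
    simpa using hP
  have hrd : s₂.map.rev (T.rev d) = d := by rw [hP.rev _ (hT.rev_lt d hd), hT.rev_rev d hd]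
  have hhd : s₂.map.head d = T.head d := hP.head hd (hT.rev_lt d hd)
  have hwc : s₂.map.Edge (T.head d) (T.head c) := hP.edge hT.rev_lt ⟨c, hD, ht, rfl⟩
  have hno' : ∀ u ∈ S, u ≠ T.head c → ¬ s₂.map.Edge u (T.head d) := by
    intro u hu huc he
    rcases hV.edge _ _ he with h | h
    · exact hno u hu huc (hedge u (by simp [hu]) _ (hm ▸ h))
    · exact hw h.2.1
  have hcoe : ((insert (T.head d) S : Finset ℕ) : Set ℕ) = insert (T.head d) (S : Set ℕ) := by simp
  have hcount := hV.count
  have hE : ∀ u v, s₂.map.Edge u v → s.map.Edge u v ∨ (u ∈ insert (T.head d) S ∧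
      v ∈ insert (T.head d) S ∧ ((none : Option ℕ) ≠ none → u ≠ T.head d ∧ v ≠ T.head d)) := by
    intro u v h
    rcases hV.edge u v h with h | h
    · exact Or.inl (hm ▸ h)
    · exact Or.inr ⟨by simp [h.1], by simp [h.2.1], by simp⟩
  have hC' : FullAt s₂.map S (T.head c) m _ _ _ _ := hC
  by_cases h3 : s₂.kind (T.head c) < 3
  · have h2 : s₂.kind (T.head c) = 2 := by have := hV.kind; omega
    have hs : s₂.step = s₂.put s₂.map 3 d (s₂.a (T.head c)) (s₂.c (T.head c)) := by
      simp [Config.step, hc₂, hh₂, ht₂, hf₂, hup, hk, h2, hnx, hrd]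
    rw [hs]
    have hF := FullAt.unary_two (h2 ▸ hC') hP' hw hwc hhd
    refine visited_put (by rw [hc₂, hh₂]) (by rw [hc₂, hf₂, hnx]; rfl) (by simp) (hm ▸ hV.ext) hE
      hoff hup (by norm_num) ?_ ?_ hP' ?_ ?_
    · rw [Finset.sum_insert hw, hdem, ← hm]
      rw [h2] at hcount
      simp only [pending, if_true] at hcount ⊢
      simp only [show (3 : ℕ) ≠ 2 by norm_num, if_false]
      omega
    -- The last corner lies at the child only if the child is a leaf, and then the branch has just
    -- two vertices. Otherwise the vertex of that corner is not adjacent to the new root.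
    · rintro - h
      have hcard := (h.resolve_left (by norm_num)).2
      rw [Finset.card_insert_of_notMem hw] at hcard
      refine hno' _ hC'.conn.hc ?_
      rcases hC'.conn.distinct_two h2 with h4 | h4
      · obtain ⟨p, hp, q, hq, hpq⟩ := Finset.one_lt_card.1 (show 1 < S.card by omega)
        exact absurd ((h4 p hp).trans (h4 q hq).symm) hpq
      · exact h4.2.1
    · rw [hcoe]
      exact hF
    · intro _
      exact ⟨d :: m, by simp [hc₂], by rw [hc₂, hh₂]⟩
  · have h2 : s₂.kind (T.head c) ≠ 2 := by omega
    have hs : s₂.step = s₂.put (s₂.map.chord (s₂.c (T.head c)) (T.rev c)) 2 (s₂.a (T.head c))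
        (s₂.a (T.head c)) (s₂.b (T.head c)) := by
      simp [Config.step, hc₂, hh₂, ht₂, hf₂, hup, hk, h3, hnx]
    rw [hs]
    obtain ⟨m', F₂, hP₂, hF⟩ := hC'.unary_three h2 hP' hw hwc hh₂ hno'
    refine visited_put (by rw [hc₂, hh₂]) (by rw [hc₂, hf₂, hnx]; rfl) (by simp)
      ((hm ▸ hV.ext).trans (extends_chord _ _ _)) ?_ hoff hup le_rfl ?_ (by simp) hP₂ ?_ (by simp)
    · intro u v h
      rw [chord_edge hP.toIsSimpleMap, hh₂] at h
      have hc : s₂.map.head (s₂.c (T.head c)) ∈ S := hC'.conn.hc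
      rcases h with h | ⟨rfl, rfl⟩ | ⟨rfl, rfl⟩
      · exact hE u v h
      · exact Or.inr ⟨by simp [hc], by simp, by simp⟩
      · exact Or.inr ⟨by simp, by simp [hc], by simp⟩
    · rw [Finset.sum_insert hw, hdem, ← hm, chord_D]
      simp only [pending, if_neg h2, if_true] at hcount ⊢
      omega
    · rw [hcoe]
      exact hF

omit hedge in
theorem visited_first (hnx : nx = T.nxt c) (hn : T.nxt c ≠ T.rev d) (hdem : dem (T.head d) = 0) :
    Visited T n dem d (some c) (insert (T.head d) S) W₁ (nx :: W₃) s s₂.step := by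
  obtain ⟨hc₂, hh₂, ht₂, hf₂⟩ := Visited.arrive hT hD ht hV
  obtain ⟨hm, hoff, hup, hk⟩ := Visited.enter_facts hT hd hw hV hP₀ hcur hs₁ hfresh
  obtain ⟨m, F', hP, hC, hI⟩ := hV.plane
  have hP' : IsPlane T n s₂.map (W₁ ++ ((d :: (m ++ [T.rev c])) ++ nx :: W₃)) F' := by
    simpa using hP
  have hwc : s₂.map.Edge (T.head d) (T.head c) := hP.edge hT.rev_lt ⟨c, hD, ht, rfl⟩
  have hcoe : ((insert (T.head d) S : Finset ℕ) : Set ℕ) = insert (T.head d) (S : Set ℕ) := by simp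
  have hC' : FullAt s₂.map S (T.head c) m _ _ _ _ := hC
  have hs : s₂.step = s₂.put s₂.map (s₂.kind (T.head c)) (s₂.a (T.head c)) (s₂.b (T.head c))
      (s₂.c (T.head c)) := by
    simp [Config.step, hc₂, hh₂, ht₂, hf₂, hup, hk, hnx, hn]
  rw [hs]
  refine visited_put (by rw [hc₂, hh₂]) (by rw [hc₂, hf₂, hnx]; rfl) (by simp) (hm ▸ hV.ext) ?_
    hoff hup hV.kind ?_ (by simp) hP' ?_ ?_
  · intro u v h
    rcases hV.edge u v h with h | h
    · exact Or.inl (hm ▸ h)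
    · exact Or.inr ⟨by simp [h.1], by simp [h.2.1], fun _ =>
        ⟨fun e => hw (e ▸ h.1), fun e => hw (e ▸ h.2.1)⟩⟩
  · rw [Finset.sum_insert hw, hdem, ← hm, hV.count, zero_add]
  · rw [hcoe]
    exact hC'.first hP' hw hwc
  · intro _
    exact ⟨d :: m, by simp [hc₂], by rw [hc₂, hh₂]⟩

end Enter

section Merge

variable {c' nx : ℕ} {o : Option ℕ} {m : List ℕ} (hT : T.IsSimpleMap n) (hD : c' < T.D)
  (ht : T.tail c' = T.head d) (hdis : ∀ v ∈ S, v ∉ S')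
  (hno : ∀ u ∈ S, ∀ v ∈ S', T.Edge u v → u = T.head d ∧ v = T.head c')
  (hV₁ : Visited T n dem d (some c) S W₁ (c' :: W₃) s s₁)
  (hP₁ : IsPlane T n s₁.map (W₁ ++ (m ++ c' :: W₃)) F)
  (hA : PartialAt s₁.map S (T.head d) m (s₁.kind (T.head d)) (s₁.a (T.head d)) (s₁.b (T.head d))
    (s₁.c (T.head d)))
  {W₄ : List ℕ}
  (hV₂ : Visited T n dem c' none S' (W₁ ++ m) (T.rev c' :: nx :: W₄) s₁ s₂)
  (hedge : ∀ u ∈ S ∪ S', ∀ v, s.map.Edge u v → T.Edge u v) (hnx : nx = o.elim (T.rev d) T.nxt)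
include hT hD ht hdis hno hV₁ hP₁ hA hV₂ hedge hnx

/-- The root demands nothing here, so the chords only consume pending demands of the two sides. No
new edge touches the root, which keeps the closing chord from `c` to the root available in kind 4.
-/
theorem visited_merge : Visited T n dem d o (S ∪ S') W₁ (nx :: W₄) s s₂.step := by
  obtain ⟨hc₂, hh₂, ht₂, hf₂⟩ := Visited.arrive hT hD ht hV₂
  obtain ⟨m', F', hP, hB, hI⟩ := hV₂.plane
  have hwS : T.head d ∈ S := hA.conn.hw
  have hwS' := hdis _ hwS
  obtain ⟨hok, hoa, hob, hoc, hou⟩ := hV₂.off _ hwS'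
  have hA' : PartialAt s₂.map S (T.head d) m (s₂.kind (T.head d)) (s₂.a (T.head d))
      (s₂.b (T.head d)) (s₂.c (T.head d)) := by
    rw [hok, hoa, hob, hoc]
    exact hA.extends hP₁.toIsSimpleMap (fun z hz => hP₁.lt_of_mem hz) hV₂.ext
  have hB' : FullAt s₂.map S' (T.head c') m' _ _ _ _ := hB
  have hP' : IsPlane T n s₂.map (W₁ ++ ((m ++ m' ++ [T.rev c']) ++ nx :: W₄)) F' := by
    simpa using hP
  have hwc : s₂.map.Edge (T.head d) (T.head c') := hP.edge hT.rev_lt ⟨c', hD, ht, rfl⟩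
  have hd : ∀ v ∈ (S : Set ℕ), v ∉ (S' : Set ℕ) := hdis
  have hno' : ∀ u ∈ (S : Set ℕ), u ≠ T.head d → ∀ v ∈ (S' : Set ℕ), ¬ s₂.map.Edge u v := by
    intro u hu huw v hv he
    rcases hV₂.edge _ _ he with h | h
    · rcases hV₁.edge _ _ h with h | h
      · exact huw (hno u hu v hv (hedge u (Finset.mem_union_left _ hu) v h)).1
      · exact hdis v h.2.1 hv
    · exact hdis u hu h.1
  have hsep : ∀ x ∈ S', x ≠ T.head c' → ¬ s₂.map.Edge x (T.head d) := by
    intro x hx hxc he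
    rcases hV₂.edge _ _ he with h | h
    · rcases hV₁.edge _ _ h with h | h
      · exact hxc (hno _ hwS x hx
          (hT.edge_symm _ _ (hedge x (Finset.mem_union_right _ hx) _ h))).2
      · exact hdis x h.1 hx
    · exact hwS' h.2.1
  have hcoe : ((S ∪ S' : Finset ℕ) : Set ℕ) = (S : Set ℕ) ∪ S' := by simp
  have hkind := hV₁.kind
  rw [← hok] at hkind
  have hkind' := hV₂.kind
  have hcount := hV₁.count
  rw [← hok] at hcount
  have hcount' := hV₂.count
  have hup := hV₁.up
  rw [← hou] at hup
  have hk1 : ¬ s₂.kind (T.head d) < 1 := by omega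
  have hu1 : ¬ s₂.up (T.head d) < 1 := by omega
  -- What the four merges have in common. Kind 3 never arises from a merge, and kind 4 takes its
  -- last corner from the right branch, away from the child's root.
  have key : ∀ (N : HalfEdgeMap) (k y z : ℕ) (m₂ : List ℕ) (F₂ : List (List ℕ)),
      s₂.step = s₂.put N k (s₂.a (T.head d)) y z →
      IsPlane T n N (W₁ ++ ((m₂ ++ [T.rev c']) ++ nx :: W₄)) F₂ →
      FullAt N (S ∪ S') (T.head d) (m₂ ++ [T.rev c']) k (s₂.a (T.head d)) y z →
      s₂.map.Extends N →
      (∀ u v, N.Edge u v → s₂.map.Edge u v ∨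
        (u ∈ S ∪ S' ∧ u ≠ T.head d) ∧ (v ∈ S ∪ S' ∧ v ≠ T.head d)) →
      N.D + pending k + s₂.map.D =
        s₂.map.D + pending (s₂.kind (T.head d)) + s₂.map.D + pending (s₂.kind (T.head c')) →
      k ≠ 3 → (k = 4 → N.head z ∈ S' ∧ N.head z ≠ T.head c') →
      Visited T n dem d o (S ∪ S') W₁ (nx :: W₄) s s₂.step := by
    intro N k y z m₂ F₂ hs hP₂ hF hN hE hN_D hk3 hk4
    rw [hs]
    refine visited_put (by rw [hc₂, hh₂]) (by rw [hc₂, hf₂, hnx]) (by simp [hwS])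
      ((hV₁.ext.trans hV₂.ext).trans hN) ?_ ?_ hup ?_ ?_ ?_ hP₂ ?_ ?_
    · intro u v h
      rcases hE u v h with h | h
      · rcases hV₂.edge u v h with h | h
        · rcases hV₁.edge u v h with h | h
          · exact Or.inl h
          · have h3 := h.2.2 (by simp)
            exact Or.inr ⟨by simp [h.1], by simp [h.2.1], fun _ => h3⟩
        · exact Or.inr ⟨by simp [h.1], by simp [h.2.1], fun _ =>
            ⟨fun e => hwS' (e ▸ h.1), fun e => hwS' (e ▸ h.2.1)⟩⟩
      · exact Or.inr ⟨h.1.1, h.2.1, fun _ => ⟨h.1.2, h.2.2⟩⟩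
    · intro v hv
      rw [Finset.mem_union, not_or] at hv
      have h1 := hV₁.off v hv.1
      have h2 := hV₂.off v hv.2
      grind
    · have := hF.conn.kind
      omega
    · rw [Finset.sum_union (Finset.disjoint_left.2 hdis)]
      omega
    · rintro - h
      obtain ⟨h4, h5⟩ := hk4 (h.resolve_right fun h => hk3 h.1)
      intro he
      rcases hE _ _ he with h | h
      · exact hsep _ h4 h5 h
      · exact h.2.2 rfl
    · rw [hcoe]
      cases o with
      | none => exact hF
      | some _ =>
        refine hF.partialAt ?_
        have ha := hP'.lt_of_mem (show s₂.a (T.head d) ∈ _ by simp [hA'.ab.1])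
        rw [hN.head ha (hP'.rev_lt _ ha)]
        exact hA'.conn.aw
    · intro _
      refine ⟨m₂, by rw [hc₂], ?_⟩
      have hr := hT.rev_lt c' hD
      rw [hc₂, hP₂.head hr (hT.rev_lt _ hr), hT.head_rev hD, ht]
  have hEc : ∀ x y, s₂.map.head x ∈ S → s₂.map.head x ≠ T.head d → s₂.map.head y ∈ S' →
      ∀ u v, (s₂.map.chord x y).Edge u v → s₂.map.Edge u v ∨
        (u ∈ S ∪ S' ∧ u ≠ T.head d) ∧ (v ∈ S ∪ S' ∧ v ≠ T.head d) := by
    intro x y hx hxw hy u v h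
    have hyw : s₂.map.head y ≠ T.head d := fun e => hwS' (e ▸ hy)
    rw [chord_edge hP.toIsSimpleMap] at h
    rcases h with h | ⟨rfl, rfl⟩ | ⟨rfl, rfl⟩
    · exact Or.inl h
    · exact Or.inr ⟨⟨by simp [hx], hxw⟩, by simp [hy], hyw⟩
    · exact Or.inr ⟨⟨by simp [hy], hyw⟩, by simp [hx], hxw⟩
  have hEc₁ := hEc _ _ hA'.conn.hc hA'.conn.cw hB'.conn.ha
  by_cases h3 : s₂.kind (T.head d) < 3
  · have h2 : s₂.kind (T.head d) = 2 := by omega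
    by_cases h3' : s₂.kind (T.head c') < 3
    · have h2' : s₂.kind (T.head c') = 2 := by omega
      obtain ⟨m₂, F₂, hP₂, hF⟩ := merge_two_two hA' hB' hP' hd hwc hno' h2 h2'
      refine key _ _ _ _ m₂ F₂ ?_ hP₂ hF (extends_chord _ _ _) hEc₁ ?_ (by norm_num) (by simp)
      · simp [Config.step, hc₂, hh₂, ht₂, h3, h3', hk1, hu1]
      · simp only [chord_D, pending, h2, h2', if_true]
        omega
    · have h2' : s₂.kind (T.head c') ≠ 2 := by omega
      obtain ⟨m₂, F₂, hP₂, hF⟩ := merge_two_three hA' hB' hP' hd hwc hno' h2 h2'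
      refine key _ _ _ _ m₂ F₂ ?_ hP₂ hF (extends_chord _ _ _) hEc₁ ?_ (by norm_num) ?_
      · simp [Config.step, hc₂, hh₂, ht₂, h3, h3', hk1, hu1]
      · simp only [chord_D, pending, h2, if_neg h2', if_true, show (4 : ℕ) ≠ 2 by norm_num,
          if_false]
        omega
      · intro _
        have hdist := hB'.conn.distinct h2'
        rw [if_neg fun h => hdist.2.1 (by rw [h]), hP'.head_chord (by simp [hB'.bc.2.1])]
        exact ⟨hB'.conn.hc, hdist.2.2.2⟩
  · have h2 : s₂.kind (T.head d) ≠ 2 := by omega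
    by_cases h3' : s₂.kind (T.head c') < 3
    · have h2' : s₂.kind (T.head c') = 2 := by omega
      obtain ⟨m₂, F₂, hP₂, hF⟩ := merge_three_two hA' hB' hP' hd hwc hno' h2 h2'
      refine key _ _ _ _ m₂ F₂ ?_ hP₂ hF (extends_chord _ _ _) hEc₁ ?_ (by norm_num) (by simp)
      · simp [Config.step, hc₂, hh₂, ht₂, h3, h3', hk1, hu1]
      · simp only [chord_D, pending, h2', if_neg h2, if_true, show (5 : ℕ) ≠ 2 by norm_num,
          if_false]
        omega
    · have h2' : s₂.kind (T.head c') ≠ 2 := by omega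
      obtain ⟨m₂, F₂, hP₂, hF⟩ := merge_three_three hA' hB' hP' hd hwc hno' h2 h2'
      refine key _ _ _ _ m₂ F₂ ?_ hP₂ hF ((extends_chord _ _ _).trans (extends_chord _ _ _)) ?_ ?_
        (by norm_num) (by simp)
      · simp [Config.step, hc₂, hh₂, ht₂, h3, h3', hk1, hu1]
      · intro u v h
        obtain ⟨_, _, hPc, -⟩ := merge_chord hA' hB' hP' hd hno'
        rw [chord_edge hPc.toIsSimpleMap, hP'.head_chord (by simp [hA'.ab.2.1]),
          hP'.head_chord (by simp [hB'.ab.2.1])] at h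
        have hb : s₂.map.head (s₂.b (T.head d)) ∈ S := hA'.conn.hb
        have hb' : s₂.map.head (s₂.b (T.head c')) ∈ S' := hB'.conn.hb
        have hyw : s₂.map.head (s₂.b (T.head c')) ≠ T.head d := fun e => hwS' (e ▸ hb')
        rcases h with h | ⟨rfl, rfl⟩ | ⟨rfl, rfl⟩
        · exact hEc₁ u v h
        · exact Or.inr ⟨⟨by simp [hb], hA'.conn.bw⟩, by simp [hb'], hyw⟩
        · exact Or.inr ⟨⟨by simp [hb'], hyw⟩, by simp [hb], hA'.conn.bw⟩
      · simp only [chord_D, pending, if_neg h2, if_neg h2', if_true]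
        omega

end Merge

end Cases

/-- The algorithm works on the list `l` of arrivals at the branch `S`, or a part of it. -/
def Visits (T : HalfEdgeMap) (n : ℕ) (dem : ℕ → ℕ) (d : ℕ) (o : Option ℕ) (S : Finset ℕ)
    (l : List ℕ) : Prop :=
  ∀ (s : Config) (W₁ W₃ : List ℕ) (F : List (List ℕ)),
    IsPlane T n s.map (W₁ ++ (l ++ o.elim (T.rev d) T.nxt :: W₃)) F → s.cur = d →
    (∀ v ∈ S, s.up v = 0 ∧ s.kind v = 0) →
    (∀ u ∈ S, ∀ v, s.map.Edge u v → T.Edge u v) →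
    Visited T n dem d o S W₁ (o.elim (T.rev d) T.nxt :: W₃) s (Config.step^[l.length] s)

/-- First the earlier children, then the new branch, then one more arrival at the root, where the
merge takes place. The two branches are disjoint, so the second is still fresh after the first walk.
-/
theorem Visits.merge (hT : T.IsSimpleMap n) {d c c' : ℕ} {o : Option ℕ} {S S' : Finset ℕ}
    {l l' : List ℕ} (h : Visits T n dem d (some c) S l) (hc : T.nxt c = c')
    (hS' : Shape T dem c' none S' l') (h' : Visits T n dem c' none S' l') (hD : c' < T.D)
    (ht : T.tail c' = T.head d) (hdis : ∀ v ∈ S, v ∉ S')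
    (hno : ∀ u ∈ S, ∀ v ∈ S', T.Edge u v → u = T.head d ∧ v = T.head c') :
    Visits T n dem d o (S ∪ S') (l ++ l' ++ [T.rev c']) := by
  intro s W₁ W₃ F hP hcur hfresh hedge
  obtain ⟨l'', rfl⟩ := hS'.exists_cons
  have hV₁ := h s W₁ (l'' ++ T.rev c' :: o.elim (T.rev d) T.nxt :: W₃) F
    (by simpa [hc] using hP) hcur (fun v hv => hfresh v (Finset.mem_union_left _ hv))
    (fun u hu => hedge u (Finset.mem_union_left _ hu))
  rw [Option.elim_some, hc] at hV₁
  obtain ⟨m, F', hP₁, hA, -⟩ := hV₁.plane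
  have hV₂ := h' _ (W₁ ++ m) (o.elim (T.rev d) T.nxt :: W₃) F' (by simpa using hP₁)
    (hV₁.cur.trans hc) ?_ ?_
  · rw [show (l ++ c' :: l'' ++ [T.rev c']).length = ((c' :: l'').length + l.length) + 1 by
      simp only [List.length_append, List.length_cons, List.length_nil]; omega,
      Function.iterate_succ_apply', Function.iterate_add_apply]
    exact visited_merge hT hD ht hdis hno hV₁ hP₁ hA hV₂ hedge rfl
  · intro v hv
    obtain ⟨hk, -, -, -, hu⟩ := hV₁.off v fun h => hdis v h hv
    rw [hk, hu]
    exact hfresh v (Finset.mem_union_right _ hv)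
  · intro u hu v he
    rcases hV₁.edge _ _ he with h | h
    · exact hedge u (Finset.mem_union_right _ hu) v h
    · exact (hdis u h.1 hu).elim

/-- The walk around a branch, or a part of it. -/
theorem Shape.visits (hT : T.IsSimpleMap n) {d : ℕ} {o : Option ℕ} {S : Finset ℕ} {l : List ℕ}
    (h : Shape T dem d o S l) : d < T.D → Visits T n dem d o S l := by
  have henter : ∀ {d c : ℕ} {S : Finset ℕ} {l : List ℕ} {nx : ℕ} {s : Config} {W₁ W₃ : List ℕ}
      {F : List (List ℕ)}, Shape T dem c none S l → d < T.D → c ≠ T.rev d →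
      IsPlane T n s.map (W₁ ++ ((d :: (l ++ [T.rev c])) ++ nx :: W₃)) F → s.cur = d →
      s.up (T.head d) = 0 → s.step = { s.mark with cur := c, prev := d } := by
    intro d c S l nx s W₁ W₃ F hS hd hcd hP hcur hup
    obtain ⟨l', rfl⟩ := hS.exists_cons
    have hf : s.map.face d = c := IsPlane.face_eq (W₁ := W₁) (W₃ := l' ++ T.rev c :: nx :: W₃)
      (by simpa using hP)
    have hh : s.map.head d = T.head d := hP.head hd (hT.rev_lt d hd)
    simp [Config.step, hcur, hh, hup, hf, hP.rev d hd, hcd]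
  have hmark : ∀ {d c : ℕ} {S : Finset ℕ} {s : Config}, T.Extends s.map → d < T.D → s.cur = d →
      T.head d ∉ S → (∀ v ∈ insert (T.head d) S, s.up v = 0 ∧ s.kind v = 0) →
      ∀ v ∈ S, ({ s.mark with cur := c, prev := d } : Config).up v = 0 ∧
        ({ s.mark with cur := c, prev := d } : Config).kind v = 0 := by
    intro d c S s hE hd hcur hw hfresh v hv
    have hvd : v ≠ T.head d := fun h => hw (h ▸ hv)
    have hh : s.map.head d = T.head d := hE.head hd (hT.rev_lt d hd)
    simpa [Config.mark, hcur, hh, hvd] using hfresh v (by simp [hv])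
  induction h with
  | leaf hn hdem =>
    intro hd s W₁ W₃ F hP hcur hfresh _
    exact visited_leaf hT hd hdem hP hcur (hfresh _ (by simp)).1
  | @unary d c S l hc hcd hn hdem hS hD ht hw hno ih =>
    intro hd s W₁ W₃ F hP hcur hfresh hedge
    have hs := henter hS hd hcd hP hcur (hfresh _ (by simp)).1
    have hV := ih hD { s.mark with cur := c, prev := d } (W₁ ++ [d]) (T.rev d :: W₃) F
      (by simpa [Config.mark] using hP) rfl (hmark hP.toExtends hd hcur hw hfresh)
      (fun u hu v he => hedge u (by simp [hu]) v he)
    rw [show (d :: (l ++ [T.rev c])).length = l.length + 1 + 1 by simp,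
      Function.iterate_succ_apply', Function.iterate_succ_apply, hs]
    exact visited_unary hT hd hD ht hw hV hP.toExtends hcur rfl hfresh hedge rfl hdem hno
  | @first d c S l hc hcd hn hdem hS hD ht hw ih =>
    intro hd s W₁ W₃ F hP hcur hfresh hedge
    have hs := henter hS hd hcd hP hcur (hfresh _ (by simp)).1
    have hV := ih hD { s.mark with cur := c, prev := d } (W₁ ++ [d]) (T.nxt c :: W₃) F
      (by simpa [Config.mark] using hP) rfl (hmark hP.toExtends hd hcur hw hfresh)
      (fun u hu v he => hedge u (by simp [hu]) v he)
    rw [show (d :: (l ++ [T.rev c])).length = l.length + 1 + 1 by simp,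
      Function.iterate_succ_apply', Function.iterate_succ_apply, hs]
    exact visited_first hT hd hD ht hw hV hP.toExtends hcur rfl hfresh rfl hn hdem
  | next _ hc _ hS' hD ht hdis hno ih ih' | last _ hc _ hS' hD ht hdis hno ih ih' =>
    intro hd
    exact (ih hd).merge hT hc hS' (ih' hD) hD ht hdis hno

end HalfEdgeMap

namespace HalfEdgeMap

/-! ### The root -/

/-- The map after the last chords are inserted, at the leaf that is the root. -/
def Config.finish (s : Config) : HalfEdgeMap :=
  let e := s.cur
  let u := s.map.tail e
  if s.kind u < 3 then (s.map.chord e (s.a u)).chord e (s.c u)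
  else if s.kind u < 4 then
    ((s.map.chord (s.c u) s.prev).chord e (s.b u)).chord e (s.c u)
  else if s.kind u < 5 then
    ((s.map.chord (s.c u) s.prev).chord e (s.a u)).chord e (s.b u)
  else ((s.map.chord e (s.a u)).chord e (s.b u)).chord e (s.c u)

variable {T M : HalfEdgeMap} {n : ℕ} {dem : ℕ → ℕ} {F : List (List ℕ)}

theorem _root_.IsClosedWalk.rotate {f : ℕ → ℕ} {l : List ℕ} {e : ℕ} (h : IsClosedWalk f (l ++ [e])) :
    IsClosedWalk f (e :: l) := by
  cases l with
  | nil => simpa using h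
  | cons x l =>
    unfold IsClosedWalk at h ⊢
    simp only [List.cons_append, List.take_succ_cons, List.take_zero, List.append_assoc,
      List.nil_append] at h ⊢
    rw [← List.cons_append, List.isChain_split] at h
    rw [List.isChain_cons_cons]
    simp only [List.isChain_cons_cons] at h
    exact ⟨h.2.1, by simpa using h.1⟩

/-- The outer walk is cyclic. Started at the corner of the root leaf, it has that corner before all
pending ones, as a fan of chords requires. -/
theorem IsPlane.rotate {m : List ℕ} {e : ℕ} (h : IsPlane T n M (m ++ [e]) F) :
    IsPlane T n M (e :: m) F := by
  refine { h with
    nodup := ?_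
    mem := fun z => ?_
    outer_ne := by simp
    outer := IsClosedWalk.rotate h.outer }
  · refine (List.Perm.nodup_iff ?_).1 h.nodup
    exact (List.perm_append_comm (l₁ := m) (l₂ := [e])).append_right _
  · rw [← h.mem z]
    simp only [List.mem_append, List.mem_cons, List.not_mem_nil, or_false]
    tauto

/-- A chord from the corner `e`, and the order of the corners behind it. -/
theorem IsPlane.fan {L : List ℕ} {e x : ℕ} (h : IsPlane T n M L F) (hx : InOrder L e x)
    (hne : M.head e ≠ M.head x) (hno : ¬ M.Edge (M.head e) (M.head x)) :
    ∃ L' F', IsPlane T n (M.chord e x) L' F' ∧ (M.chord e x).Edge (M.head e) (M.head x) ∧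
      (∀ y, InOrder L x y → y ≠ x → InOrder L' e y ∧ (M.chord e x).head y = M.head y ∧
        ∀ z, InOrder L y z → InOrder L' y z) ∧ (M.chord e x).head e = M.head e ∧
      ∀ y, y ≠ M.head x → (M.head e ≠ y) → ¬ M.Edge (M.head e) y →
        ¬ (M.chord e x).Edge (M.head e) y := by
  have h' : IsPlane T n M ([] ++ (L ++ [])) F := by simpa using h
  obtain ⟨L', F', hP, hs⟩ := h'.exists_chord hx hne hno
  refine ⟨L', F', by simpa using hP, ?_, ?_, h'.head_chord hx.1, ?_⟩
  · rw [chord_edge h.toIsSimpleMap]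
    exact Or.inr (Or.inl ⟨rfl, rfl⟩)
  · intro y hy hyx
    exact ⟨hs.across _ _ (.refl hx.1) hy hyx, h'.head_chord hy.2.1, fun z hz =>
      hs.after _ _ hz hy hyx⟩
  · intro y hyx hye hEy
    rw [chord_edge h.toIsSimpleMap]
    rintro (h1 | ⟨-, h1⟩ | ⟨h1, -⟩)
    · exact hEy h1
    · exact hyx h1
    · exact hne h1

theorem IsPlane.fan_two {L : List ℕ} {e x y r vx vy : ℕ} (h : IsPlane T n M L F)
    (hx : InOrder L e x) (hy : InOrder L x y) (he : M.head e = r) (hvx : M.head x = vx)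
    (hvy : M.head y = vy) (hrx : r ≠ vx) (hry : r ≠ vy) (hxy : vx ≠ vy)
    (hnx : ¬ M.Edge r vx) (hny : ¬ M.Edge r vy) :
    ∃ L' F', IsPlane T n ((M.chord e x).chord e y) L' F' ∧
      ((M.chord e x).chord e y).Edge r vx ∧ ((M.chord e x).chord e y).Edge r vy := by
  subst he hvx hvy
  obtain ⟨L₁, F₁, hP₁, hE₁, hO₁, hh₁, hn₁⟩ := h.fan hx hrx hnx
  have hyx : y ≠ x := fun h => hxy (by rw [h])
  obtain ⟨hy₁, hhy, -⟩ := hO₁ y hy hyx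
  obtain ⟨L₂, F₂, hP₂, hE₂, -⟩ := hP₁.fan hy₁ (by rwa [hh₁, hhy])
    (by rw [hh₁, hhy]; exact hn₁ _ hxy.symm hry hny)
  refine ⟨L₂, F₂, hP₂, (extends_chord _ _ _).edge hP₁.rev_lt hE₁, ?_⟩
  rwa [hh₁, hhy] at hE₂

theorem IsPlane.fan_three {L : List ℕ} {e x y z r vx vy vz : ℕ} (h : IsPlane T n M L F)
    (hx : InOrder L e x) (hy : InOrder L x y) (hz : InOrder L y z) (he : M.head e = r)
    (hvx : M.head x = vx) (hvy : M.head y = vy) (hvz : M.head z = vz) (hrx : r ≠ vx) (hry : r ≠ vy)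
    (hrz : r ≠ vz) (hxy : vx ≠ vy) (hxz : vx ≠ vz) (hyz : vy ≠ vz)
    (hnx : ¬ M.Edge r vx) (hny : ¬ M.Edge r vy) (hnz : ¬ M.Edge r vz) :
    ∃ L' F', IsPlane T n (((M.chord e x).chord e y).chord e z) L' F' ∧
      (((M.chord e x).chord e y).chord e z).Edge r vx ∧
      (((M.chord e x).chord e y).chord e z).Edge r vy ∧
      (((M.chord e x).chord e y).chord e z).Edge r vz := by
  subst he hvx hvy hvz
  obtain ⟨L₁, F₁, hP₁, hE₁, hO₁, hh₁, hn₁⟩ := h.fan hx hrx hnx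
  obtain ⟨hy₁, hhy, hz₁⟩ := hO₁ y hy (fun h => hxy (by rw [h]))
  obtain ⟨-, hhz, -⟩ := hO₁ z (hy.trans hz) (fun h => hxz (by rw [h]))
  obtain ⟨L₂, F₂, hP₂, hE₂, hE₃⟩ := hP₁.fan_two hy₁ (hz₁ z hz) hh₁ hhy hhz hry hrz hyz
    (hn₁ _ hxy.symm hry hny) (hn₁ _ hxz.symm hrz hnz)
  exact ⟨L₂, F₂, hP₂, ((extends_chord _ _ _).trans (extends_chord _ _ _)).edge hP₁.rev_lt hE₁,
    hE₂, hE₃⟩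

/-- `N` is a plane map that contains `T`, stays connected if two vertices of `V` are removed, and
has the prescribed number of half-edges. -/
structure IsGoal (T : HalfEdgeMap) (n m : ℕ) (V : Set ℕ) (N : HalfEdgeMap) : Prop where
  plane : ∃ W F, IsPlane T n N W F
  count : N.D = T.D + m ∨ N.D = T.D + m + 1
  closed : ∀ x ∈ V, ∀ y ∈ V, ∀ C, ClosedIn N.Edge (V \ {x, y}) C →
    ∀ z ∈ V, z ≠ x → z ≠ y → z ∈ C → ∀ t ∈ V, t ≠ x → t ≠ y → t ∈ C

/-- The map at the end is plane and `3`-connected, and has the right number of edges. -/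
theorem Visited.finish {d : ℕ} {S : Finset ℕ} {s₀ s : Config} (hT : T.IsSimpleMap n) (hd : d < T.D)
    (hV : Visited T n dem d none S [] [T.rev d] s₀ s) (hs₀ : s₀.map = T) (hr : T.tail d ∉ S)
    (hS : 2 < S.card) (hleaf : ∀ x, T.Edge (T.tail d) x → x = T.head d) :
    IsGoal T n (∑ v ∈ S, dem v + 2) (insert (T.tail d) S) s.finish := by
  obtain ⟨m, F, hP, hF, hI⟩ := hV.plane
  have hF : FullAt s.map S (T.head d) m _ _ _ _ := hF
  have hrd := hT.rev_lt d hd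
  have hcur : s.cur = T.rev d := hV.cur
  have hu : s.map.tail (T.rev d) = T.head d := hP.tail _ hrd
  have he : s.map.head (T.rev d) = T.tail d := by
    rw [hP.head hrd (hT.rev_lt _ hrd), hT.head_rev hd]
  have hP : IsPlane T n s.map (T.rev d :: m) F := IsPlane.rotate (by simpa using hP)
  have hnd := hP.nodup
  have hem : T.rev d ∉ m := by
    rw [List.nodup_append, List.nodup_cons] at hnd
    exact hnd.1.1
  have hadd : ∀ {m' : List ℕ} {F' M'}, IsPlane T n M' (T.rev d :: m') F' → ∀ {x y}, InOrder m' x y →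
      InOrder (T.rev d :: m') x y := by
    intro m' F' M' hP x y h
    have hnd := hP.nodup
    rw [List.nodup_append, List.nodup_cons] at hnd
    exact h.append_right (l₁ := [T.rev d]) (by rw [List.mem_singleton]; exact fun e => hnd.1.1 (e ▸ h.1))
      (by rw [List.mem_singleton]; exact fun e => hnd.1.1 (e ▸ h.2.1))
  have hD : T.D = s₀.map.D := by rw [hs₀]
  have hcount := hV.count
  rw [← hD] at hcount
  have hrS : ∀ {v}, v ∈ S → T.tail d ≠ v := fun h e => hr (e ▸ h)
  have hrE : ∀ {v}, v ∈ S → v ≠ T.head d → ¬ s.map.Edge (T.tail d) v := by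
    intro v hv hvd h
    rcases hV.edge _ _ h with h | h
    · exact hvd (hleaf _ (hs₀ ▸ h))
    · exact hr h.1
  set k := s.kind (T.head d) with hk
  set a := s.a (T.head d)
  set b := s.b (T.head d)
  set c := s.c (T.head d)
  have hha : s.map.head a ∈ S := hF.conn.ha
  have hhb : s.map.head b ∈ S := hF.conn.hb
  have hhc : s.map.head c ∈ S := hF.conn.hc
  have hcoe : (↑(insert (T.tail d) S) : Set ℕ) = insert (T.tail d) (S : Set ℕ) := by simp
  have hclose : ∀ {N : HalfEdgeMap} {W F}, IsPlane T n N W F → s.map.Extends N →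
      (k = 3 ∨ k = 4 → N.Edge (T.head d) (s.map.head c)) →
      (k ≠ 3 → N.Edge (T.tail d) (s.map.head a)) → (k ≠ 2 → N.Edge (T.tail d) (s.map.head b)) →
      (k ≠ 4 → N.Edge (T.tail d) (s.map.head c)) → s.finish = N →
      N.D = T.D + ∑ v ∈ S, dem v + pending k →
      IsGoal T n (∑ v ∈ S, dem v + 2) (insert (T.tail d) S) s.finish := by
    intro N W F hPN hN huc hra hrb hrc hfin hcnt
    rw [hfin]
    refine ⟨⟨W, F, hPN⟩, ?_, ?_⟩
    -- The root leaf itself demands 2. With two pending demands the closing chords fit exactly; with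
    -- three, one half-edge is in surplus.
    · unfold pending at hcnt
      split_ifs at hcnt <;> omega
    · have hB := hF.conn.mono fun u v => hN.edge (u := u) (v := v) hP.rev_lt
      exact fun x hx y hy => hB.closed_of_root hr (hPN.edge hT.rev_lt ⟨d, hd, rfl, rfl⟩)
        hPN.edge_symm huc hra hrb hrc x y hx hy
  rcases hF.conn.kind with h2 | h2 | h2 | h2
  · have hab := hF.two h2
    have hdis : s.map.head a ≠ T.head d ∧ s.map.head c ≠ T.head d ∧ s.map.head a ≠ s.map.head c := by
      refine (hF.conn.distinct_two h2).resolve_left fun h => ?_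
      obtain ⟨p, hp, q, hq, hpq⟩ := Finset.one_lt_card.1 (show 1 < S.card by omega)
      exact hpq ((h p hp).trans (h q hq).symm)
    obtain ⟨L, F', hP', hE₁, hE₂⟩ := hP.fan_two (.cons hF.ab.1) (hadd hP (hF.ab.trans hF.bc)) he rfl
      rfl (hrS hha) (hrS hhc) hdis.2.2 (hrE hha hdis.1) (hrE hhc hdis.2.1)
    refine hclose hP' ((extends_chord _ _ _).trans (extends_chord _ _ _)) (by omega) (fun _ => hE₁)
      (by omega) (fun _ => hE₂) ?_ ?_
    · simp [Config.finish, hcur, hu, ← hk, h2, a, c]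
    · simp only [chord_D, pending, h2, if_true] at hcount ⊢
      omega
  all_goals
    have hdis := hF.conn.distinct (by omega)
    obtain ⟨hcp, hhp⟩ := hI (by omega)
  -- Kind 5: three chords from the root leaf, which receives one edge more than it needs.
  on_goal 3 =>
    obtain ⟨L, F', hP', hE₁, hE₂, hE₃⟩ := hP.fan_three (.cons hF.ab.1) (hadd hP hF.ab)
      (hadd hP hF.bc) he rfl rfl rfl (hrS hha) (hrS hhb) (hrS hhc) hdis.1 hdis.2.1 (hF.conn.bc h2)
      (hrE hha (hF.conn.aw (Or.inr h2))) (hrE hhb hdis.2.2.1) (hrE hhc hdis.2.2.2)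
    refine hclose hP' (((extends_chord _ _ _).trans (extends_chord _ _ _)).trans
      (extends_chord _ _ _)) (by omega) (fun _ => hE₁) (fun _ => hE₂) (fun _ => hE₃) ?_ ?_
    · simp [Config.finish, hcur, hu, ← hk, h2, a, b, c]
    · simp only [chord_D, pending, h2] at hcount ⊢
      norm_num at hcount ⊢
      omega
  all_goals
    -- Kinds 3 and 4: the chord from `c` to the root of the branch is not yet an edge. In kind 3
    -- this needs more than two vertices in `S`.
    have hsep := hV.sep rfl (by omega)
    have hP₀ : IsPlane T n s.map ([T.rev d] ++ (m ++ [])) F := by simpa using hP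
    obtain ⟨m', F', hP₁, hs⟩ := hP₀.exists_chord hcp (by rw [hhp]; exact hdis.2.2.2)
      (by rw [hhp]; exact hsep)
    have hP₁ : IsPlane T n (s.map.chord c s.prev) (T.rev d :: m') F' := by simpa using hP₁
    have hab := hs.before _ _ hF.ab hF.bc
    have hbc := hs.before _ _ hF.bc (.refl hF.bc.2.1)
    have hh : ∀ {z}, z ∈ m → (s.map.chord c s.prev).head z = s.map.head z := fun hz =>
      hP₀.head_chord hz
    have he₁ : (s.map.chord c s.prev).head (T.rev d) = T.tail d := by
      rw [chord_head hP.toIsSimpleMap (hrd.trans_le hP.le), he]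
    have hrE₁ : ∀ {v}, v ∈ S → v ≠ T.head d → ¬ (s.map.chord c s.prev).Edge (T.tail d) v := by
      intro v hv hvd
      rw [chord_edge hP.toIsSimpleMap, hhp]
      rintro (h | ⟨h, -⟩ | ⟨h, -⟩)
      · exact hrE hv hvd h
      · exact hrS hhc h
      · exact hrS hF.conn.hw h
    have hcu : (s.map.chord c s.prev).Edge (T.head d) (s.map.head c) := by
      rw [chord_edge hP.toIsSimpleMap, hhp]
      exact Or.inr (Or.inr ⟨rfl, rfl⟩)
  · have hbc' : s.map.head b ≠ s.map.head c := by
      refine (hF.conn.aw_three h2).2.resolve_left fun h => ?_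
      have h3 : S ⊆ {T.head d, s.map.head c} := fun v hv => by simpa using h v hv
      have := (Finset.card_le_card h3).trans Finset.card_le_two
      omega
    obtain ⟨L, F₂, hP', hE₁, hE₂⟩ := hP₁.fan_two (.cons hab.2.1) (hadd hP₁ hbc) he₁ (hh hF.ab.2.1)
      (hh hF.bc.2.1) (hrS hhb) (hrS hhc) hbc' (hrE₁ hhb hdis.2.2.1) (hrE₁ hhc hdis.2.2.2)
    have hext := (extends_chord (s.map.chord c s.prev) (T.rev d) b).trans
      (extends_chord _ (T.rev d) c)
    refine hclose hP' ((extends_chord _ _ _).trans hext) (fun _ => hext.edge hP₁.rev_lt hcu)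
      (by omega) (fun _ => hE₁) (fun _ => hE₂) ?_ ?_
    · simp [Config.finish, hcur, hu, ← hk, h2, b, c]
    · simp only [chord_D, pending, h2] at hcount ⊢
      norm_num at hcount ⊢
      omega
  · obtain ⟨L, F₂, hP', hE₁, hE₂⟩ := hP₁.fan_two (.cons hab.1) (hadd hP₁ hab) he₁ (hh hF.ab.1)
      (hh hF.ab.2.1) (hrS hha) (hrS hhb) hdis.1 (hrE₁ hha (hF.conn.aw (Or.inl h2)))
      (hrE₁ hhb hdis.2.2.1)
    have hext := (extends_chord (s.map.chord c s.prev) (T.rev d) a).trans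
      (extends_chord _ (T.rev d) b)
    refine hclose hP' ((extends_chord _ _ _).trans hext) (fun _ => hext.edge hP₁.rev_lt hcu)
      (fun _ => hE₁) (fun _ => hE₂) (by omega) ?_ ?_
    · simp [Config.finish, hcur, hu, ← hk, h2, a, b, c]
    · simp only [chord_D, pending, h2] at hcount ⊢
      norm_num at hcount ⊢
      omega

end HalfEdgeMap

/-! ### Programs without loops -/

namespace RamProgram

/-- The effect of a program without loops. -/
def run : RamProgram → RamState → RamState
  | skip, s => s
  | const r k, s => s.setReg r k
  | add r a b, s => s.setReg r (s.reg a + s.reg b)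
  | sub r a b, s => s.setReg r (s.reg a - s.reg b)
  | load r A i, s => s.setReg r (s.arr A (s.reg i))
  | store A i r, s => s.setArr A (s.reg i) (s.reg r)
  | seq P Q, s => Q.run (P.run s)
  | ite a b P Q, s => if s.reg a < s.reg b then P.run s else Q.run s
  | loop _ _ _, s => s

/-- A bound for the time that a program without loops takes. -/
def cost : RamProgram → ℕ
  | seq P Q => P.cost + Q.cost
  | ite _ _ P Q => P.cost + Q.cost + 1
  | _ => 1

/-- The program has no loops, never writes to register 5, adds nothing but the content of
register 5, and has no constants above 5. -/
def Tame : RamProgram → Prop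
  | skip => True
  | const r k => r ≠ 5 ∧ k ≤ 5
  | add r _ b => r ≠ 5 ∧ b = 5
  | sub r _ _ => r ≠ 5
  | load r _ _ => r ≠ 5
  | store _ _ _ => True
  | seq P Q => P.Tame ∧ Q.Tame
  | ite _ _ P Q => P.Tame ∧ Q.Tame
  | loop _ _ _ => False

end RamProgram

namespace RamState

/-- All numbers in the memory are at most `K`, and register 5 holds one. -/
structure Bounded (s : RamState) (K : ℕ) : Prop where
  reg : ∀ r, s.reg r ≤ K
  arr : ∀ A i, s.arr A i ≤ K
  one : s.reg 5 = 1

theorem Bounded.mono {s : RamState} {K K' : ℕ} (h : s.Bounded K) (hK : K ≤ K') : s.Bounded K' :=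
  ⟨fun r => (h.reg r).trans hK, fun A i => (h.arr A i).trans hK, h.one⟩

theorem Bounded.setReg {s : RamState} {K r x : ℕ} (h : s.Bounded K) (hr : r ≠ 5) (hx : x ≤ K) :
    (s.setReg r x).Bounded K := by
  refine ⟨fun q => ?_, h.arr, ?_⟩
  · simp only [RamState.setReg, Function.update_apply]
    split_ifs
    · exact hx
    · exact h.reg q
  · simp [RamState.setReg, hr.symm, h.one]

theorem Bounded.setArr {s : RamState} {K A i x : ℕ} (h : s.Bounded K) (hx : x ≤ K) :
    (s.setArr A i x).Bounded K := by
  refine ⟨h.reg, fun B j => ?_, h.one⟩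
  simp only [RamState.setArr, Function.update_apply]
  split_ifs with h1
  · simp only [Function.update_apply]
    split_ifs
    · exact hx
    · exact h.arr A j
  · exact h.arr B j

end RamState

/-- Every instruction raises the largest number in the memory by at most one, since only the one in
register 5 is ever added. A bound on the time is thus a bound on the word size. -/
theorem RamProgram.Tame.exec {N : ℕ} {P : RamProgram} (hP : P.Tame) : ∀ {K : ℕ} {s : RamState},
    5 ≤ K → s.Bounded K → K + P.cost ≤ N →
    (P.run s).Bounded (K + P.cost) ∧ ∃ t ≤ P.cost, RamExec N P s t (P.run s) := by
  induction P with
  | skip => exact fun _ hs _ => ⟨hs.mono (by omega), 1, le_rfl, .skip _⟩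
  | const r k =>
    intro K s hK hs hN
    simp only [cost] at hN
    exact ⟨(hs.mono (by omega)).setReg hP.1 (by have := hP.2; omega), 1, le_rfl,
      .const _ _ _ (by have := hP.2; omega)⟩
  | add r a b =>
    intro K s hK hs hN
    simp only [cost] at hN
    have h1 := hs.reg a
    have h2 : s.reg b = 1 := by rw [hP.2, hs.one]
    exact ⟨(hs.mono (by omega)).setReg hP.1 (by simp only [cost]; omega), 1, le_rfl,
      .add _ _ _ _ (by omega)⟩
  | sub r a b =>
    intro K s hK hs hN
    have h1 := hs.reg a
    exact ⟨(hs.mono (by omega)).setReg hP (by simp only [cost]; omega), 1, le_rfl,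
      .sub _ _ _ _ (by omega)⟩
  | load r A i =>
    intro K s hK hs hN
    have h1 := hs.arr A (s.reg i)
    exact ⟨(hs.mono (by omega)).setReg hP (by simp only [cost]; omega), 1, le_rfl,
      .load _ _ _ _ (by omega)⟩
  | store A i r =>
    intro K s hK hs hN
    have h1 := hs.reg r
    exact ⟨(hs.mono (by omega)).setArr (by simp only [cost]; omega), 1, le_rfl,
      .store _ _ _ _ (by omega)⟩
  | seq P Q ihP ihQ =>
    intro K s hK hs hN
    simp only [cost] at hN
    obtain ⟨hb, t, ht, he⟩ := ihP hP.1 hK hs (by omega)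
    obtain ⟨hb', t', ht', he'⟩ := ihQ hP.2 (by omega) hb (by omega)
    exact ⟨hb'.mono (by simp only [cost]; omega), t + t', by simp only [cost]; omega, .seq he he'⟩
  | ite a b P Q ihP ihQ =>
    intro K s hK hs hN
    simp only [cost] at hN
    by_cases h : s.reg a < s.reg b
    · obtain ⟨hb, t, ht, he⟩ := ihP hP.1 hK hs (by omega)
      rw [show (RamProgram.ite a b P Q).run s = P.run s by simp [run, h]]
      exact ⟨hb.mono (by simp only [cost]; omega), t + 1, by simp only [cost]; omega, .iteTrue h he⟩
    · obtain ⟨hb, t, ht, he⟩ := ihQ hP.2 hK hs (by omega)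
      rw [show (RamProgram.ite a b P Q).run s = Q.run s by simp [run, h]]
      exact ⟨hb.mono (by simp only [cost]; omega), t + 1, by simp only [cost]; omega,
        .iteFalse h he⟩
  | loop => exact hP.elim

/-- A loop whose body is a program without loops. -/
theorem RamProgram.Tame.exec_loop {N a b : ℕ} {P : RamProgram} (hP : P.Tame) : ∀ {k K : ℕ}
    {s : RamState}, 5 ≤ K → s.Bounded K → K + k * P.cost ≤ N →
    (∀ j < k, (P.run^[j] s).reg a < (P.run^[j] s).reg b) →
    ¬ (P.run^[k] s).reg a < (P.run^[k] s).reg b →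
    (P.run^[k] s).Bounded (K + k * P.cost) ∧
      ∃ t ≤ k * (P.cost + 1) + 1, RamExec N (.loop a b P) s t (P.run^[k] s) := by
  intro k
  induction k with
  | zero =>
    intro K s _ hs _ _ h
    exact ⟨by simpa using hs, 1, by omega, .loopStop h⟩
  | succ k ih =>
    intro K s hK hs hN h1 h2
    rw [Nat.succ_mul] at hN
    obtain ⟨hb, t, ht, he⟩ := hP.exec (N := N) hK hs (by omega)
    obtain ⟨hb', t', ht', he'⟩ := ih (K := K + P.cost) (by omega) hb (by omega)
      (fun j hj => by simpa using h1 (j + 1) (by omega)) (by simpa using h2)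
    rw [Function.iterate_succ_apply]
    refine ⟨hb'.mono ?_, t + 1 + t', ?_, .loopStep (h1 0 (by omega)) he he'⟩
    · rw [Nat.succ_mul]
      omega
    · rw [Nat.succ_mul]
      omega

/-! ### The program -/

namespace RamProgram

/-- `r := a`; register 7 holds zero. -/
def copy (r a : ℕ) : RamProgram := .sub r a 7

/-- Insert the chord from the arrival in register `x` to the one in register `y`. -/
def chord (x y : ℕ) : RamProgram :=
  .seq (.load 17 1 x) <| .seq (.load 18 1 y) <| .seq (.add 19 1 5) <| .seq (copy 20 1) <|
  .seq (.load 30 0 17) <| .seq (.load 31 0 18) <| .seq (.store 0 20 30) <| .seq (.store 0 19 31) <|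
  .seq (.store 1 20 19) <| .seq (.store 1 19 20) <|
  .seq (.load 30 2 17) <| .seq (.load 31 2 18) <| .seq (.store 2 20 30) <| .seq (.store 2 19 31) <|
  .seq (.store 2 17 20) <| .seq (.store 2 18 19) <| .add 1 19 5

/-- Load the data of the current arrival. -/
def loads : RamProgram :=
  .seq (.load 8 1 2) <| .seq (.load 9 0 8) <| .seq (.load 10 2 8) <| .seq (.load 11 7 9) <|
  .seq (.load 12 0 2) <| .seq (.load 13 3 9) <| .seq (.load 14 3 12) <| .seq (.load 15 6 9) <|
  .seq (.load 16 4 12) <| .seq (.load 21 6 12) <| .seq (.load 23 5 9) <| .seq (.load 24 5 12) <|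
  .load 29 4 9

/-- Store a kind and three corners, and go on along the face. -/
def put (k a b c : ℕ) : RamProgram :=
  .seq (.const 25 k) <| .seq (.store 3 9 25) <| .seq (.store 4 9 a) <| .seq (.store 5 9 b) <|
  .store 6 9 c

/-- If the registers `a` and `b` are equal, then `P`, else `Q`. -/
def ifEq (a b : ℕ) (P Q : RamProgram) : RamProgram := .ite a b Q (.ite b a Q P)

/-- The case of a vertex that is not yet visited. -/
def arriveNew : RamProgram :=
  .seq (.add 30 8 5) <| .seq (.store 7 9 30) <| ifEq 10 8 (put 2 2 2 2) .skip

/-- The case of the return from the first child. -/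
def arriveFirst : RamProgram :=
  .seq (.add 30 10 5) <| ifEq 30 11
    (.ite 14 22 (.seq (.sub 30 11 5) <| .seq (.load 31 1 30) (put 3 31 16 21))
      (.seq (chord 21 2) (put 2 16 16 24)))
    (.seq (.store 3 9 14) <| .seq (.store 4 9 16) <| .seq (.store 5 9 24) (.store 6 9 21))

/-- The case of the return from a later child. -/
def arriveNext : RamProgram :=
  .seq (chord 15 16) <| .ite 13 22
    (.seq (ifEq 21 16 (copy 21 20) .skip) <| .ite 14 22 (put 2 29 23 21) (put 4 29 24 21))
    (.ite 14 22 (.seq (ifEq 21 16 (copy 21 20) .skip) (put 5 29 23 21))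
      (.seq (chord 23 24) <| .seq (ifEq 21 24 (copy 21 20) .skip) (put 2 29 29 21)))

/-- One arrival. -/
def arrive : RamProgram :=
  .seq loads <| .seq (.ite 11 5 arriveNew (.ite 13 5 arriveFirst arriveNext)) <|
  .seq (copy 6 2) <| .seq (copy 2 10) (.add 3 3 5)

/-- The last chords. -/
def close : RamProgram :=
  .seq (.load 12 0 2) <| .seq (.load 14 3 12) <| .seq (.load 16 4 12) <| .seq (.load 24 5 12) <|
  .seq (.load 21 6 12) <| .seq (.const 23 4) <| .seq (.const 25 5) <|
  .ite 14 22 (.seq (chord 2 16) (chord 2 21)) <|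
  .ite 14 23 (.seq (chord 21 6) <| .seq (chord 2 24) (chord 2 21)) <|
  .ite 14 25 (.seq (chord 21 6) <| .seq (chord 2 16) (chord 2 24))
    (.seq (chord 2 16) <| .seq (chord 2 24) (chord 2 21))

/-- Look at one half-edge for a leaf, which ends in register 2. -/
def scan : RamProgram :=
  .seq (.load 8 2 3) <| .seq (ifEq 8 3 (copy 2 3) .skip) (.add 3 3 5)

/-- Prepare the walk. -/
def prepare : RamProgram :=
  .seq (copy 4 1) <| .seq (.const 3 1) (.const 22 3)

/-- The program: find a leaf, walk around the tree, and insert the last chords. -/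
def augment : RamProgram :=
  .seq (.const 5 1) <| .seq (.loop 3 1 scan) <| .seq prepare <| .seq (.loop 3 4 arrive) close

theorem tame_arrive : arrive.Tame := by
  simp [Tame, arrive, loads, arriveNew, arriveFirst, arriveNext, chord, put, ifEq, copy]

theorem tame_close : close.Tame := by
  simp [Tame, close, chord, copy]

theorem tame_scan : scan.Tame := by
  simp [Tame, scan, ifEq, copy]

theorem tame_prepare : prepare.Tame := by
  simp [Tame, prepare, copy]

end RamProgram

/-! ### The memory as a state of the algorithm -/

namespace RamState

/-- The map in the arrays 0, 1, 2. -/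
def map (s : RamState) : HalfEdgeMap := ⟨s.reg 1, s.arr 0, s.arr 1, s.arr 2⟩

/-- The memory as a state of the algorithm. -/
def config (s : RamState) : HalfEdgeMap.Config :=
  ⟨s.map, s.arr 3, s.arr 4, s.arr 5, s.arr 6, s.arr 7, s.reg 2, s.reg 6⟩

/-- The registers with constants. -/
structure Constants (s : RamState) : Prop where
  one : s.reg 5 = 1
  zero : s.reg 7 = 0
  three : s.reg 22 = 3

@[simp] theorem setReg_reg (s : RamState) (r x q : ℕ) :
    (s.setReg r x).reg q = if q = r then x else s.reg q := by
  simp [setReg, Function.update_apply]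

@[simp] theorem setReg_arr (s : RamState) (r x : ℕ) : (s.setReg r x).arr = s.arr := rfl

@[simp] theorem setArr_reg (s : RamState) (A i x : ℕ) : (s.setArr A i x).reg = s.reg := rfl

@[simp] theorem setArr_arr (s : RamState) (A i x B : ℕ) :
    (s.setArr A i x).arr B = if B = A then Function.update (s.arr A) i x else s.arr B := by
  by_cases h : B = A
  · subst h
    simp [setArr]
  · simp [setArr, h]

theorem map_setReg (s : RamState) {r : ℕ} (x : ℕ) (h : r ≠ 1) : (s.setReg r x).map = s.map := by
  simp [map, h.symm]

theorem map_setArr (s : RamState) {A : ℕ} (i x : ℕ) (h : 3 ≤ A) :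
    (s.setArr A i x).map = s.map := by
  simp [map, show 0 ≠ A by omega, show 1 ≠ A by omega, show 2 ≠ A by omega]

end RamState

/-! ### The program simulates one arrival -/

section Exec

open RamState RamProgram

variable {s : RamState}

/-- The effect of the insertion of a chord. -/
theorem RamProgram.run_chord {x y : ℕ} (h5 : s.reg 5 = 1) (h7 : s.reg 7 = 0)
    (hy : y ∉ [1, 17, 18, 19, 20, 30, 31]) :
    ∃ s', (chord x y).run s = s' ∧ s'.map = s.map.chord (s.reg x) (s.reg y) ∧
      (∀ A, 3 ≤ A → s'.arr A = s.arr A) ∧ s'.reg 20 = s.map.D ∧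
      ∀ r, r ∉ [1, 17, 18, 19, 20, 30, 31] → s'.reg r = s.reg r := by
  simp only [List.mem_cons, List.not_mem_nil, or_false, not_or] at hy
  refine ⟨_, rfl, ?_, ?_, ?_, ?_⟩
  · simp [chord, copy, run, h5, h7, hy, RamState.map, HalfEdgeMap.chord]
  · intro A hA
    simp [chord, copy, run, h5, h7, hy, show A ≠ 0 by omega, show A ≠ 1 by omega,
      show A ≠ 2 by omega]
  · simp [chord, copy, run, h5, h7, hy, RamState.map]
  · intro r hr
    simp only [List.mem_cons, List.not_mem_nil, or_false, not_or] at hr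
    simp [chord, copy, run, h5, h7, hr]

/-- The effect of the loads. -/
theorem RamProgram.run_loads :
    ∃ s', loads.run s = s' ∧ s'.arr = s.arr ∧
      s'.reg 8 = s.map.rev (s.reg 2) ∧ s'.reg 9 = s.map.head (s.reg 2) ∧
      s'.reg 10 = s.map.face (s.reg 2) ∧ s'.reg 11 = s.arr 7 (s.map.head (s.reg 2)) ∧
      s'.reg 13 = s.arr 3 (s.map.head (s.reg 2)) ∧
      s'.reg 14 = s.arr 3 (s.map.tail (s.reg 2)) ∧ s'.reg 15 = s.arr 6 (s.map.head (s.reg 2)) ∧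
      s'.reg 16 = s.arr 4 (s.map.tail (s.reg 2)) ∧ s'.reg 21 = s.arr 6 (s.map.tail (s.reg 2)) ∧
      s'.reg 23 = s.arr 5 (s.map.head (s.reg 2)) ∧ s'.reg 24 = s.arr 5 (s.map.tail (s.reg 2)) ∧
      s'.reg 29 = s.arr 4 (s.map.head (s.reg 2)) ∧
      ∀ r ∈ [0, 1, 2, 3, 4, 5, 6, 7, 22], s'.reg r = s.reg r := by
  refine ⟨_, rfl, ?_⟩
  simp [loads, run, RamState.map, HalfEdgeMap.head, HalfEdgeMap.face]

theorem RamProgram.run_ifEq {a b : ℕ} {P Q : RamProgram} :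
    (ifEq a b P Q).run s = if s.reg a = s.reg b then P.run s else Q.run s := by
  rcases lt_trichotomy (s.reg a) (s.reg b) with h | h | h
  · simp [ifEq, run, h, h.ne]
  · simp [ifEq, run, h]
  · simp [ifEq, run, h, h.ne', h.not_gt]

/-- The effect of the storing of corners. -/
theorem RamProgram.run_put {k a b c : ℕ} (ha : a ≠ 25) (hb : b ≠ 25) (hc : c ≠ 25) :
    ∃ s', (put k a b c).run s = s' ∧ s'.config = { s.config with
        kind := Function.update s.config.kind (s.reg 9) k
        a := Function.update s.config.a (s.reg 9) (s.reg a)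
        b := Function.update s.config.b (s.reg 9) (s.reg b)
        c := Function.update s.config.c (s.reg 9) (s.reg c) } ∧
      ∀ r, r ≠ 25 → s'.reg r = s.reg r := by
  refine ⟨_, rfl, ?_, ?_⟩
  · simp [put, run, config, RamState.map, ha, hb, hc]
  · intro r hr
    simp [put, run, hr]

/-- The effect of the correction of the last corner. -/
theorem RamProgram.run_correct {y : ℕ} (h7 : s.reg 7 = 0) :
    (ifEq 21 y (copy 21 20) .skip).run s =
      s.setReg 21 (if s.reg 21 = s.reg y then s.reg 20 else s.reg 21) := by
  rw [run_ifEq]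
  split_ifs
  · simp [run, copy, h7]
  · simp [run, RamState.setReg]

/-- The effect of one arrival. -/
theorem RamProgram.run_arrive (hs : s.Constants) :
    (arrive.run s).config = s.config.step ∧ (arrive.run s).Constants ∧
      (arrive.run s).reg 0 = s.reg 0 ∧ (arrive.run s).reg 3 = s.reg 3 + 1 ∧
      (arrive.run s).reg 4 = s.reg 4 := by
  obtain ⟨s₁, h₁, harr, h8, h9, h10, h11, h13, h14, h15, h16, h21, h23, h24, h29, hr⟩ :=
    run_loads (s := s)
  have h5 : s₁.reg 5 = 1 := by rw [hr 5 (by simp), hs.one]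
  have h7 : s₁.reg 7 = 0 := by rw [hr 7 (by simp), hs.zero]
  have h22 : s₁.reg 22 = 3 := by rw [hr 22 (by simp), hs.three]
  have hmap : s₁.map = s.map := by
    simp [RamState.map, harr, hr 1 (by simp)]
  have hconf : s₁.config = s.config := by
    simp [config, hmap, harr, hr 2 (by simp), hr 6 (by simp)]
  -- It suffices to follow the branching part: the final moves to the next arrival are the same in
  -- all cases.
  have key : ∀ s₂ : RamState,
      (RamProgram.ite 11 5 arriveNew (.ite 13 5 arriveFirst arriveNext)).run s₁ = s₂ →
      ({ s₂.config with cur := s.map.face (s.reg 2), prev := s.reg 2 } : HalfEdgeMap.Config) =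
        s.config.step → (∀ r ∈ [0, 2, 3, 4, 5, 7, 10, 22], s₂.reg r = s₁.reg r) →
      (arrive.run s).config = s.config.step ∧ (arrive.run s).Constants ∧
      (arrive.run s).reg 0 = s.reg 0 ∧ (arrive.run s).reg 3 = s.reg 3 + 1 ∧
      (arrive.run s).reg 4 = s.reg 4 := by
    intro s₂ h₂ hc hreg
    have e2 : s₂.reg 2 = s.reg 2 := by rw [hreg 2 (by simp), hr 2 (by simp)]
    have e0 : s₂.reg 0 = s.reg 0 := by rw [hreg 0 (by simp), hr 0 (by simp)]
    have e3 : s₂.reg 3 = s.reg 3 := by rw [hreg 3 (by simp), hr 3 (by simp)]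
    have e4 : s₂.reg 4 = s.reg 4 := by rw [hreg 4 (by simp), hr 4 (by simp)]
    have e5 : s₂.reg 5 = 1 := by rw [hreg 5 (by simp), h5]
    have e7 : s₂.reg 7 = 0 := by rw [hreg 7 (by simp), h7]
    have e10 : s₂.reg 10 = s.map.face (s.reg 2) := by rw [hreg 10 (by simp), h10]
    have e22 : s₂.reg 22 = 3 := by rw [hreg 22 (by simp), h22]
    rw [← hc, show arrive.run s = ((copy 6 2).seq ((copy 2 10).seq (.add 3 3 5))).run s₂ by
      rw [← h₂, ← h₁]; rfl]
    refine ⟨?_, ⟨?_, ?_, ?_⟩, ?_, ?_, ?_⟩ <;>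
      simp [run, copy, config, RamState.map, e0, e2, e3, e4, e5, e7, e10, e22]
  have hput : ∀ (s₂ : RamState) (k a b c : ℕ), a ≠ 25 → b ≠ 25 → c ≠ 25 →
      (RamProgram.ite 11 5 arriveNew (.ite 13 5 arriveFirst arriveNext)).run s₁ =
        (put k a b c).run s₂ → (∀ r ∈ [0, 2, 3, 4, 5, 7, 9, 10, 22], s₂.reg r = s₁.reg r) →
      ({ s₂.config with
        kind := Function.update s₂.config.kind (s.map.head (s.reg 2)) k
        a := Function.update s₂.config.a (s.map.head (s.reg 2)) (s₂.reg a)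
        b := Function.update s₂.config.b (s.map.head (s.reg 2)) (s₂.reg b)
        c := Function.update s₂.config.c (s.map.head (s.reg 2)) (s₂.reg c)
        cur := s.map.face (s.reg 2), prev := s.reg 2 } : HalfEdgeMap.Config) =
        s.config.step → (arrive.run s).config = s.config.step ∧ (arrive.run s).Constants ∧
      (arrive.run s).reg 0 = s.reg 0 ∧ (arrive.run s).reg 3 = s.reg 3 + 1 ∧
      (arrive.run s).reg 4 = s.reg 4 := by
    intro s₂ k a b c ha hb hc hrun hreg hconf
    obtain ⟨s₃, h₃, hc₃, hr₃⟩ := run_put (s := s₂) (k := k) ha hb hc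
    refine key s₃ (hrun.trans h₃) ?_ ?_
    · rw [← hconf, hc₃, hreg 9 (by simp), h9]
    · intro r hr'
      rw [hr₃ r (by rintro rfl; simp at hr'), hreg r (by simp at hr' ⊢; tauto)]
  by_cases hu : s.arr 7 (s.map.head (s.reg 2)) < 1
  · by_cases hf : s.map.face (s.reg 2) = s.map.rev (s.reg 2)
    · refine hput ((s₁.setReg 30 (s.map.rev (s.reg 2) + 1)).setArr 7 (s.map.head (s.reg 2))
        (s.map.rev (s.reg 2) + 1)) 2 2 2 2 (by simp) (by simp) (by simp) ?_ ?_ ?_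
      · simp [run, arriveNew, h5, h11, hu, run_ifEq, h8, h9, h10, hf]
      · simp only [List.mem_cons, List.not_mem_nil, or_false]
        rintro r (rfl | rfl | rfl | rfl | rfl | rfl | rfl | rfl | rfl) <;> simp
      · simp [HalfEdgeMap.Config.step, HalfEdgeMap.Config.put, HalfEdgeMap.Config.mark,
          config, hu, hf, harr, hmap, map_setReg, map_setArr, hr 2 (by simp)]
    · refine key ((s₁.setReg 30 (s.map.rev (s.reg 2) + 1)).setArr 7 (s.map.head (s.reg 2))
        (s.map.rev (s.reg 2) + 1)) ?_ ?_ ?_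
      · simp [run, arriveNew, h5, h11, hu, run_ifEq, h8, h9, h10, hf]
      · simp [HalfEdgeMap.Config.step, HalfEdgeMap.Config.mark,
          config, hu, hf, harr, hmap, map_setReg, map_setArr, hr 2 (by simp)]
      · simp only [List.mem_cons, List.not_mem_nil, or_false]
        rintro r (rfl | rfl | rfl | rfl | rfl | rfl | rfl | rfl) <;> simp
  have hu5 : ¬ s₁.reg 11 < s₁.reg 5 := by rwa [h11, h5]
  by_cases hk : s.arr 3 (s.map.head (s.reg 2)) < 1
  · have hk5 : s₁.reg 13 < s₁.reg 5 := by rwa [h13, h5]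
    have hrun : (RamProgram.ite 11 5 arriveNew (.ite 13 5 arriveFirst arriveNext)).run s₁ =
        arriveFirst.run s₁ := by
      simp only [run, if_neg hu5, if_pos hk5]
    rw [hrun] at hput key
    by_cases hf : s.map.face (s.reg 2) + 1 = s.arr 7 (s.map.head (s.reg 2))
    · by_cases hw : s.arr 3 (s.map.tail (s.reg 2)) < 3
      · refine hput (((s₁.setReg 30 (s.map.face (s.reg 2) + 1)).setReg 30
          (s.arr 7 (s.map.head (s.reg 2)) - 1)).setReg 31
          (s.map.rev (s.arr 7 (s.map.head (s.reg 2)) - 1))) 3 31 16 21 (by simp) (by simp) (by simp)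
          ?_ ?_ ?_
        · have hw' : s₁.reg 14 < 3 := by rwa [h14]
          simp [run, arriveFirst, run_ifEq, h10, h5, h11, hf, h22, hw', harr, show s.arr 1 = s.map.rev from rfl]
        · simp only [List.mem_cons, List.not_mem_nil, or_false]
          rintro r (rfl | rfl | rfl | rfl | rfl | rfl | rfl | rfl | rfl) <;> simp
        · simp [HalfEdgeMap.Config.step, HalfEdgeMap.Config.put, hk,
            config, hu, hf, hw, harr, hmap, map_setReg, hr 2 (by simp), h16, h21]
      · obtain ⟨s₂, h₂, hm₂, ha₂, -, hr₂⟩ := run_chord (s := s₁.setReg 30 (s.map.face (s.reg 2) + 1))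
          (x := 21) (y := 2) (by simp [h5]) (by simp [h7]) (by simp)
        refine hput s₂ 2 16 16 24 (by simp) (by simp) (by simp) ?_ ?_ ?_
        · have hw' : ¬ s₁.reg 14 < 3 := by rwa [h14]
          simp [run, arriveFirst, run_ifEq, h10, h5, h11, hf, h22, hw', ← h₂]
        · simp only [List.mem_cons, List.not_mem_nil, or_false]
          rintro r (rfl | rfl | rfl | rfl | rfl | rfl | rfl | rfl | rfl) <;> simp [hr₂]
        · simp [HalfEdgeMap.Config.step, HalfEdgeMap.Config.put, hk,
            config, hu, hf, hw, harr, hmap, hm₂, ha₂, hr₂, map_setReg, hr 2 (by simp), h16, h21, h24]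
    · refine key ((((s₁.setReg 30 (s.map.face (s.reg 2) + 1)).setArr 3 (s.map.head (s.reg 2))
        (s₁.reg 14)).setArr 4 (s.map.head (s.reg 2)) (s₁.reg 16)).setArr 5 (s.map.head (s.reg 2))
        (s₁.reg 24) |>.setArr 6 (s.map.head (s.reg 2)) (s₁.reg 21)) ?_ ?_ ?_
      · simp [run, arriveFirst, run_ifEq, h10, h5, h11, hf, h9]
      · simp [HalfEdgeMap.Config.step, HalfEdgeMap.Config.put, hk, config, hu, hf, harr, hmap,
          map_setReg, map_setArr, h14, h16, h21, h24]
      · simp only [List.mem_cons, List.not_mem_nil, or_false]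
        rintro r (rfl | rfl | rfl | rfl | rfl | rfl | rfl | rfl) <;> simp
  have hk5 : ¬ s₁.reg 13 < s₁.reg 5 := by rwa [h13, h5]
  have hrun : (RamProgram.ite 11 5 arriveNew (.ite 13 5 arriveFirst arriveNext)).run s₁ =
      arriveNext.run s₁ := by
    simp only [run, if_neg hu5, if_neg hk5]
  rw [hrun] at hput
  obtain ⟨s₂, h₂, hm₂, ha₂, h20, hr₂⟩ := run_chord (s := s₁) (x := 15) (y := 16) h5 h7 (by simp)
  have e5 : s₂.reg 5 = 1 := by rw [hr₂ 5 (by simp), h5]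
  have e7 : s₂.reg 7 = 0 := by rw [hr₂ 7 (by simp), h7]
  have e13 : s₂.reg 13 = s₁.reg 13 := by rw [hr₂ 13 (by simp)]
  have e14 : s₂.reg 14 = s₁.reg 14 := by rw [hr₂ 14 (by simp)]
  have h22₂ : s₂.reg 22 = 3 := by rw [hr₂ 22 (by simp), h22]
  by_cases hv : s.arr 3 (s.map.head (s.reg 2)) < 3
  · have hv' : s₁.reg 13 < 3 := by rwa [h13]
    by_cases hw : s.arr 3 (s.map.tail (s.reg 2)) < 3
    · have hw' : s₁.reg 14 < 3 := by rwa [h14]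
      refine hput (s₂.setReg 21 (if s₂.reg 21 = s₂.reg 16 then s₂.reg 20 else s₂.reg 21))
        2 29 23 21 (by simp) (by simp) (by simp) ?_ ?_ ?_
      · simp [run, arriveNext, run_correct, h₂, e7, e13, e14, h22₂, hv', hw']
      · simp only [List.mem_cons, List.not_mem_nil, or_false]
        rintro r (rfl | rfl | rfl | rfl | rfl | rfl | rfl | rfl | rfl) <;> simp [hr₂]
      · simp [HalfEdgeMap.Config.step, HalfEdgeMap.Config.put, hk, config, hu, hv, hw, harr, hmap, hm₂,
          ha₂, hr₂, h20, map_setReg, h15, h16, h21, h23, h29]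
        congr
    · have hw' : ¬ s₁.reg 14 < 3 := by rwa [h14]
      refine hput (s₂.setReg 21 (if s₂.reg 21 = s₂.reg 16 then s₂.reg 20 else s₂.reg 21))
        4 29 24 21 (by simp) (by simp) (by simp) ?_ ?_ ?_
      · simp [run, arriveNext, run_correct, h₂, e7, e13, e14, h22₂, hv', hw']
      · simp only [List.mem_cons, List.not_mem_nil, or_false]
        rintro r (rfl | rfl | rfl | rfl | rfl | rfl | rfl | rfl | rfl) <;> simp [hr₂]
      · simp [HalfEdgeMap.Config.step, HalfEdgeMap.Config.put, hk, config, hu, hv, hw, harr, hmap, hm₂,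
          ha₂, hr₂, h20, map_setReg, h15, h16, h21, h24, h29]
        congr
  · have hv' : ¬ s₁.reg 13 < 3 := by rwa [h13]
    by_cases hw : s.arr 3 (s.map.tail (s.reg 2)) < 3
    · have hw' : s₁.reg 14 < 3 := by rwa [h14]
      refine hput (s₂.setReg 21 (if s₂.reg 21 = s₂.reg 16 then s₂.reg 20 else s₂.reg 21))
        5 29 23 21 (by simp) (by simp) (by simp) ?_ ?_ ?_
      · simp [run, arriveNext, run_correct, h₂, e7, e13, e14, h22₂, hv', hw']
      · simp only [List.mem_cons, List.not_mem_nil, or_false]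
        rintro r (rfl | rfl | rfl | rfl | rfl | rfl | rfl | rfl | rfl) <;> simp [hr₂]
      · simp [HalfEdgeMap.Config.step, HalfEdgeMap.Config.put, hk, config, hu, hv, hw, harr, hmap, hm₂,
          ha₂, hr₂, h20, map_setReg, h15, h16, h21, h23, h29]
        congr
    · have hw' : ¬ s₁.reg 14 < 3 := by rwa [h14]
      obtain ⟨s₃, h₃, hm₃, ha₃, i20, hr₃⟩ := run_chord (s := s₂) (x := 23) (y := 24) e5 e7 (by simp)
      have i7 : s₃.reg 7 = 0 := by rw [hr₃ 7 (by simp), e7]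
      -- Register 20 now names the second chord, whose first half-edge has the number `D + 2`.
      have hD : s₂.map.D = s.map.D + 2 := by rw [hm₂, hmap]; rfl
      refine hput (s₃.setReg 21 (if s₃.reg 21 = s₃.reg 24 then s₃.reg 20 else s₃.reg 21))
        2 29 29 21 (by simp) (by simp) (by simp) ?_ ?_ ?_
      · simp [run, arriveNext, run_correct, h₂, e13, e14, h22₂, hv', hw', h₃, i7]
      · simp only [List.mem_cons, List.not_mem_nil, or_false]
        rintro r (rfl | rfl | rfl | rfl | rfl | rfl | rfl | rfl | rfl) <;> simp [hr₂, hr₃, i20, hD]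
      · simp [HalfEdgeMap.Config.step, HalfEdgeMap.Config.put, hk, config, hu, hv, hw, harr, hmap, hm₂,
          ha₂, hr₂, map_setReg, h15, h16, h21, h23, h24, h29, hr₃, hm₃, ha₃, i20]
        congr

end Exec

/-! ### The whole run of the program -/

section Augment

open RamState RamProgram

variable {s : RamState}

/-- The effect of the last chords. -/
theorem RamProgram.run_close (hs : s.Constants) :
    (close.run s).map = s.config.finish ∧ (close.run s).reg 0 = s.reg 0 := by
  have h5 := hs.one
  have h7 := hs.zero
  obtain ⟨s₁, h₁, harr, hmap, h14, h16, h24, h21, h23, h25, hr⟩ : ∃ s₁, s₁ =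
      ((((((s.setReg 12 (s.map.tail (s.reg 2))).setReg 14 (s.arr 3 (s.map.tail (s.reg 2)))).setReg 16
        (s.arr 4 (s.map.tail (s.reg 2)))).setReg 24 (s.arr 5 (s.map.tail (s.reg 2)))).setReg 21
        (s.arr 6 (s.map.tail (s.reg 2)))).setReg 23 4).setReg 25 5 ∧ s₁.arr = s.arr ∧
      s₁.map = s.map ∧ s₁.reg 14 = s.arr 3 (s.map.tail (s.reg 2)) ∧
      s₁.reg 16 = s.arr 4 (s.map.tail (s.reg 2)) ∧ s₁.reg 24 = s.arr 5 (s.map.tail (s.reg 2)) ∧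
      s₁.reg 21 = s.arr 6 (s.map.tail (s.reg 2)) ∧ s₁.reg 23 = 4 ∧ s₁.reg 25 = 5 ∧
      ∀ r ∈ [0, 1, 2, 5, 6, 7, 22], s₁.reg r = s.reg r := by
    refine ⟨_, rfl, ?_⟩
    simp [map_setReg]
  have hclose : close.run s = (RamProgram.ite 14 22 (.seq (chord 2 16) (chord 2 21)) <|
      .ite 14 23 (.seq (chord 21 6) <| .seq (chord 2 24) (chord 2 21)) <|
      .ite 14 25 (.seq (chord 21 6) <| .seq (chord 2 16) (chord 2 24))
      (.seq (chord 2 16) <| .seq (chord 2 24) (chord 2 21))).run s₁ := by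
    rw [h₁]
    simp [close, run, RamState.map]
  have two : ∀ x₁ y₁ x₂ y₂ : ℕ, (∀ r ∈ [x₁, y₁, x₂, y₂], r ∉ [1, 17, 18, 19, 20, 30, 31]) →
      ∀ s₁ : RamState, s₁.reg 5 = 1 → s₁.reg 7 = 0 →
      ((seq (chord x₁ y₁) (chord x₂ y₂)).run s₁).map =
        (s₁.map.chord (s₁.reg x₁) (s₁.reg y₁)).chord (s₁.reg x₂) (s₁.reg y₂) ∧
      ((seq (chord x₁ y₁) (chord x₂ y₂)).run s₁).reg 0 = s₁.reg 0 := by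
    intro x₁ y₁ x₂ y₂ hr s₁ h5 h7
    obtain ⟨s₂, h₂, hm₂, -, -, hr₂⟩ := run_chord (s := s₁) (x := x₁) h5 h7 (hr y₁ (by simp))
    obtain ⟨s₃, h₃, hm₃, -, -, hr₃⟩ := run_chord (s := s₂) (x := x₂) (by rw [hr₂ 5 (by simp), h5])
      (by rw [hr₂ 7 (by simp), h7]) (hr y₂ (by simp))
    rw [show (seq (chord x₁ y₁) (chord x₂ y₂)).run s₁ = s₃ by rw [← h₃, ← h₂]; rfl, hm₃, hm₂,
      hr₂ x₂ (hr _ (by simp)), hr₂ y₂ (hr _ (by simp)), hr₃ 0 (by simp), hr₂ 0 (by simp)]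
    exact ⟨rfl, rfl⟩
  have three : ∀ x₁ y₁ x₂ y₂ x₃ y₃ : ℕ,
      (∀ r ∈ [x₁, y₁, x₂, y₂, x₃, y₃], r ∉ [1, 17, 18, 19, 20, 30, 31]) →
      ((seq (chord x₁ y₁) (seq (chord x₂ y₂) (chord x₃ y₃))).run s₁).map =
        ((s₁.map.chord (s₁.reg x₁) (s₁.reg y₁)).chord (s₁.reg x₂) (s₁.reg y₂)).chord (s₁.reg x₃)
          (s₁.reg y₃) ∧
      ((seq (chord x₁ y₁) (seq (chord x₂ y₂) (chord x₃ y₃))).run s₁).reg 0 = s₁.reg 0 := by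
    intro x₁ y₁ x₂ y₂ x₃ y₃ hr'
    obtain ⟨s₂, h₂, hm₂, -, -, hr₂⟩ := run_chord (s := s₁) (x := x₁) (by rw [hr 5 (by simp), h5])
      (by rw [hr 7 (by simp), h7]) (hr' y₁ (by simp))
    have := two x₂ y₂ x₃ y₃ (fun r h => hr' r (by simp at h ⊢; tauto)) s₂
      (by rw [hr₂ 5 (by simp), hr 5 (by simp), h5]) (by rw [hr₂ 7 (by simp), hr 7 (by simp), h7])
    rw [show (seq (chord x₁ y₁) (seq (chord x₂ y₂) (chord x₃ y₃))).run s₁ =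
      (seq (chord x₂ y₂) (chord x₃ y₃)).run s₂ by rw [← h₂]; rfl, this.1, this.2, hm₂,
      hr₂ x₂ (hr' _ (by simp)), hr₂ y₂ (hr' _ (by simp)), hr₂ x₃ (hr' _ (by simp)),
      hr₂ y₃ (hr' _ (by simp)), hr₂ 0 (by simp)]
    exact ⟨rfl, rfl⟩
  have e0 := hr 0 (by simp)
  have e2 := hr 2 (by simp)
  have e6 := hr 6 (by simp)
  have e22 := (hr 22 (by simp)).trans hs.three
  rw [hclose]
  by_cases h3 : s.arr 3 (s.map.tail (s.reg 2)) < 3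
  · have := two 2 16 2 21 (by simp) s₁ (by rw [hr 5 (by simp), h5]) (by rw [hr 7 (by simp), h7])
    rw [show ∀ P, (RamProgram.ite 14 22 (.seq (chord 2 16) (chord 2 21)) P).run s₁ =
      (seq (chord 2 16) (chord 2 21)).run s₁ by intro P; simp [run, h14, e22, h3], this.1, this.2]
    simp [config, HalfEdgeMap.Config.finish, h3, hmap, e0, e2, h16, h21]
  rw [show ∀ P Q, (RamProgram.ite 14 22 P Q).run s₁ = Q.run s₁ by
    intro P Q; simp [run, h14, e22, h3]]
  by_cases h4 : s.arr 3 (s.map.tail (s.reg 2)) < 4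
  · rw [show ∀ P Q, (RamProgram.ite 14 23 P Q).run s₁ = P.run s₁ by
      intro P Q; simp [run, h14, h23, h4], (three 21 6 2 24 2 21 (by simp)).1,
      (three 21 6 2 24 2 21 (by simp)).2]
    simp [config, HalfEdgeMap.Config.finish, h3, h4, hmap, e0, e2, e6, h24, h21]
  rw [show ∀ P Q, (RamProgram.ite 14 23 P Q).run s₁ = Q.run s₁ by
    intro P Q; simp [run, h14, h23, h4]]
  by_cases h5' : s.arr 3 (s.map.tail (s.reg 2)) < 5
  · rw [show ∀ P Q, (RamProgram.ite 14 25 P Q).run s₁ = P.run s₁ by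
      intro P Q; simp [run, h14, h25, h5'], (three 21 6 2 16 2 24 (by simp)).1,
      (three 21 6 2 16 2 24 (by simp)).2]
    simp [config, HalfEdgeMap.Config.finish, h3, h4, h5', hmap, e0, e2, e6, h24, h21, h16]
  · rw [show ∀ P Q, (RamProgram.ite 14 25 P Q).run s₁ = Q.run s₁ by
      intro P Q; simp [run, h14, h25, h5'], (three 2 16 2 24 2 21 (by simp)).1,
      (three 2 16 2 24 2 21 (by simp)).2]
    simp [config, HalfEdgeMap.Config.finish, h3, h4, h5', hmap, e0, e2, h24, h21, h16]

/-- A half-edge that is its own successor starts at a leaf; register 2 keeps the last one seen. -/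
theorem RamProgram.run_scan_iterate (h5 : s.reg 5 = 1) (h7 : s.reg 7 = 0) (h3 : s.reg 3 = 0)
    (j : ℕ) : (scan.run^[j] s).arr = s.arr ∧ (scan.run^[j] s).reg 3 = j ∧
      (∀ h < j, s.arr 2 h = h →
        (scan.run^[j] s).reg 2 < j ∧ s.arr 2 ((scan.run^[j] s).reg 2) = (scan.run^[j] s).reg 2) ∧
      ∀ r, r ∉ [2, 3, 8] → (scan.run^[j] s).reg r = s.reg r := by
  induction j with
  | zero => simp [h3]
  | succ j ih =>
    rw [Function.iterate_succ_apply']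
    generalize scan.run^[j] s = s₁ at ih ⊢
    obtain ⟨harr, hj, hleaf, hr⟩ := ih
    have e5 : s₁.reg 5 = 1 := by rw [hr 5 (by simp), h5]
    have e7 : s₁.reg 7 = 0 := by rw [hr 7 (by simp), h7]
    by_cases hl : s.arr 2 j = j
    · have hrun : scan.run s₁ = ((s₁.setReg 8 j).setReg 2 j).setReg 3 (j + 1) := by
        simp [scan, run, run_ifEq, copy, e5, e7, hj, harr, hl]
      rw [hrun]
      refine ⟨by simp [harr], by simp, ?_, ?_⟩
      · intro h _ _
        simp [hl]
      · intro r hr'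
        simp only [List.mem_cons, List.not_mem_nil, or_false, not_or] at hr'
        simp [hr', hr]
    · have hrun : scan.run s₁ = (s₁.setReg 8 (s.arr 2 j)).setReg 3 (j + 1) := by
        simp [scan, run, run_ifEq, e5, hj, harr, hl]
      rw [hrun]
      refine ⟨by simp [harr], by simp, ?_, ?_⟩
      · intro h hh he
        have := hleaf h (by rcases Nat.lt_succ_iff_lt_or_eq.1 hh with h' | rfl; exacts [h', absurd he hl]) he
        simp only [setReg_reg]
        norm_num
        exact ⟨by omega, this.2⟩
      · intro r hr'
        simp only [List.mem_cons, List.not_mem_nil, or_false, not_or] at hr'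
        simp [hr', hr]

theorem RamProgram.run_arrive_iterate (hs : s.Constants) (j : ℕ) :
    (arrive.run^[j] s).config = HalfEdgeMap.Config.step^[j] s.config ∧
      (arrive.run^[j] s).Constants ∧ (arrive.run^[j] s).reg 0 = s.reg 0 ∧
      (arrive.run^[j] s).reg 3 = s.reg 3 + j ∧ (arrive.run^[j] s).reg 4 = s.reg 4 := by
  induction j with
  | zero => exact ⟨rfl, hs, rfl, rfl, rfl⟩
  | succ j ih =>
    rw [Function.iterate_succ_apply', Function.iterate_succ_apply']
    obtain ⟨h1, h2, h3, h4, h5⟩ := ih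
    obtain ⟨i1, i2, i3, i4, i5⟩ := run_arrive h2
    exact ⟨by rw [i1, h1], i2, i3.trans h3, by rw [i4, h4]; rfl, i5.trans h5⟩

/-- The state of the algorithm at the beginning. -/
def HalfEdgeMap.initial (T : HalfEdgeMap) (d : ℕ) : HalfEdgeMap.Config :=
  ⟨T, 0, 0, 0, 0, 0, d, 0⟩

/-- A bound for the steps per half-edge of the program. -/
def RamProgram.rate : ℕ := scan.cost + prepare.cost + arrive.cost + close.cost + 10

/-- The effect of the program. -/
theorem RamProgram.exec_augment {N K : ℕ} (hreg : ∀ r, s.reg r ≤ K) (harr : ∀ A i, s.arr A i ≤ K)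
    (hK : 5 ≤ K) (hN : K + rate * (s.reg 1 + 1) ≤ N) (hzero : ∀ r, 2 ≤ r → s.reg r = 0)
    (hzero' : ∀ A i, 3 ≤ A → s.arr A i = 0) (hleaf : ∃ h < s.reg 1, s.arr 2 h = h) :
    ∃ d < s.reg 1, s.arr 2 d = d ∧ ∃ t s', RamExec N augment s t s' ∧ t ≤ rate * (s.reg 1 + 1) ∧
      s'.reg 0 = s.reg 0 ∧
      s'.map = (HalfEdgeMap.Config.step^[s.reg 1 - 1] (s.map.initial d)).finish := by
  obtain ⟨D, hD⟩ : ∃ D, s.reg 1 = D := ⟨_, rfl⟩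
  obtain ⟨p, hp, hpl⟩ := hleaf
  rw [hD] at hN hp ⊢
  -- The products are expanded and then made opaque, so that the remaining estimates are linear.
  have hrate : rate * (D + 1) = D * scan.cost + D * prepare.cost + D * arrive.cost + D * close.cost
      + D * 10 + scan.cost + prepare.cost + arrive.cost + close.cost + 10 := by
    unfold rate
    ring
  have hD1 : (D - 1) * arrive.cost ≤ D * arrive.cost := Nat.mul_le_mul_right _ (by omega)
  rw [hrate] at hN ⊢
  generalize D * prepare.cost = x₁ at hN ⊢
  generalize D * close.cost = x₂ at hN ⊢
  generalize hx₃ : D * scan.cost = x₃ at hN ⊢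
  generalize D * arrive.cost = x₄ at hN hD1 ⊢
  have hb₀ : (s.setReg 5 1).Bounded K := by
    refine ⟨fun r => ?_, by simpa using harr, by simp⟩
    simp only [setReg_reg]
    split_ifs
    · omega
    · exact hreg r
  have hscan := run_scan_iterate (s := s.setReg 5 1) (by simp) (by simp [hzero]) (by simp [hzero])
  have hreg1 : ∀ j, (scan.run^[j] (s.setReg 5 1)).reg 1 = D := fun j => by
    rw [(hscan j).2.2.2 1 (by simp)]
    simpa using hD
  obtain ⟨hb₁, t₁, ht₁, he₁⟩ := tame_scan.exec_loop (N := N) (a := 3) (b := 1) (k := D) hK hb₀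
    (by omega) (fun j hj => by rw [(hscan j).2.1, hreg1]; exact hj)
    (by rw [(hscan D).2.1, hreg1]; omega)
  obtain ⟨harr₁, -, hl₁, hr₁⟩ := hscan D
  rw [hx₃] at hb₁
  have hD₁ := hreg1 D
  generalize scan.run^[D] (s.setReg 5 1) = s₁ at *
  obtain ⟨hb₂, t₂, ht₂, he₂⟩ := tame_prepare.exec (N := N) (by omega) hb₁ (by omega)
  have e7 : s₁.reg 7 = 0 := by rw [hr₁ 7 (by simp)]; simp [hzero]
  have hrun : prepare.run s₁ = ((s₁.setReg 4 D).setReg 3 1).setReg 22 3 := by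
    simp [prepare, run, copy, e7, hD₁]
  obtain ⟨hl, hl'⟩ := hl₁ p hp (by simpa using hpl)
  have hconf : (prepare.run s₁).config = s.map.initial (s₁.reg 2) := by
    have hz : ∀ A, 3 ≤ A → s.arr A = 0 := fun A hA => funext fun i => hzero' A i hA
    have e6 : s₁.reg 6 = 0 := by rw [hr₁ 6 (by simp)]; simp [hzero]
    rw [hrun]
    simp [config, HalfEdgeMap.initial, RamState.map, harr₁, hz, e6, hD₁, hD]
  have hconst : (prepare.run s₁).Constants := by
    have e5 : s₁.reg 5 = 1 := hb₁.one
    rw [hrun]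
    constructor <;> simp [e5, e7]
  have hreg₂ : (prepare.run s₁).reg 0 = s.reg 0 ∧ (prepare.run s₁).reg 3 = 1 ∧
      (prepare.run s₁).reg 4 = D := by
    rw [hrun]
    simp [hr₁]
  generalize prepare.run s₁ = s₂ at *
  have harrive := run_arrive_iterate hconst
  -- The counter starts at 1: the last of the `D` arrivals, back at the root leaf, is left to the
  -- closing. The limit is read from register 4, because register 1 grows with each chord.
  obtain ⟨hb₃, t₃, ht₃, he₃⟩ := tame_arrive.exec_loop (N := N) (a := 3) (b := 4) (k := D - 1)
    (by omega) hb₂ (by omega)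
    (fun j hj => by rw [(harrive j).2.2.2.1, (harrive j).2.2.2.2, hreg₂.2.1, hreg₂.2.2]; omega)
    (by rw [(harrive _).2.2.2.1, (harrive _).2.2.2.2, hreg₂.2.1, hreg₂.2.2]; omega)
  obtain ⟨hc₃, hk₃, h0₃, -, -⟩ := harrive (D - 1)
  generalize arrive.run^[D - 1] s₂ = s₃ at *
  obtain ⟨-, t₄, ht₄, he₄⟩ := tame_close.exec (N := N) (by omega) hb₃ (by omega)
  obtain ⟨hm₄, h0₄⟩ := run_close hk₃
  refine ⟨s₁.reg 2, hl, by simpa using hl', 1 + (t₁ + (t₂ + (t₃ + t₄))), close.run s₃,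
    .seq (.const _ _ _ (by omega)) (.seq he₁ (.seq he₂ (.seq he₃ he₄))), ?_,
    h0₄.trans (h0₃.trans hreg₂.1), by rw [hm₄, hc₃, hconf]⟩
  rw [Nat.mul_succ] at ht₁ ht₃
  omega

end Augment

/-! ### Plane graphs and half-edge maps -/

/-- `M` is a half-edge list of `G`, with the numbering `num`. -/
structure PlaneGraph.IsMap {n : ℕ} (G : PlaneGraph (Fin n)) (M : HalfEdgeMap)
    (num : Fin M.D ≃ G.graph.Dart) : Prop where
  tail : ∀ h : Fin M.D, M.tail h = (num h).fst
  rev : ∀ h : Fin M.D, M.rev h = num.symm (num h).symm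
  nxt : ∀ h : Fin M.D, M.nxt h = num.symm (G.rot (num h))

theorem RamState.holds_iff {s : RamState} {n : ℕ} {G : PlaneGraph (Fin n)} :
    s.Holds G ↔ s.reg 0 = n ∧ ∃ num, G.IsMap s.map num :=
  ⟨fun ⟨h, num, hn⟩ => ⟨h, num, fun x => (hn x).1, fun x => (hn x).2.1, fun x => (hn x).2.2⟩,
    fun ⟨h, num, hn⟩ => ⟨h, num, fun x => ⟨hn.tail x, hn.rev x, hn.nxt x⟩⟩⟩

namespace PlaneGraph

section IsMap

variable {n : ℕ} {G : PlaneGraph (Fin n)} {M : HalfEdgeMap} {num : Fin M.D ≃ G.graph.Dart}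
  (hM : G.IsMap M num)
include hM

theorem IsMap.nxt_iterate (h : Fin M.D) (k : ℕ) :
    M.nxt^[k] h = num.symm ((G.rot ^ k) (num h)) := by
  induction k with
  | zero => simp
  | succ k ih =>
    rw [Function.iterate_succ_apply', ih, hM.nxt, Equiv.apply_symm_apply, pow_succ',
      Equiv.Perm.mul_apply]

theorem IsMap.head (h : Fin M.D) : M.head h = (num h).snd := by
  rw [HalfEdgeMap.head, hM.rev, hM.tail, Equiv.apply_symm_apply]
  rfl

theorem IsMap.face (h : Fin M.D) : M.face h = num.symm (facePerm G.rot (num h)) := by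
  rw [HalfEdgeMap.face, hM.rev, hM.nxt, Equiv.apply_symm_apply]
  rfl

theorem IsMap.face_iterate (h : Fin M.D) (k : ℕ) :
    M.face^[k] h = num.symm ((facePerm G.rot ^ k) (num h)) := by
  induction k with
  | zero => simp
  | succ k ih =>
    rw [Function.iterate_succ_apply', ih, hM.face, Equiv.apply_symm_apply, pow_succ',
      Equiv.Perm.mul_apply]

theorem IsMap.edge_iff {u v : Fin n} : M.Edge u v ↔ G.graph.Adj u v := by
  constructor
  · rintro ⟨h, hh, hu, hv⟩
    have h1 := hM.tail ⟨h, hh⟩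
    have h2 := hM.head ⟨h, hh⟩
    have h3 := (num ⟨h, hh⟩).adj
    rwa [Fin.ext (h1.symm.trans hu), Fin.ext (h2.symm.trans hv)] at h3
  · intro e
    refine ⟨num.symm ⟨(u, v), e⟩, (num.symm ⟨(u, v), e⟩).2, ?_, ?_⟩
    · rw [hM.tail, Equiv.apply_symm_apply]
    · rw [hM.head, Equiv.apply_symm_apply]

theorem IsMap.isSimpleMap : M.IsSimpleMap n where
  tail_lt h hh := by
    rw [hM.tail ⟨h, hh⟩]
    exact Fin.is_lt _
  rev_lt h hh := by
    rw [hM.rev ⟨h, hh⟩]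
    exact Fin.is_lt _
  nxt_lt h hh := by
    rw [hM.nxt ⟨h, hh⟩]
    exact Fin.is_lt _
  rev_rev h hh := by
    rw [hM.rev ⟨h, hh⟩, hM.rev, Equiv.apply_symm_apply, SimpleGraph.Dart.symm_symm,
      Equiv.symm_apply_apply]
  tail_nxt h hh := by
    rw [hM.nxt ⟨h, hh⟩, hM.tail, Equiv.apply_symm_apply, G.rot_fst, hM.tail ⟨h, hh⟩]
  loopless h hh := by
    rw [hM.tail ⟨h, hh⟩, hM.head ⟨h, hh⟩]
    exact fun e => (num ⟨h, hh⟩).adj.ne (Fin.ext e.symm)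
  simple h hh h' hh' ht hd := by
    rw [hM.tail ⟨h, hh⟩, hM.tail ⟨h', hh'⟩] at ht
    rw [hM.head ⟨h, hh⟩, hM.head ⟨h', hh'⟩] at hd
    have := num.injective (SimpleGraph.Dart.ext _ _ (Prod.ext (Fin.ext ht) (Fin.ext hd)))
    exact congrArg Fin.val this
  cyc h hh h' hh' ht := by
    rw [hM.tail ⟨h, hh⟩, hM.tail ⟨h', hh'⟩] at ht
    have : Finite G.graph.Dart := Finite.of_equiv _ num
    obtain ⟨i, hi⟩ := (G.rot_cyclic _ _ (Fin.ext ht)).exists_nat_pow_eq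
    have h1 : M.nxt^[i] h = h' := by
      rw [hM.nxt_iterate ⟨h, hh⟩, hi, Equiv.symm_apply_apply]
    have h2 : ∀ j, Relation.ReflTransGen (fun a b => M.nxt a = b) h (M.nxt^[j] h) := by
      intro j
      induction j with
      | zero => exact .refl
      | succ j ih => exact ih.tail (Function.iterate_succ_apply' _ _ _).symm
    exact h1 ▸ h2 i

omit hM in
include num in
theorem two_mul_ncard_edgeSet : M.D = 2 * G.graph.edgeSet.ncard := by
  classical
  have h1 : Fintype.card G.graph.Dart = M.D := by
    rw [← Fintype.card_congr num, Fintype.card_fin]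
  rw [← h1, G.graph.dart_card_eq_twice_card_edges, Set.ncard_eq_toFinset_card',
    SimpleGraph.edgeFinset]

end IsMap

end PlaneGraph

/-- Shortest paths from `r` to `a` and to `b`, prolonged to `c`, are both the unique path from `r`
to `c`. -/
theorem SimpleGraph.IsTree.eq_of_dist {V : Type*} {G : SimpleGraph V} (hG : G.IsTree)
    {r a b c : V} (ha : G.Adj a c) (hb : G.Adj b c) (ha' : G.dist r c = G.dist r a + 1)
    (hb' : G.dist r c = G.dist r b + 1) : a = b := by
  obtain ⟨p, -, hp⟩ := hG.connected.exists_path_of_dist r a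
  obtain ⟨q, -, hq⟩ := hG.connected.exists_path_of_dist r b
  have h1 : (p.concat ha).IsPath :=
    Walk.isPath_of_length_eq_dist _ (by rw [Walk.length_concat, hp, ha'])
  have h2 : (q.concat hb).IsPath :=
    Walk.isPath_of_length_eq_dist _ (by rw [Walk.length_concat, hq, hb'])
  have h3 : p.concat ha = q.concat hb :=
    congrArg Subtype.val ((hG.isAcyclic.subsingleton_path r c).elim ⟨_, h1⟩ ⟨_, h2⟩)
  have h4 := congrArg Walk.penultimate h3
  simpa using h4

/-! ### Missing edges, read off the rotation -/

namespace HalfEdgeMap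

variable {M : HalfEdgeMap} {n : ℕ}

/-- The number of edges that are missing at a vertex. -/
def demand (M : HalfEdgeMap) (v : ℕ) : ℕ :=
  if ((Finset.range M.D).filter (M.tail · = v)).card = 1 then 2
  else if ((Finset.range M.D).filter (M.tail · = v)).card = 2 then 1 else 0

/-- The half-edges at a vertex form one orbit of `M.nxt`, so one or two steps tell whether the
degree is 1, 2 or larger. This is the local test that the algorithm uses. -/
theorem IsSimpleMap.demand_tail (hM : M.IsSimpleMap n) {h : ℕ} (hh : h < M.D) :
    M.demand (M.tail h) = if M.nxt h = h then 2 else if M.nxt (M.nxt h) = h then 1 else 0 := by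
  have hn := hM.nxt_lt h hh
  have hreach : ∀ P : ℕ → Prop, P h → (∀ x, P x → P (M.nxt x)) →
      ∀ x < M.D, M.tail x = M.tail h → P x := by
    intro P h0 hP x hx ht
    have := hM.cyc h hh x hx ht.symm
    induction this with
    | refl => exact h0
    | @tail b c hb e ih =>
      have hb' : b < M.D ∧ M.tail b = M.tail h := by
        clear ih e ht hx
        induction hb with
        | refl => exact ⟨hh, rfl⟩
        | tail _ e ih => exact e ▸ ⟨hM.nxt_lt _ ih.1, (hM.tail_nxt _ ih.1).trans ih.2⟩
      exact e ▸ hP b (ih hb'.1 hb'.2)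
  have hcard : ∀ A : Finset ℕ, (∀ x, x ∈ A ↔ x < M.D ∧ M.tail x = M.tail h) →
      ((Finset.range M.D).filter (M.tail · = M.tail h)).card = A.card := by
    intro A hA
    congr 1
    ext x
    simp [hA]
  have ht := hM.tail_nxt h hh
  by_cases h1 : M.nxt h = h
  · rw [if_pos h1, demand, if_pos]
    rw [hcard {h}, Finset.card_singleton]
    intro x
    rw [Finset.mem_singleton]
    refine ⟨?_, fun hx => hreach (· = h) rfl (fun y hy => by rw [hy, h1]) x hx.1 hx.2⟩
    rintro rfl
    exact ⟨hh, rfl⟩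
  rw [if_neg h1]
  by_cases h2 : M.nxt (M.nxt h) = h
  · have h3 : ((Finset.range M.D).filter (M.tail · = M.tail h)).card = 2 := by
      rw [hcard {h, M.nxt h}, Finset.card_pair (Ne.symm h1)]
      intro x
      rw [Finset.mem_insert, Finset.mem_singleton]
      refine ⟨?_, fun hx => hreach (fun y => y = h ∨ y = M.nxt h) (Or.inl rfl) ?_ x hx.1 hx.2⟩
      · rintro (rfl | rfl)
        exacts [⟨hh, rfl⟩, ⟨hn, ht⟩]
      · rintro y (rfl | rfl)
        exacts [Or.inr rfl, Or.inl h2]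
    rw [if_pos h2, demand, h3]
    rfl
  · have hnn := hM.nxt_lt _ hn
    have h4 : M.nxt (M.nxt h) ≠ M.nxt h := fun e => h1 (hM.nxt_inj hn hh e)
    have h3 : 2 < ((Finset.range M.D).filter (M.tail · = M.tail h)).card := by
      refine Finset.two_lt_card.2 ⟨h, by simp [hh], M.nxt h, by simp [hn, ht], M.nxt (M.nxt h),
        by simp [hnn, hM.tail_nxt _ hn, ht], Ne.symm h1, Ne.symm h2, Ne.symm h4⟩
    rw [if_neg h2, demand, if_neg (by omega), if_neg (by omega)]

theorem IsSimpleMap.eq_of_nxt_eq (hM : M.IsSimpleMap n) {d h : ℕ} (hd : d < M.D)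
    (hn : M.nxt d = d) (hh : h < M.D) (ht : M.tail h = M.tail d) : h = d := by
  have := hM.cyc d hd h hh ht.symm
  induction this with
  | refl => rfl
  | @tail b c hb e ih =>
    have hb' : b = d := by
      clear ih e ht hh
      induction hb with
      | refl => rfl
      | tail _ e ih => rw [← e, ih, hn]
    rw [← e, hb', hn]

end HalfEdgeMap

theorem IsClosedWalk.mem {f : ℕ → ℕ} {l : List ℕ} (h : IsClosedWalk f l) {x : ℕ} (hx : x ∈ l) :
    f x ∈ l := by
  obtain ⟨l₁, l₂, rfl⟩ := List.append_of_mem hx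
  cases l₂ with
  | cons y l₂ =>
    rw [IsClosedWalk, List.append_assoc, List.isChain_append] at h
    have := (List.isChain_cons_cons.1 h.2.1).1
    simp [this]
  | nil =>
    cases l₁ with
    | nil =>
      have : f x = x := by simpa [IsClosedWalk] using h
      simp [this]
    | cons z l₁ =>
      have h1 : (z :: l₁ ++ x :: [z]).IsChain (fun a b => f a = b) := by
        simpa [IsClosedWalk] using h
      rw [List.isChain_append] at h1
      have := (List.isChain_cons_cons.1 h1.2.1).1
      simp [this]

theorem IsClosedWalk.reachable {f : ℕ → ℕ} {l : List ℕ} {x y : ℕ} (h : IsClosedWalk f (x :: l))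
    (hy : y ∈ x :: l) : ∃ k, f^[k] x = y := by
  have h1 : (x :: l).IsChain (fun a b => f a = b) := by
    rw [IsClosedWalk, List.isChain_append] at h
    exact h.1
  clear h
  induction l generalizing x with
  | nil => exact ⟨0, by simpa using (List.mem_singleton.1 hy).symm⟩
  | cons z l ih =>
    rw [List.isChain_cons_cons] at h1
    rcases List.mem_cons.1 hy with rfl | hy
    · exact ⟨0, rfl⟩
    · obtain ⟨k, hk⟩ := ih hy h1.2
      exact ⟨k + 1, by rw [Function.iterate_succ_apply, h1.1, hk]⟩

/-! ### Plane trees: one face, and its boundary walk -/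

namespace PlaneGraph

section Tree

variable {n : ℕ} {G : PlaneGraph (Fin n)} {M : HalfEdgeMap} {num : Fin M.D ≃ G.graph.Dart}
  (hM : G.IsMap M num) (hG : G.graph.IsTree)
include hM hG

omit hM in
include num in
theorem two_mul_eq_of_isTree : M.D + 2 = 2 * n := by
  classical
  have h1 := hG.card_edgeFinset
  have h2 := two_mul_ncard_edgeSet (num := num)
  rw [Set.ncard_eq_toFinset_card'] at h2
  rw [SimpleGraph.edgeFinset, Fintype.card_fin] at h1
  omega

theorem IsMap.isRooted (r : Fin n) :
    M.IsRooted n fun v => if hv : v < n then G.graph.dist r ⟨v, hv⟩ else 0 := by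
  have hdep : ∀ v : Fin n, (if hv : (v : ℕ) < n then G.graph.dist r ⟨v, hv⟩ else 0) =
      G.graph.dist r v := fun v => by simp
  refine { hM.isSimpleMap with adj := fun h hh => ?_, parent := fun h hh h' hh' h1 h2 h3 => ?_ }
  · rw [hM.head ⟨h, hh⟩, hM.tail ⟨h, hh⟩, hdep, hdep]
    exact (hG.dist_eq_dist_add_one_of_adj r (num ⟨h, hh⟩).adj).symm
  · rw [hM.head ⟨h, hh⟩, hM.tail ⟨h, hh⟩, hdep, hdep] at h1
    rw [hM.head ⟨h', hh'⟩, hM.tail ⟨h', hh'⟩, hdep, hdep] at h2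
    rw [hM.head ⟨h, hh⟩, hM.head ⟨h', hh'⟩] at h3
    rw [hM.tail ⟨h, hh⟩, hM.tail ⟨h', hh'⟩]
    have h4 := Fin.ext h3
    have h5 := (num ⟨h', hh'⟩).adj
    rw [← h4] at h2 h5
    exact congrArg Fin.val (hG.eq_of_dist (num ⟨h, hh⟩).adj h5 h1 h2)

/-- A tree has `n - 1` edges and one component, so Euler's formula leaves room for a single boundary
walk. -/
theorem IsMap.face_transitive {x y : ℕ} (hx : x < M.D) (hy : y < M.D) :
    ∃ k, M.face^[k] x = y := by
  classical
  have hfin : Finite G.graph.Dart := Finite.of_equiv _ num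
  have h1 := G.euler
  have h2 := two_mul_eq_of_isTree (num := num) hG
  have h3 := two_mul_ncard_edgeSet (num := num)
  have h4 : Nat.card G.graph.ConnectedComponent = 1 := by
    have := hG.connected.preconnected.subsingleton_connectedComponent
    have : Nonempty G.graph.ConnectedComponent := hG.connected.nonempty.map G.graph.connectedComponentMk
    exact Nat.card_eq_one_iff_unique.2 ⟨inferInstance, inferInstance⟩
  rw [h4, Nat.card_fin] at h1
  unfold boundaryWalkCount at h1
  have hne : Nonempty (Quotient (Equiv.Perm.SameCycle.setoid (facePerm G.rot))) :=
    ⟨Quotient.mk _ (num ⟨x, hx⟩)⟩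
  have h5 : 0 < Nat.card (Quotient (Equiv.Perm.SameCycle.setoid (facePerm G.rot))) := Nat.card_pos
  have h6 : Nat.card (Quotient (Equiv.Perm.SameCycle.setoid (facePerm G.rot))) = 1 := by omega
  obtain ⟨hs, -⟩ := Nat.card_eq_one_iff_unique.1 h6
  have h7 : (facePerm G.rot).SameCycle (num ⟨x, hx⟩) (num ⟨y, hy⟩) :=
    Quotient.exact (hs.elim (Quotient.mk _ (num ⟨x, hx⟩)) (Quotient.mk _ (num ⟨y, hy⟩)))
  obtain ⟨k, hk⟩ := h7.exists_nat_pow_eq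
  exact ⟨k, by rw [hM.face_iterate ⟨x, hx⟩, hk, Equiv.symm_apply_apply]⟩

theorem IsMap.exists_leaf (hn : 2 ≤ n) : ∃ d < M.D, M.nxt d = d := by
  classical
  have : Nontrivial (Fin n) := Fin.nontrivial_iff_two_le.2 hn
  obtain ⟨v, hv⟩ := hG.exists_vert_degree_one_of_nontrivial
  obtain ⟨u, hu, hu'⟩ := SimpleGraph.degree_eq_one_iff_existsUnique_adj.1 hv
  have hall : ∀ e : G.graph.Dart, e.fst = v → e = ⟨(v, u), hu⟩ := by
    rintro ⟨⟨p, q⟩, e⟩ rfl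
    have := hu' q e
    subst this
    rfl
  refine ⟨num.symm ⟨(v, u), hu⟩, Fin.is_lt _, ?_⟩
  rw [hM.nxt, Equiv.apply_symm_apply, hall (G.rot ⟨(v, u), hu⟩) (G.rot_fst _)]

/-- The boundary walk of a plane tree, from a leaf on. -/
theorem IsMap.exists_walk (hn : 2 ≤ n) {d : ℕ} (hd : d < M.D) (hl : M.nxt d = d) :
    ∃ S l, M.Shape M.demand d none S l ∧ l.length = M.D - 1 ∧ S.card = n - 1 ∧ M.tail d ∉ S ∧
      insert (M.tail d) S = Finset.range n ∧ M.IsPlane n M (l ++ [M.rev d]) [] := by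
  have hS := hM.isSimpleMap
  have htd := hS.tail_lt d hd
  have hhd : M.head d < n := hS.tail_lt _ (hS.rev_lt d hd)
  have hR := hM.isRooted hG ⟨M.tail d, htd⟩
  set dep : ℕ → ℕ := fun v => if hv : v < n then G.graph.dist ⟨M.tail d, htd⟩ ⟨v, hv⟩ else 0
  have hdt : dep (M.tail d) = 0 := by simp [dep, htd]
  have hdh : dep (M.head d) = dep (M.tail d) + 1 := by
    refine (hR.adj d hd).resolve_right fun h => ?_
    omega
  obtain ⟨S, l, hSh, hdesc⟩ := hR.exists_shape (dem := M.demand) ((Finset.range n).sup dep)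
    (fun v hv => Finset.le_sup (f := dep) (Finset.mem_range.2 hv))
    (fun h hh => hS.demand_tail hh) ((Finset.range n).sup dep + 1) d hd hdh (by omega)
  have hrS : M.tail d ∉ S := fun h => by
    have := HalfEdgeMap.IsDescendant.dep_le (hdesc _ h)
    omega
  have hSn : S ⊆ (Finset.range n).erase (M.tail d) := by
    intro v hv
    refine Finset.mem_erase.2 ⟨fun h => hrS (h ▸ hv), Finset.mem_range.2 ?_⟩
    have h1 := hdesc v hv
    clear hv
    induction h1 with
    | refl => exact hhd
    | tail _ e _ =>
      obtain ⟨⟨h, hh, -, rfl⟩, -⟩ := e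
      exact hS.tail_lt _ (hS.rev_lt h hh)
  have hcard := Finset.card_le_card hSn
  rw [Finset.card_erase_of_mem (Finset.mem_range.2 htd), Finset.card_range] at hcard
  have hlen := hSh.card
  have hD := two_mul_eq_of_isTree (num := num) hG
  obtain ⟨l', rfl⟩ := hSh.exists_cons
  have hwalk : IsClosedWalk M.face (d :: l' ++ [M.rev d]) := by
    have h1 := hSh.isChain hS
    have h2 : M.face (M.rev d) = d := by rw [HalfEdgeMap.face, hS.rev_rev d hd, hl]
    simp only [Option.elim_none, List.cons_append] at h1
    simp only [IsClosedWalk, List.cons_append, List.take_succ_cons, List.take_zero,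
      List.append_assoc, List.nil_append]
    rw [← List.cons_append, List.isChain_split]
    exact ⟨h1, by simp [h2]⟩
  -- A closed walk along the faces contains every half-edge, as there is only one face.
  have hmem : ∀ x < M.D, x ∈ d :: l' ++ [M.rev d] := by
    intro x hx
    obtain ⟨k, rfl⟩ := hM.face_transitive hG hd hx
    clear hx
    induction k with
    | zero => simp
    | succ k ih =>
      rw [Function.iterate_succ_apply']
      exact hwalk.mem ih
  have hsub : Finset.range M.D ⊆ (d :: l' ++ [M.rev d]).toFinset := fun x hx => by
    rw [List.mem_toFinset]
    exact hmem x (Finset.mem_range.1 hx)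
  have h1 := Finset.card_le_card hsub
  rw [Finset.card_range] at h1
  have h2 := List.toFinset_card_le (d :: l' ++ [M.rev d])
  have h3 : (d :: l' ++ [M.rev d]).length = (d :: l').length + 1 := by simp
  -- The walk has at most `M.D` entries because `S` omits the root, and it lists all `M.D`
  -- half-edges; hence there is no repetition, and `S` is everything but the root.
  have hnd : (d :: l' ++ [M.rev d]).Nodup :=
    Multiset.coe_nodup.1 (Multiset.toFinset_card_eq_card_iff_nodup.1 (by
      change (d :: l' ++ [M.rev d]).toFinset.card = (d :: l' ++ [M.rev d]).length
      omega))
  refine ⟨S, d :: l', hSh, by omega, by omega, hrS, ?_, ?_⟩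
  · refine Finset.eq_of_subset_of_card_le ?_ ?_
    · intro v hv
      rcases Finset.mem_insert.1 hv with rfl | hv
      · exact Finset.mem_range.2 htd
      · exact Finset.mem_of_mem_erase (hSn hv)
    · rw [Finset.card_insert_of_notMem hrS, Finset.card_range]
      omega
  · have hlt := hSh.mem_lt hS hd
    have hrd := hS.rev_lt d hd
    exact
      { hS, HalfEdgeMap.Extends.refl M with
        nodup := by simpa using hnd
        mem := fun x => by
          refine ⟨fun hx => ?_, fun hx => by simpa using hmem x hx⟩
          rcases List.mem_append.1 (by simpa using hx : x ∈ (d :: l') ++ [M.rev d]) with h | h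
          · exact hlt x h
          · exact List.mem_singleton.1 h ▸ hrd
        outer_ne := by simp
        outer := hwalk
        inner := by simp
        euler := by simp only [List.length_nil]; omega
        first := fun h hh => .here rfl (hS.nxt_lt h hh) }

/-- The algorithm works. -/
theorem IsMap.isGoal (hn : 4 ≤ n) {d : ℕ} (hd : d < M.D) (hl : M.nxt d = d) :
    HalfEdgeMap.IsGoal M n (∑ v ∈ Finset.range n, M.demand v) (Set.Iio n)
      (HalfEdgeMap.Config.step^[M.D - 1] (M.initial d)).finish := by
  obtain ⟨S, l, hSh, hlen, hcard, hr, hV, hP⟩ := hM.exists_walk hG (by omega) hd hl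
  have hS := hM.isSimpleMap
  have hleaf : ∀ x, M.Edge (M.tail d) x → x = M.head d := by
    rintro x ⟨h, hh, ht, rfl⟩
    rw [hS.eq_of_nxt_eq hd hl hh ht]
  have hvis := hSh.visits hS hd (M.initial d) [] [] [] hP rfl
    (fun _ _ => ⟨rfl, rfl⟩) (fun _ _ _ h => h)
  rw [hlen] at hvis
  have h1 := HalfEdgeMap.Visited.finish hS hd hvis rfl hr (by omega) hleaf
  have h2 : M.demand (M.tail d) = 2 := by rw [hS.demand_tail hd, if_pos hl]
  -- The summand 2 of the closing is the demand of the root, which is a leaf.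
  have h3 : ∑ v ∈ S, M.demand v + 2 = ∑ v ∈ Finset.range n, M.demand v := by
    rw [← hV, Finset.sum_insert hr, h2, add_comm]
  have h4 : insert (M.tail d) (S : Set ℕ) = Set.Iio n := by
    rw [← Finset.coe_insert, hV]
    ext
    simp
  rwa [h3, h4] at h1

end Tree

end PlaneGraph

/-! ### From half-edge maps back to plane graphs -/

namespace HalfEdgeMap

section ToPlaneGraph

variable {T M : HalfEdgeMap} {n : ℕ} {W : List ℕ} {F : List (List ℕ)}

/-- The underlying graph. -/
def toGraph (M : HalfEdgeMap) {n : ℕ} (hM : M.IsSimpleMap n) : SimpleGraph (Fin n) where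
  Adj u v := M.Edge u v
  symm := ⟨fun _ _ h => hM.edge_symm _ _ h⟩
  loopless := ⟨fun _ ⟨h, hh, h1, h2⟩ => hM.loopless h hh (h2.trans h1.symm)⟩

/-- The half-edges as darts. -/
noncomputable def dartEquiv (M : HalfEdgeMap) {n : ℕ} (hM : M.IsSimpleMap n) :
    Fin M.D ≃ (M.toGraph hM).Dart :=
  Equiv.ofBijective
    (fun h => ⟨(⟨M.tail h, hM.tail_lt h h.2⟩, ⟨M.head h, hM.tail_lt _ (hM.rev_lt h h.2)⟩),
      ⟨h, h.2, rfl, rfl⟩⟩) (by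
    constructor
    · intro h h' e
      have e := congrArg SimpleGraph.Dart.toProd e
      have e1 := congrArg (fun p => (p.1 : ℕ)) e
      have e2 := congrArg (fun p => (p.2 : ℕ)) e
      exact Fin.ext (hM.simple h h.2 h' h'.2 e1 e2)
    · rintro ⟨⟨u, v⟩, h, hh, h1, h2⟩
      refine ⟨⟨h, hh⟩, SimpleGraph.Dart.ext _ _ (Prod.ext (Fin.ext h1) (Fin.ext h2))⟩)

/-- The rotation of the half-edges. -/
noncomputable def nxtPerm (M : HalfEdgeMap) {n : ℕ} (hM : M.IsSimpleMap n) :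
    Equiv.Perm (Fin M.D) :=
  Equiv.ofBijective (fun h => ⟨M.nxt h, hM.nxt_lt h h.2⟩)
    (Finite.injective_iff_bijective.1 fun a b h =>
      Fin.ext (hM.nxt_inj a.2 b.2 (congrArg Fin.val h)))

/-- The rotation of the darts. -/
noncomputable def dartRot (M : HalfEdgeMap) {n : ℕ} (hM : M.IsSimpleMap n) :
    Equiv.Perm (M.toGraph hM).Dart :=
  (M.dartEquiv hM).permCongr (M.nxtPerm hM)

theorem dartRot_dartEquiv (hM : M.IsSimpleMap n) (h : Fin M.D) :
    M.dartRot hM (M.dartEquiv hM h) = M.dartEquiv hM ⟨M.nxt h, hM.nxt_lt h h.2⟩ := by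
  rw [dartRot, Equiv.permCongr_apply, Equiv.symm_apply_apply]
  rfl

theorem dartEquiv_rev (hM : M.IsSimpleMap n) (h : Fin M.D) :
    M.dartEquiv hM ⟨M.rev h, hM.rev_lt h h.2⟩ = (M.dartEquiv hM h).symm := by
  refine SimpleGraph.Dart.ext _ _ (Prod.ext (Fin.ext ?_) (Fin.ext ?_))
  · rfl
  · exact hM.head_rev h.2

theorem face_lt (hM : M.IsSimpleMap n) {h : ℕ} (hh : h < M.D) : M.face h < M.D :=
  hM.nxt_lt _ (hM.rev_lt h hh)

theorem facePerm_dartEquiv (hM : M.IsSimpleMap n) (h : Fin M.D) :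
    facePerm (M.dartRot hM) (M.dartEquiv hM h) = M.dartEquiv hM ⟨M.face h, face_lt hM h.2⟩ := by
  change M.dartRot hM (M.dartEquiv hM h).symm = _
  rw [← dartEquiv_rev, dartRot_dartEquiv]
  rfl

theorem sameCycle_face (hM : M.IsSimpleMap n) (h : Fin M.D) (k : ℕ) :
    ∃ hk : M.face^[k] h < M.D, (facePerm (M.dartRot hM)).SameCycle (M.dartEquiv hM h)
      (M.dartEquiv hM ⟨M.face^[k] h, hk⟩) := by
  induction k with
  | zero => exact ⟨h.2, .refl _ _⟩
  | succ k ih =>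
    obtain ⟨hk, hc⟩ := ih
    have h1 : M.face^[k + 1] h = M.face (M.face^[k] h) := Function.iterate_succ_apply' _ _ _
    refine ⟨h1 ▸ face_lt hM hk, ?_⟩
    have h2 := Equiv.Perm.sameCycle_apply_right.2 hc
    rw [facePerm_dartEquiv] at h2
    convert h2 using 3

/-- The boundary walks of the faces correspond to the cycles of the face permutation. -/
theorem HasFaces.card_cycles (hM : M.IsSimpleMap n) (hF : M.HasFaces n W F) :
    Nat.card (Quotient (Equiv.Perm.SameCycle.setoid (facePerm (M.dartRot hM)))) = F.length + 1 := by
  have hfin : Finite (M.toGraph hM).Dart := Finite.of_equiv _ (M.dartEquiv hM)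
  have hwalk : ∀ l ∈ W :: F, l ≠ [] ∧ IsClosedWalk M.face l := by
    intro l hl
    rcases List.mem_cons.1 hl with rfl | hl
    · exact ⟨hF.outer_ne, hF.outer⟩
    · exact hF.inner l hl
  have hnd : (W :: F).flatten.Nodup := by simpa using hF.nodup
  have hmem : ∀ x, x ∈ (W :: F).flatten ↔ x < M.D := fun x => by simpa using hF.mem x
  have hlt : ∀ i : Fin (W :: F).length, ∃ x : Fin M.D, ∃ l', (W :: F)[i] = (x : ℕ) :: l' := by
    intro i
    have hi : (W :: F)[i] ∈ W :: F := List.getElem_mem _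
    obtain ⟨x, l', e⟩ := List.exists_cons_of_ne_nil (hwalk _ hi).1
    refine ⟨⟨x, (hmem x).1 (List.mem_flatten.2 ⟨_, hi, by rw [e]; simp⟩)⟩, l', e⟩
  choose x l' hx using hlt
  rw [show F.length + 1 = Nat.card (Fin (W :: F).length) by simp]
  refine (Nat.card_congr (Equiv.ofBijective
    (fun i => Quotient.mk (Equiv.Perm.SameCycle.setoid (facePerm (M.dartRot hM)))
      (M.dartEquiv hM (x i))) ⟨?_, ?_⟩)).symm
  -- A cycle of the face permutation never leaves the list it starts in, and the lists are disjoint.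
  · intro i j hij
    have h1 : (facePerm (M.dartRot hM)).SameCycle (M.dartEquiv hM (x i)) (M.dartEquiv hM (x j)) :=
      Quotient.exact hij
    obtain ⟨k, hk⟩ := h1.exists_nat_pow_eq
    have h2 : ∀ k, ∃ y : Fin M.D, (facePerm (M.dartRot hM) ^ k) (M.dartEquiv hM (x i)) =
        M.dartEquiv hM y ∧ (y : ℕ) ∈ (W :: F)[i] := by
      intro k
      induction k with
      | zero => exact ⟨x i, rfl, by rw [hx]; simp⟩
      | succ k ih =>
        obtain ⟨y, hy, hy'⟩ := ih
        refine ⟨⟨M.face y, face_lt hM y.2⟩, ?_, (hwalk _ (List.getElem_mem _)).2.mem hy'⟩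
        rw [pow_succ', Equiv.Perm.mul_apply, hy, facePerm_dartEquiv]
    obtain ⟨y, hy, hy'⟩ := h2 k
    have h3 : x j = y := (M.dartEquiv hM).injective (hk.symm.trans hy)
    have h4 : (x j : ℕ) ∈ (W :: F)[j] := by rw [hx]; simp
    by_contra hne
    have h5 := (List.nodup_flatten.1 hnd).2
    rw [List.pairwise_iff_getElem] at h5
    rcases lt_or_gt_of_ne hne with h | h
    · exact h5 i j i.2 j.2 h hy' (h3 ▸ h4)
    · exact h5 j i j.2 i.2 h (h3 ▸ h4) hy'
  · intro q
    obtain ⟨e, rfl⟩ := Quotient.exists_rep q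
    obtain ⟨h, rfl⟩ := (M.dartEquiv hM).surjective e
    obtain ⟨l, hl, hhl⟩ := List.mem_flatten.1 ((hmem h).2 h.2)
    obtain ⟨i, hi, rfl⟩ := List.mem_iff_getElem.1 hl
    refine ⟨⟨i, hi⟩, Quotient.sound ?_⟩
    have h1 : (W :: F)[i] = (x ⟨i, hi⟩ : ℕ) :: l' ⟨i, hi⟩ := hx ⟨i, hi⟩
    have h2 := (hwalk _ hl).2
    rw [h1] at h2 hhl
    obtain ⟨k, hk⟩ := h2.reachable hhl
    obtain ⟨hk', hc⟩ := sameCycle_face hM (x ⟨i, hi⟩) k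
    have h3 : (⟨M.face^[k] (x ⟨i, hi⟩), hk'⟩ : Fin M.D) = h := Fin.ext hk
    rw [h3] at hc
    exact hc

/-- A half-edge map with the right number of faces, as a plane graph. -/
noncomputable def toPlaneGraph (M : HalfEdgeMap) {n : ℕ} {W : List ℕ} {F : List (List ℕ)}
    (hM : M.IsSimpleMap n) (hF : M.HasFaces n W F) (hc : (M.toGraph hM).Connected)
    (hn : 2 ≤ n) : PlaneGraph (Fin n) where
  graph := M.toGraph hM
  rot := M.dartRot hM
  rot_fst d := by
    obtain ⟨h, rfl⟩ := (M.dartEquiv hM).surjective d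
    rw [dartRot_dartEquiv]
    exact Fin.ext (hM.tail_nxt h h.2)
  rot_cyclic d e hde := by
    obtain ⟨h, rfl⟩ := (M.dartEquiv hM).surjective d
    obtain ⟨h', rfl⟩ := (M.dartEquiv hM).surjective e
    have h1 := hM.cyc h h.2 h' h'.2 (congrArg Fin.val hde)
    have h2 : ∀ q, Relation.ReflTransGen (fun a b => M.nxt a = b) h q → ∃ hq : q < M.D,
        (M.dartRot hM).SameCycle (M.dartEquiv hM h) (M.dartEquiv hM ⟨q, hq⟩) := by
      intro q hq
      induction hq with
      | refl => exact ⟨h.2, .refl _ _⟩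
      | tail _ e ih =>
        obtain ⟨hq, hc⟩ := ih
        subst e
        refine ⟨hM.nxt_lt _ hq, ?_⟩
        have h2 := Equiv.Perm.sameCycle_apply_right.2 hc
        rwa [dartRot_dartEquiv] at h2
    exact (h2 h' h1).2
  euler := by
    have hne : Nonempty (Fin n) := hc.nonempty
    have : Nontrivial (Fin n) := Fin.nontrivial_iff_two_le.2 hn
    have h1 : {v : Fin n | ∀ u, ¬ (M.toGraph hM).Adj v u} = ∅ := by
      ext v
      simp only [Set.mem_ofPred_eq, Set.mem_empty_iff_false, iff_false, not_forall, not_not]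
      exact hc.preconnected.exists_adj_of_nontrivial v
    have h2 : Nat.card (M.toGraph hM).ConnectedComponent = 1 := by
      have := hc.preconnected.subsingleton_connectedComponent
      have : Nonempty (M.toGraph hM).ConnectedComponent :=
        hne.map (M.toGraph hM).connectedComponentMk
      exact Nat.card_eq_one_iff_unique.2 ⟨inferInstance, inferInstance⟩
    have h3 : M.D = 2 * (M.toGraph hM).edgeSet.ncard := by
      classical
      have h1 : Fintype.card (M.toGraph hM).Dart = M.D := by
        rw [← Fintype.card_congr (M.dartEquiv hM), Fintype.card_fin]
      rw [← h1, SimpleGraph.dart_card_eq_twice_card_edges, Set.ncard_eq_toFinset_card',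
        SimpleGraph.edgeFinset]
    have h4 := hF.euler
    rw [boundaryWalkCount, hF.card_cycles hM, h1, h2, Set.ncard_empty, Nat.card_fin]
    omega

theorem isMap_toPlaneGraph (hM : M.IsSimpleMap n) (hF : M.HasFaces n W F)
    (hc : (M.toGraph hM).Connected) (hn : 2 ≤ n) :
    (M.toPlaneGraph hM hF hc hn).IsMap M (M.dartEquiv hM) where
  tail h := rfl
  rev h := by
    change M.rev h = ((M.dartEquiv hM).symm (M.dartEquiv hM h).symm : ℕ)
    rw [← dartEquiv_rev hM h, Equiv.symm_apply_apply]
  nxt h := by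
    change M.nxt h = ((M.dartEquiv hM).symm (M.dartRot hM (M.dartEquiv hM h)) : ℕ)
    rw [dartRot_dartEquiv, Equiv.symm_apply_apply]

end ToPlaneGraph

end HalfEdgeMap

/-! ### The augmentation -/

theorem FirstBelow.exists_iterate {f : ℕ → ℕ} {B h t : ℕ} (hf : FirstBelow f B h t) :
    ∃ k, 0 < k ∧ f^[k] h = t ∧ ∀ j, 0 < j → j < k → B ≤ f^[j] h := by
  induction hf with
  | here e _ => exact ⟨1, one_pos, e, fun j h0 h1 => by omega⟩
  | skip hB _ ih =>
    obtain ⟨k, hk, e, hj⟩ := ih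
    refine ⟨k + 1, by omega, by rwa [Function.iterate_succ_apply], fun j h0 h1 => ?_⟩
    obtain ⟨i, rfl⟩ : ∃ i, j = i + 1 := ⟨j - 1, by omega⟩
    rw [Function.iterate_succ_apply]
    rcases Nat.eq_zero_or_pos i with rfl | hi
    · exact hB
    · exact hj i hi (by omega)

/-! ### Degrees and the lower bound -/

namespace SimpleGraph

variable {n : ℕ}

theorem degreeCount_eq_sum (G : SimpleGraph (Fin n)) (i : ℕ) :
    G.degreeCount i = ∑ v, if (G.neighborSet v).ncard = i then 1 else 0 := by
  classical
  rw [degreeCount, ← Finset.card_filter, ← Set.ncard_coe_finset]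
  congr 1
  ext v
  simp

theorem augmentationBound_eq (G : SimpleGraph (Fin n)) : G.augmentationBound =
    ⌈((∑ v, if (G.neighborSet v).ncard = 1 then 2 else
      if (G.neighborSet v).ncard = 2 then 1 else 0 : ℕ) : ℚ) / 2⌉ := by
  have h : (∑ v, if (G.neighborSet v).ncard = 1 then 2 else
      if (G.neighborSet v).ncard = 2 then 1 else 0) = 2 * G.degreeCount 1 + G.degreeCount 2 := by
    rw [degreeCount_eq_sum, degreeCount_eq_sum, Finset.mul_sum, ← Finset.sum_add_distrib]
    refine Finset.sum_congr rfl fun v _ => ?_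
    split_ifs <;> omega
  rw [h, augmentationBound]
  push_cast
  rfl

theorem sum_ncard_neighborSet (G : SimpleGraph (Fin n)) :
    ∑ v, (G.neighborSet v).ncard = 2 * G.edgeSet.ncard := by
  classical
  rw [Set.ncard_eq_toFinset_card', ← edgeFinset, ← sum_degrees_eq_twice_card_edges]
  refine Finset.sum_congr rfl fun v _ => ?_
  rw [Set.ncard_eq_toFinset_card', ← card_neighborSet_eq_degree, Set.toFinset_card]

/-- Fewer than three neighbours could all be removed, which would isolate `v` while some other
vertex remains. -/
theorem IsKConnected.three_le_ncard {H : SimpleGraph (Fin n)} (hH : H.IsKConnected 3)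
    (v : Fin n) : 3 ≤ (H.neighborSet v).ncard := by
  classical
  by_contra! hlt
  have hcard := hH.1
  rw [Nat.card_fin] at hcard
  rw [Set.ncard_eq_toFinset_card'] at hlt
  have hc := hH.2 (H.neighborSet v).toFinset hlt
  have h1 : (insert v (H.neighborSet v).toFinset).card < n :=
    (Finset.card_insert_le _ _).trans_lt (by omega)
  obtain ⟨u, hu⟩ : ∃ u, u ∉ insert v (H.neighborSet v).toFinset := by
    by_contra! h
    rw [(Finset.eq_univ_iff_forall.2 h), Finset.card_univ, Fintype.card_fin] at h1
    omega
  rw [Finset.mem_insert, not_or] at hu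
  have hv : v ∈ ((H.neighborSet v).toFinset : Set (Fin n))ᶜ := by simp
  have hu' : u ∈ ((H.neighborSet v).toFinset : Set (Fin n))ᶜ := by simpa using hu.2
  have : Nontrivial ↥((H.neighborSet v).toFinset : Set (Fin n))ᶜ :=
    ⟨⟨⟨v, hv⟩, ⟨u, hu'⟩, fun e => hu.1 (congrArg Subtype.val e).symm⟩⟩
  obtain ⟨⟨x, hx⟩, hvx⟩ := hc.preconnected.exists_adj_of_nontrivial ⟨v, hv⟩
  have hvx : H.Adj v x := hvx
  simp [hvx] at hx

/-- The lower bound. -/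
theorem IsKConnected.augmentationBound_le {T H : SimpleGraph (Fin n)} (hT : T ≤ H)
    (hH : H.IsKConnected 3) :
    T.augmentationBound ≤ (H.edgeSet.ncard : ℤ) - T.edgeSet.ncard := by
  have h1 := sum_ncard_neighborSet H
  have h2 := sum_ncard_neighborSet T
  -- At each vertex, the degree in `T` plus the demand is at most the degree in `H`; a degree 0 in
  -- `T` is harmless, since it is counted without demand.
  have h3 : ∑ v, ((T.neighborSet v).ncard + if (T.neighborSet v).ncard = 1 then 2 else
      if (T.neighborSet v).ncard = 2 then 1 else 0) ≤ ∑ v, (H.neighborSet v).ncard := by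
    refine Finset.sum_le_sum fun v _ => ?_
    have h4 := hH.three_le_ncard v
    have h5 : (T.neighborSet v).ncard ≤ (H.neighborSet v).ncard :=
      Set.ncard_le_ncard fun u hu => hT hu
    split_ifs <;> omega
  rw [Finset.sum_add_distrib, h1, h2] at h3
  rw [augmentationBound_eq, Int.ceil_le, div_le_iff₀ (by norm_num)]
  have h4 : ((2 * T.edgeSet.ncard + ∑ v, if (T.neighborSet v).ncard = 1 then 2 else
      if (T.neighborSet v).ncard = 2 then 1 else 0 : ℕ) : ℚ) ≤ (2 * H.edgeSet.ncard : ℕ) := by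
    exact_mod_cast h3
  push_cast at h4 ⊢
  linarith

end SimpleGraph

namespace PlaneGraph

variable {n : ℕ} {T : PlaneGraph (Fin n)} {M N : HalfEdgeMap} {num : Fin M.D ≃ T.graph.Dart}
  (hM : T.IsMap M num)
include hM

theorem IsMap.demand (v : Fin n) : M.demand v = if (T.graph.neighborSet v).ncard = 1 then 2 else
    if (T.graph.neighborSet v).ncard = 2 then 1 else 0 := by
  have h : ((Finset.range M.D).filter (M.tail · = v)).card = (T.graph.neighborSet v).ncard := by
    rw [← Set.ncard_coe_finset]
    refine Set.ncard_congr (fun h hh => (num ⟨h, by simp at hh; exact hh.1⟩).snd) ?_ ?_ ?_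
    · intro h hh
      simp only [Finset.coe_filter, Finset.mem_range, Set.mem_ofPred_eq] at hh
      have h1 := (num ⟨h, hh.1⟩).adj
      rwa [Fin.ext ((hM.tail ⟨h, hh.1⟩).symm.trans hh.2)] at h1
    · intro h h' hh hh' e
      simp only [Finset.coe_filter, Finset.mem_range, Set.mem_ofPred_eq] at hh hh'
      refine hM.isSimpleMap.simple h hh.1 h' hh'.1 (hh.2.trans hh'.2.symm) ?_
      rw [hM.head ⟨h, hh.1⟩, hM.head ⟨h', hh'.1⟩, e]
    · intro u hu
      have hu : T.graph.Adj v u := hu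
      refine ⟨num.symm ⟨(v, u), hu⟩, ?_, ?_⟩
      · simp [hM.tail]
      · simp
  rw [HalfEdgeMap.demand, h]

/-- The half-edges of `T` keep their numbers and are exactly those below `M.D`, so `FirstBelow` is
the first return of the rotation to `T`. -/
theorem IsMap.isSpanningSubgraph {G : PlaneGraph (Fin n)} {num' : Fin N.D ≃ G.graph.Dart}
    (hN : G.IsMap N num') (hE : M.Extends N)
    (hfirst : ∀ h < M.D, FirstBelow N.nxt M.D h (M.nxt h)) : T.IsSpanningSubgraph G := by
  have hS := hM.isSimpleMap
  have hle : T.graph ≤ G.graph := fun u v e =>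
    hN.edge_iff.1 (hE.edge hS.rev_lt (hM.edge_iff.2 e))
  have hdart : ∀ h : Fin M.D, dartOfLE hle (num h) = num' ⟨h, h.2.trans_le hE.le⟩ := by
    intro h
    refine SimpleGraph.Dart.ext _ _ (Prod.ext (Fin.ext ?_) (Fin.ext ?_))
    · have h1 := hM.tail h
      have h2 := hN.tail ⟨h, h.2.trans_le hE.le⟩
      rw [← h2, hE.tail h h.2, h1]
      rfl
    · have h1 := hM.head h
      have h2 := hN.head ⟨h, h.2.trans_le hE.le⟩
      rw [← h2, hE.head h.2 (hS.rev_lt h h.2), h1]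
      rfl
  refine ⟨hle, fun d => ?_⟩
  obtain ⟨h, rfl⟩ := num.surjective d
  obtain ⟨k, hk, he, hj⟩ := (hfirst h h.2).exists_iterate
  have hit : ∀ j, N.nxt^[j] h = num'.symm ((G.rot ^ j) (dartOfLE hle (num h))) := fun j => by
    rw [hdart]
    exact hN.nxt_iterate ⟨h, h.2.trans_le hE.le⟩ j
  refine ⟨k, hk, ?_, ?_⟩
  · rw [hit, hM.nxt] at he
    have h1 := hdart (num.symm (T.rot (num h)))
    rw [Equiv.apply_symm_apply] at h1
    rw [h1, ← Equiv.symm_apply_eq]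
    exact Fin.ext he
  · rintro j h0 hjk ⟨e, he⟩
    have h1 := hj j h0 hjk
    have h2 := hdart (num.symm e)
    rw [Equiv.apply_symm_apply, he] at h2
    rw [hit, h2, Equiv.symm_apply_apply] at h1
    exact absurd (num.symm e).2 (not_lt.2 h1)

-- Allowing `x = y` covers the removal of a single vertex too; the removal of none is the hypothesis
-- `hG`.
omit hM in
theorem isKConnected_three {G : SimpleGraph (Fin n)} (hn : 4 ≤ n) (hG : G.Connected)
    {E : ℕ → ℕ → Prop} (hE : ∀ u v : Fin n, E u v ↔ G.Adj u v)
    (hc : ∀ x ∈ Set.Iio n, ∀ y ∈ Set.Iio n, ∀ C, ClosedIn E (Set.Iio n \ {x, y}) C →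
      ∀ z ∈ Set.Iio n, z ≠ x → z ≠ y → z ∈ C → ∀ t ∈ Set.Iio n, t ≠ x → t ≠ y → t ∈ C) :
    G.IsKConnected 3 := by
  classical
  refine ⟨by rw [Nat.card_fin]; omega, fun X hX => ?_⟩
  have hmain : ∀ x y : Fin n, X = {x, y} → (G.induce (X : Set (Fin n))ᶜ).Connected := by
    intro x y hxy
    have hmem : ∀ v : Fin n, v ∈ (X : Set (Fin n))ᶜ ↔ (v : ℕ) ≠ x ∧ (v : ℕ) ≠ y := by
      intro v
      simp [hxy, Fin.ext_iff]
    obtain ⟨u, hu⟩ : ∃ u, u ∉ X := by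
      by_contra! h
      rw [(Finset.eq_univ_iff_forall.2 h), Finset.card_univ, Fintype.card_fin] at hX
      omega
    refine @SimpleGraph.Connected.mk _ _ ?_ ⟨⟨u, by simpa using hu⟩⟩
    rintro ⟨z, hz⟩ ⟨t, ht⟩
    -- The closed set is the component of `z` after the removal.
    have h1 := hc x x.2 y y.2 {v | ∃ (hv : v < n) (hv' : (⟨v, hv⟩ : Fin n) ∈ (X : Set (Fin n))ᶜ),
      (G.induce (X : Set (Fin n))ᶜ).Reachable ⟨z, hz⟩ ⟨⟨v, hv⟩, hv'⟩} ?_ z z.2 ((hmem z).1 hz).1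
      ((hmem z).1 hz).2 ⟨z.2, hz, .refl _⟩ t t.2 ((hmem t).1 ht).1 ((hmem t).1 ht).2
    · obtain ⟨_, _, h2⟩ := h1
      exact h2
    · rintro p q e - ⟨hq, hqX⟩ ⟨hp, hpX, hr⟩
      have hqX' : (⟨q, hq⟩ : Fin n) ∈ (X : Set (Fin n))ᶜ := by
        rw [hmem]
        simpa using hqX
      refine ⟨hq, hqX', hr.trans (SimpleGraph.Adj.reachable ?_)⟩
      exact (hE ⟨p, hp⟩ ⟨q, hq⟩).1 e
  rcases (show X.card = 0 ∨ X.card = 1 ∨ X.card = 2 by omega) with h | h | h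
  · rw [Finset.card_eq_zero.1 h, Finset.coe_empty, Set.compl_empty]
    exact (SimpleGraph.induceUnivIso G).connected_iff.2 hG
  · obtain ⟨x, rfl⟩ := Finset.card_eq_one.1 h
    exact hmain x x (by simp)
  · obtain ⟨x, y, -, rfl⟩ := Finset.card_eq_two.1 h
    exact hmain x y rfl

theorem IsMap.exists_augmentation (hT : T.graph.IsTree) (hn : 4 ≤ n)
    (hN : HalfEdgeMap.IsGoal M n (∑ v ∈ Finset.range n, M.demand v) (Set.Iio n) N) :
    ∃ (G : PlaneGraph (Fin n)) (num' : Fin N.D ≃ G.graph.Dart), G.IsMap N num' ∧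
      T.IsAugmentation G := by
  obtain ⟨W, F, hP⟩ := hN.plane
  have hS := hP.toIsSimpleMap
  have hle : T.graph ≤ N.toGraph hS := fun u v e =>
    hP.edge hM.isSimpleMap.rev_lt (hM.edge_iff.2 e)
  have hc := hT.connected.mono hle
  have hG := HalfEdgeMap.isMap_toPlaneGraph hS hP.toHasFaces hc (by omega)
  refine ⟨_, _, hG, hM.isSpanningSubgraph hG hP.toExtends hP.first,
    isKConnected_three hn hc (E := N.Edge) (fun u v => hG.edge_iff) hN.closed, ?_⟩
  have h1 := two_mul_ncard_edgeSet (num := num)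
  have h2 := two_mul_ncard_edgeSet (num := N.dartEquiv hS)
    (G := N.toPlaneGraph hS hP.toHasFaces hc (by omega))
  have h3 := hN.count
  rw [Finset.sum_range, Finset.sum_congr rfl fun v _ => hM.demand v] at h3
  -- Twice the number of new edges is the total demand, or one more than it; either way it is the
  -- demand halved and rounded up.
  rw [SimpleGraph.augmentationBound_eq, eq_comm, Int.ceil_eq_iff]
  generalize (∑ v, if (T.graph.neighborSet v).ncard = 1 then 2 else
    if (T.graph.neighborSet v).ncard = 2 then 1 else 0) = m at h3 ⊢
  rw [h1, h2] at h3
  push_cast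
  rcases h3 with h3 | h3
  · have h4 : ((2 * (N.toPlaneGraph hS hP.toHasFaces hc (by omega)).graph.edgeSet.ncard : ℕ) : ℚ)
      = (2 * T.graph.edgeSet.ncard + m : ℕ) := by exact_mod_cast h3
    push_cast at h4
    constructor <;> linarith
  · have h4 : ((2 * (N.toPlaneGraph hS hP.toHasFaces hc (by omega)).graph.edgeSet.ncard : ℕ) : ℚ)
      = (2 * T.graph.edgeSet.ncard + m + 1 : ℕ) := by exact_mod_cast h3
    push_cast at h4
    constructor <;> linarith

end PlaneGraph

/-- The program augments every plane tree. -/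
theorem RamProgram.augment_correct {n : ℕ} (hn : 4 ≤ n) {T : PlaneGraph (Fin n)}
    (hT : T.graph.IsTree) {s : RamState} (hs : s.IsInput T) :
    ∃ (t : ℕ) (s' : RamState) (G : PlaneGraph (Fin n)),
      RamExec ((2 + 2 * rate) * n) augment s t s' ∧ t ≤ 2 * rate * n ∧ s'.Holds G ∧
        T.IsAugmentation G := by
  obtain ⟨hholds, hreg, harr⟩ := hs
  obtain ⟨h0, num, hM⟩ := RamState.holds_iff.1 hholds
  have hS := hM.isSimpleMap
  have hD : s.reg 1 + 2 = 2 * n := PlaneGraph.two_mul_eq_of_isTree (num := num) hT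
  have hreg' : ∀ r, s.reg r ≤ 2 * n := by
    intro r
    match r with
    | 0 => omega
    | 1 => omega
    | r + 2 => rw [hreg _ (by omega)]; omega
  have harr' : ∀ A i, s.arr A i ≤ 2 * n := by
    intro A i
    by_cases h : 3 ≤ A ∨ s.reg 1 ≤ i
    · rw [harr A i h]
      omega
    · have hi : i < s.map.D := by
        change i < s.reg 1
        omega
      have hD' : s.map.D = s.reg 1 := rfl
      have h1 : s.arr 0 i < n := hS.tail_lt i hi
      have h2 : s.arr 1 i < s.map.D := hS.rev_lt i hi
      have h3 : s.arr 2 i < s.map.D := hS.nxt_lt i hi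
      rcases (show A = 0 ∨ A = 1 ∨ A = 2 by omega) with rfl | rfl | rfl <;> omega
  have hrate : rate * (s.reg 1 + 1) ≤ 2 * rate * n := by
    calc rate * (s.reg 1 + 1) ≤ rate * (2 * n) := Nat.mul_le_mul_left _ (by omega)
      _ = 2 * rate * n := by ring
  obtain ⟨d, hd, hl, t, s', hexec, ht, h0', hmap⟩ := exec_augment (N := (2 + 2 * rate) * n)
    hreg' harr' (by omega) (by rw [add_mul]; omega) hreg (fun A i hA => harr A i (Or.inl hA))
    (hM.exists_leaf hT (by omega))
  have hgoal := hM.isGoal hT hn hd hl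
  change HalfEdgeMap.IsGoal _ _ _ _
    (HalfEdgeMap.Config.step^[s.reg 1 - 1] (s.map.initial d)).finish at hgoal
  rw [← hmap] at hgoal
  obtain ⟨G, num', hG, haug⟩ := hM.exists_augmentation hT hn hgoal
  exact ⟨t, s', G, hexec, ht.trans hrate, RamState.holds_iff.2 ⟨h0'.trans h0, num', hG⟩, haug⟩

/-- Any numbering of the half-edges gives an initial memory. This lets the existence of an
augmentation be read off a run of the program. -/
theorem PlaneGraph.exists_isInput {n : ℕ} (T : PlaneGraph (Fin n)) :
    ∃ s : RamState, s.IsInput T := by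
  classical
  let e := (Fintype.equivFin T.graph.Dart).symm
  refine ⟨⟨fun r => match r with
      | 0 => n
      | 1 => Fintype.card T.graph.Dart
      | _ => 0, fun A i => if hi : i < Fintype.card T.graph.Dart then match A with
      | 0 => (e ⟨i, hi⟩).fst
      | 1 => e.symm (e ⟨i, hi⟩).symm
      | 2 => e.symm (T.rot (e ⟨i, hi⟩))
      | _ => 0 else 0⟩, ⟨rfl, e, fun h => ?_⟩, ?_, ?_⟩
  · have hh : (h : ℕ) < Fintype.card T.graph.Dart := h.2
    simp only [hh, dif_pos]
    exact ⟨rfl, rfl, rfl⟩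
  · intro r hr
    match r, hr with
    | r + 2, _ => rfl
  · rintro A i (hA | hi)
    · match A, hA with
      | A + 3, _ => simp
    · have hi : ¬ i < Fintype.card T.graph.Dart := not_lt.2 hi
      simp [hi]

theorem mainTheorem8 :
    (∀ n : ℕ, 4 ≤ n → ∀ T : PlaneGraph (Fin n), T.graph.IsTree →
      (∃ G : PlaneGraph (Fin n), T.IsAugmentation G) ∧
      (∀ H : SimpleGraph (Fin n), T.graph ≤ H → H.IsKConnected 3 →
        T.graph.augmentationBound ≤ (H.edgeSet.ncard : ℤ) - T.graph.edgeSet.ncard)) ∧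
    (∃ (P : RamProgram) (c w : ℕ), ∀ n : ℕ, 4 ≤ n →
      ∀ T : PlaneGraph (Fin n), T.graph.IsTree → ∀ s : RamState, s.IsInput T →
        ∃ (t : ℕ) (s' : RamState) (G : PlaneGraph (Fin n)),
          RamExec (w * n) P s t s' ∧ t ≤ c * n ∧ s'.Holds G ∧ T.IsAugmentation G) := by
  refine ⟨fun n hn T hT => ⟨?_, fun H hTH hH => hH.augmentationBound_le hTH⟩,
    RamProgram.augment, 2 * RamProgram.rate, 2 + 2 * RamProgram.rate,
    fun n hn T hT s hs => RamProgram.augment_correct hn hT hs⟩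
  obtain ⟨s, hs⟩ := T.exists_isInput
  obtain ⟨_, _, G, _, _, _, h⟩ := RamProgram.augment_correct hn hT hs
  exact ⟨G, h⟩
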